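/- Theorem 1.2 (The forced Navier–Stokes problem near Couette flow). Let $\mathbb T=\mathbb R/2\pi\mathbb Z$, let $\nu>0$, and write $L^2=L^2(\mathbb T\times\mathbb R)$ (real-valued), $H^s=H^s(\mathbb T\times\mathbb R)$. Solutions of the linear equations below are weak solutions in $C([0,\infty);L^2)$; solutions of the nonlinear evolution are weak solutions in $C([0,\infty);L^2)\cap L^2_{loc}([0,\infty);H^1)$; stationary solutions are weak solutions in $H^1$. **(1) Linearized problem, resonant forcing.** There is a constant $C_\nu>0$ depending only on $\nu$ such that the following holds. Let $\omega_0,f_0\in L^2$ with $\int\omega_0\,dx=0=\int f_0\,dx$, and let $\omega$ solve $$\partial_t\omega+y\,\partial_x\omega-\nu\Delta\omega=f_0(x-ty,y),\qquad \omega|_{t=0}=\omega_0 .$$ Then there is a decomposition $\omega(t,x,y)=\omega_1(t,x-ty,y)+\omega_2(t,x-ty,y)$ such that for all $t\ge0$ $$e^{\nu t^3/12}\,\|\omega_1(t)\|_{L^2}+\|\omega_2(t)\|_{L^2}\le C_\nu\big(\|\omega_0\|_{L^2}+\|f_0\|_{L^2}\big),$$ so $\omega_1$ exhibits enhanced dissipation,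 while $\omega_2$ decays, but only algebraically: $\|\omega_2(t)\|_{L^2}\to0$ as $t\to\infty$; if $f_0\in H^s$ with $s\ge0$, then $\|\omega_2(t)\|_{L^2}\le C_\nu(1+t)^{-\min(s,2)}\|f_0\|_{H^s}$ for all $t\ge0$; and if $f_0\ne0$, there is $c>0$ with $\|\omega_2(t)\|_{L^2}\ge c\,t^{-2}$ for all $t\ge1$. **(2) Linearized problem, stationary forcing.** Let $f_0\in L^2$ with $\int f_0\,dx=0$. Then there is a stationary solution $g\in H^1$ of $y\,\partial_xg-\nu\Delta g=f_0$ such that every solution $\omega$ of $\partial_t\omega+y\,\partial_x\omega-\nu\Delta\omega=f_0$ with initial data $\omega_0\in L^2$, $\int\omega_0\,dx=0$, satisfies, for all $t\ge0$, $$\|\omega(t)-g\|_{L^2}\le \exp\!\big(-\nu(t+\tfrac{t^3}{12})\big)\,\|\omega_0-g\|_{L^2}.$$ **(3) Nonlinear problem, small stationary forcing.** Let $(\cdot)_{\ne}$ be the $L^2$ projection onto functions with vanishing $x$-average, and for $u\in L^2$ with vanishing $x$-average let $v[u]=\nabla^\perp\phi=(-\partial_y\phi,\partial_x\phi)$, where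 $\Delta\phi=u$ and $\phi$ has vanishing $x$-average. Let $f\in L^2$ be time-independent with $\int f\,dx=0$ and $\|f\|_{L^2}\le\nu^2/40$. Then there is a stationary solution $g\in H^1$ with vanishing $x$-average of $$y\,\partial_xg-\nu\Delta g+(v[g]\cdot\nabla g)_{\ne}=f$$ such that every global solution $\omega$ with vanishing $x$-average of $$\partial_t\omega+y\,\partial_x\omega-\nu\Delta\omega+(v[\omega]\cdot\nabla\omega)_{\ne}=f,\qquad \omega|_{t=0}=\omega_0,$$ can be written $\omega=g+\omega^\star$ with $\|\omega^\star(t)\|_{L^2}\le e^{-\nu t/2}\,\|\omega_0-g\|_{L^2}$ for all $t\ge0$. -/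

import Mathlib

open MeasureTheory Set Filter Topology
open scoped ENNReal Real FourierTransform

noncomputable section

namespace Couette

instance instFactTwoPiPos : Fact (0 < 2 * π) := ⟨Real.two_pi_pos⟩

/-- The torus `ℝ / 2πℤ`. -/
abbrev Torus : Type := AddCircle (2 * π)

/-- The infinite periodic channel `𝕋 × ℝ`; its measure is `dx dy`, with total mass `2π` in `x`. -/
abbrev Channel : Type := Torus × ℝ

/-- Real-valued `L²` on the channel. -/
abbrev L2 : Type := Lp ℝ 2 (volume : Measure Channel)

/-! ### Test functions and partial derivatives -/

/-- The classical partial derivative in `x`. -/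
def dx (u : Channel → ℝ) (p : Channel) : ℝ := deriv (fun s : ℝ => u (p.1 + (s : Torus), p.2)) 0

/-- The classical partial derivative in `y`. -/
def dy (u : Channel → ℝ) (p : Channel) : ℝ := deriv (fun s : ℝ => u (p.1, s)) p.2

/-- The classical Laplacian. -/
def lap (u : Channel → ℝ) (p : Channel) : ℝ := dx (dx u) p + dy (dy u) p

/-- Test functions: smooth (as `2π`-periodic functions on `ℝ × ℝ`) with compact support. -/
structure IsTest (ψ : Channel → ℝ) : Prop where
  smooth : ContDiff ℝ (⊤ : ℕ∞) (fun q : ℝ × ℝ => ψ ((q.1 : Torus), q.2))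
  compact_support : HasCompactSupport ψ

/-- `u ∈ H¹`, with weak gradient `(ux, uy) ∈ L²`. -/
structure HasWeakGrad (u ux uy : L2) : Prop where
  weak_dx : ∀ ψ : Channel → ℝ, IsTest ψ → ∫ p, u p * dx ψ p = - ∫ p, ux p * ψ p
  weak_dy : ∀ ψ : Channel → ℝ, IsTest ψ → ∫ p, u p * dy ψ p = - ∫ p, uy p * ψ p

/-! ### Averages in `x` and the shear -/

/-- The `x`-average vanishes: `∫ u(x,y) dx = 0` for almost every `y`. -/
def ZeroXMean (u : L2) : Prop := ∀ᵐ y : ℝ, ∫ x : Torus, u (x, y) = 0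

/-- The projection `h ↦ h_≠ = h - (2π)⁻¹ ∫ h dx` onto functions with vanishing `x`-average. -/
def projNonzero (h : Channel → ℝ) (p : Channel) : ℝ :=
  h p - (2 * π)⁻¹ * ∫ x : Torus, h (x, p.2)

/-- `u` transported by Couette flow for time `t`: the function `(x, y) ↦ u(x - t y, y)`. -/
def shear (t : ℝ) (u : Channel → ℝ) (p : Channel) : ℝ := u (p.1 - ((t * p.2 : ℝ) : Torus), p.2)

/-! ### Sobolev norms of real order -/

theorem aestronglyMeasurable_swap_haar (f : L2) :
    AEStronglyMeasurable (fun q : ℝ × Torus => ((f (q.2, q.1) : ℝ) : ℂ))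
      ((volume : Measure ℝ).prod (AddCircle.haarAddCircle : Measure Torus)) := by
  have h1 : AEStronglyMeasurable (fun q : ℝ × Torus => f (q.2, q.1))
      ((volume : Measure ℝ).prod (volume : Measure Torus)) :=
    AEStronglyMeasurable.prod_swap (f := (f : Channel → ℝ)) (Lp.aestronglyMeasurable f)
  have h2 : (AddCircle.haarAddCircle : Measure Torus) ≪ volume := by
    rw [AddCircle.volume_eq_smul_haarAddCircle]
    exact Measure.absolutelyContinuous_smul (by simp [Real.pi_pos])
  exact Complex.continuous_ofReal.comp_aestronglyMeasurable
    (h1.mono_ac (Measure.AbsolutelyContinuous.rfl.prod h2))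

theorem memLp_mode (f : L2) (k : ℤ) :
    MemLp (fun y : ℝ => fourierCoeff (fun x : Torus => ((f (x, y) : ℝ) : ℂ)) k) 2
      (volume : Measure ℝ) := by
  have hm := aestronglyMeasurable_swap_haar f
  have hk : Continuous (fun q : ℝ × Torus => (fourier (-k) q.2 : ℂ)) :=
    (fourier (T := 2 * π) (-k)).continuous.comp continuous_snd
  refine ⟨(hk.aestronglyMeasurable.smul hm).integral_prod_right', ?_⟩
  rw [eLpNorm_lt_top_iff_lintegral_rpow_enorm_lt_top (by norm_num) (by norm_num)]
  have hslice := hm.prodMk_left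
  have key : ∀ᵐ y : ℝ, ‖fourierCoeff (fun x : Torus => ((f (x, y) : ℝ) : ℂ)) k‖ₑ ^ (2 : ℝ)
      ≤ ∫⁻ x : Torus, ‖f (x, y)‖ₑ ^ (2 : ℝ) ∂AddCircle.haarAddCircle := by
    filter_upwards [hslice] with y hy
    have e1 : ‖fourierCoeff (fun x : Torus => ((f (x, y) : ℝ) : ℂ)) k‖ₑ
        ≤ eLpNorm (fun x : Torus => ((f (x, y) : ℝ) : ℂ)) 1 AddCircle.haarAddCircle := by
      rw [eLpNorm_one_eq_lintegral_enorm]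
      refine (enorm_integral_le_lintegral_enorm _).trans (lintegral_mono fun x => ?_)
      rw [enorm_smul]
      have : ‖(fourier (-k) x : ℂ)‖ₑ = 1 := by
        rw [← ofReal_norm, fourier_apply, Circle.norm_coe, ENNReal.ofReal_one]
      rw [this, one_mul]
    have e2 := e1.trans (eLpNorm_le_eLpNorm_of_exponent_le (p := 1) (q := 2) (by norm_num) hy)
    rw [eLpNorm_eq_lintegral_rpow_enorm_toReal (by norm_num) (by norm_num)] at e2
    have e3 := ENNReal.rpow_le_rpow e2 (by norm_num : (0 : ℝ) ≤ 2)
    rw [← ENNReal.rpow_mul] at e3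
    have e4 : ∀ r : ℝ, ‖(r : ℂ)‖ₑ = ‖r‖ₑ := fun r => by
      rw [← ofReal_norm, ← ofReal_norm, Complex.norm_real]
    simpa [e4] using e3
  simp only [ENNReal.toReal_ofNat]
  refine (lintegral_mono_ae key).trans_lt ?_
  have hfin := (eLpNorm_lt_top_iff_lintegral_rpow_enorm_lt_top (by norm_num) (by norm_num)).1
    (Lp.eLpNorm_lt_top f)
  have hmeas : AEMeasurable (fun p : Channel => ‖f p‖ₑ ^ (2 : ℝ)) volume :=
    (Lp.aestronglyMeasurable f).enorm.pow_const _
  simp only [ENNReal.toReal_ofNat] at hfin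
  have hsym : ∫⁻ p : Channel, ‖f p‖ₑ ^ (2 : ℝ) = ∫⁻ y : ℝ, ∫⁻ x : Torus, ‖f (x, y)‖ₑ ^ (2 : ℝ) :=
    lintegral_prod_symm _ hmeas
  rw [hsym] at hfin
  refine lt_of_le_of_lt (b := (ENNReal.ofReal (2 * π))⁻¹ *
    ∫⁻ y : ℝ, ∫⁻ x : Torus, ‖f (x, y)‖ₑ ^ (2 : ℝ)) ?_
    (ENNReal.mul_lt_top (ENNReal.inv_lt_top.2 (by simp [Real.pi_pos])) hfin)
  rw [← lintegral_const_mul' _ _ (ENNReal.inv_ne_top.2 (by simp [Real.pi_pos]))]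
  refine lintegral_mono fun y => ?_
  rw [AddCircle.volume_eq_smul_haarAddCircle, lintegral_smul_measure, smul_eq_mul, ← mul_assoc,
    ENNReal.inv_mul_cancel (by simp [Real.pi_pos]) ENNReal.ofReal_ne_top, one_mul]

/-- The `k`-th Fourier mode in `x`, `y ↦ (2π)⁻¹ ∫ f(x,y) e^{-ikx} dx`, as an element of `L²(ℝ)`. -/
def mode (f : L2) (k : ℤ) : Lp ℂ 2 (volume : Measure ℝ) := (memLp_mode f k).toLp _

/-- The `H^s` norm `(∑_k ∫ (1 + k² + η²)^s |f̂(k,η)|² dη)^{1/2}`, normalised so that `s = 0` gives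
the `L²` norm; Mathlib's Plancherel transform in `y` uses the frequency `ξ = η / 2π`. -/
def sobolevENorm (s : ℝ) (f : L2) : ℝ≥0∞ :=
  (ENNReal.ofReal (2 * π) * ∑' k : ℤ, ∫⁻ ξ : ℝ,
    ENNReal.ofReal ((1 + (k : ℝ) ^ 2 + (2 * π * ξ) ^ 2) ^ s) * ‖(𝓕 (mode f k)) ξ‖ₑ ^ 2) ^ (1 / 2 : ℝ)

/-- Membership in `H^s(𝕋 × ℝ)`, for `s ≥ 0`. -/
def MemHs (s : ℝ) (f : L2) : Prop := sobolevENorm s f < ∞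

/-! ### The linearized problem `∂ₜω + y ∂ₓω - νΔω = f` -/

/-- Weak solutions in `C([0,∞); L²)` of `∂ₜω + y ∂ₓω - νΔω = f` with `ω(0) = ω₀`. -/
structure IsLinearSolution (ν : ℝ) (f : ℝ → Channel → ℝ) (ω₀ : L2) (ω : ℝ → L2) : Prop where
  continuousOn : ContinuousOn ω (Ici 0)
  initial : ω 0 = ω₀
  weak : ∀ t : ℝ, 0 ≤ t → ∀ ψ : Channel → ℝ, IsTest ψ →
    (∫ p, ω t p * ψ p) - ∫ p, ω₀ p * ψ p =
      ∫ s in (0 : ℝ)..t,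
        ((∫ p, ω s p * (p.2 * dx ψ p + ν * lap ψ p)) + ∫ p, f s p * ψ p)

/-- Weak solutions `g ∈ H¹` of `y ∂ₓg - νΔg = f`. -/
def IsLinearStationary (ν : ℝ) (f g : L2) : Prop :=
  ∃ gx gy : L2, HasWeakGrad g gx gy ∧ ∀ ψ : Channel → ℝ, IsTest ψ →
    ∫ p, (-(g p * (p.2 * dx ψ p)) + ν * (gx p * dx ψ p + gy p * dy ψ p)) = ∫ p, f p * ψ p

/-! ### The nonlinear problem -/

/-- `v = ∇^⊥φ = (-∂_yφ, ∂_xφ)`, where `φ ∈ H¹` with vanishing `x`-average solves `Δφ = u`. -/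
def IsVelocity (u v₁ v₂ : L2) : Prop :=
  ∃ φ φx φy : L2, HasWeakGrad φ φx φy ∧ ZeroXMean φ ∧
    (∀ ψ : Channel → ℝ, IsTest ψ →
      ∫ p, (φx p * dx ψ p + φy p * dy ψ p) = - ∫ p, u p * ψ p) ∧
    v₁ = -φy ∧ v₂ = φx

/-- The nonlinearity `(v · ∇u)_≠`, for given `v` and `∇u`. -/
def advection (v₁ v₂ ux uy : L2) : Channel → ℝ :=
  projNonzero (fun p => v₁ p * ux p + v₂ p * uy p)

/-- Weak solutions `g ∈ H¹` with vanishing `x`-average of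
`y ∂ₓg - νΔg + (v[g] · ∇g)_≠ = f`. -/
def IsNonlinearStationary (ν : ℝ) (f g : L2) : Prop :=
  ZeroXMean g ∧ ∃ gx gy v₁ v₂ : L2, HasWeakGrad g gx gy ∧ IsVelocity g v₁ v₂ ∧
    ∀ ψ : Channel → ℝ, IsTest ψ →
      ∫ p, (-(g p * (p.2 * dx ψ p)) + ν * (gx p * dx ψ p + gy p * dy ψ p)
        + advection v₁ v₂ gx gy p * ψ p) = ∫ p, f p * ψ p

/-- Weak solutions, of class `C([0,∞); L²) ∩ L²_loc([0,∞); H¹)` and with vanishing `x`-average, of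
`∂ₜω + y ∂ₓω + (v · ∇ω)_≠ - νΔω = f`, `v = ∇^⊥φ`, `Δφ = ω`, with `ω(0) = ω₀`. -/
structure IsNonlinearSolution (ν : ℝ) (f ω₀ : L2) (ω : ℝ → L2) : Prop where
  continuousOn : ContinuousOn ω (Ici 0)
  initial : ω 0 = ω₀
  zero_mean : ∀ t : ℝ, 0 ≤ t → ZeroXMean (ω t)
  weak : ∃ ωx ωy v₁ v₂ : ℝ → L2,
    (∀ T : ℝ, MemLp ωx 2 (volume.restrict (Icc 0 T)) ∧ MemLp ωy 2 (volume.restrict (Icc 0 T))) ∧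
    (∀ᵐ t ∂(volume.restrict (Ici (0 : ℝ))), HasWeakGrad (ω t) (ωx t) (ωy t)) ∧
    (∀ t : ℝ, 0 ≤ t → IsVelocity (ω t) (v₁ t) (v₂ t)) ∧
    ∀ t : ℝ, 0 ≤ t → ∀ ψ : Channel → ℝ, IsTest ψ →
      (∫ p, ω t p * ψ p) - ∫ p, ω₀ p * ψ p =
        ∫ s in (0 : ℝ)..t,
          ((∫ p, ω s p * (p.2 * dx ψ p + ν * lap ψ p))
            + ∫ p, (f p - advection (v₁ s) (v₂ s) (ωx s) (ωy s) p) * ψ p)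

end Couette

end

open Couette

open MeasureTheory Set Filter Topology
open scoped ENNReal Real FourierTransform

noncomputable section

namespace Couette

open scoped ContDiff SchwartzMap ComplexConjugate InnerProductSpace

/-! In the frame moving with the Couette flow, and on the Fourier side (`k` dual to `x`, `η = 2πξ`
dual to `y`), the operator `∂ₜ + y ∂ₓ - νΔ` becomes a scalar equation at each frequency: `∂ₜû = -ν
(k² + (η - kt)²) û + F̂`. For `k ≠ 0` the damping rate grows like `k²t²` away from the critical time
`η/k`. The rate accumulated over `[s, t]` is exactly `(t - s)(k² + (η - k(t+s)/2)² + k²(t-s)²/12)`,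
the square of a mean plus a variance (`decay_sub`). With `s = 0` it is at least `t + t³/12`; this is
enhanced dissipation.

A resonant force is constant in the moving frame, so Duhamel's formula (`IsWeakSolution.duhamel`)
splits the solution into a damped copy of the data, `ω₁`, and the multiplier `forceMul` applied to
the force, `ω₂`. The multiplier is at most `1/ν`. It is also at most `(32/ν)(1 + k² + η²)/(1 + t)²`:
either `η` is small against `kt`, and the damping rate is of order `t²` at late times, or `η` is
large and the weight pays for it (`forceMul_le_weight`). Interpolation gives the `H^s` rates. No
better rate than `t⁻²` is possible, because what was injected during the last `t⁻²` units of time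
has not yet been damped (`le_forceMul`).

For stationary forcing, `y ∂ₓ` is skew and Poincaré's inequality holds for vanishing `x`-average, so
the stationary form is coercive. The weight `y` is unbounded, hence the use of Lions' projection
theorem (`exists_solution_operator`). The difference between an evolution and the stationary
solution is unforced and decays as above.

For the nonlinear problem, `Δ⁻¹` maps `L²` to `L^∞` with norm at most `1` (`ae_norm_invLap_le`).
Since `∇^⊥Δ⁻¹u = Δ⁻¹∇^⊥u`, the velocity is bounded by the gradient and `v · ∇w` is a bounded
bilinear map from `H¹` to `L²` (`norm_transport_le`). A contraction in a ball of radius `ν/10` gives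
the stationary solution. For the difference with an evolution, the dangerous half of the
nonlinearity drops out by antisymmetry (`inner_transport_self`), the other half is absorbed by
dissipation (`inner_perturbation_le`), and the energy identity (`IsWeakSolution.energy`) with
Gronwall's inequality concludes.

All this has to be derived from weak formulations. Test functions with a single mode reduce them to
identities in `y`, which `fourier_of_weak_identity` turns into pointwise ones in `ξ`. The change to
the moving frame and the derivative of a squared norm both rest on a product rule for curves that
are only absolutely continuous (`diagonal_sub_eq_integral`). Since the symbol is unbounded, the
equation is solved and the energy computed on bands `|ξ| ≤ N`, where multipliers form a Banach
algebra; the band is removed at the end. -/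

section

/-! ### The Fourier transform on `L²(ℝ)` -/

/-- Complex-valued `L²` on the line. -/
abbrev LineL2 : Type := Lp ℂ 2 (volume : Measure ℝ)

/-- The transform on `L²` agrees with that of tempered distributions, which is defined by this
duality. It is the only bridge used between `𝓕 a` and `a`. -/
theorem integral_fourier_mul (a : LineL2) (θ : 𝓢(ℝ, ℂ)) :
    ∫ ξ, (𝓕 a) ξ * θ ξ = ∫ y, a y * (𝓕 θ) y := by
  have h := congrArg (fun T => T θ) (MeasureTheory.Lp.fourier_toTemperedDistribution_eq a)
  simp only [TemperedDistribution.fourier_apply,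
    MeasureTheory.Lp.toTemperedDistribution_apply, smul_eq_mul] at h
  simp_rw [mul_comm _ (θ _), mul_comm _ ((𝓕 θ) _)]
  exact h.symm

theorem integrable_lineL2_mul (a : LineL2) {q : ℝ → ℂ} (hq : MemLp q 2) :
    Integrable (fun y => a y * q y) :=
  MemLp.integrable_mul (p := 2) (q := 2) (Lp.memLp a) hq

/-- A smooth cutoff equal to `1` near the origin. -/
theorem exists_cutoff : ∃ χ : ℝ → ℝ, ContDiff ℝ ∞ χ ∧ HasCompactSupport χ ∧ χ 0 = 1 := by
  obtain ⟨u, -, h₂, h₃, -, h₄⟩ :=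
    exists_contDiff_tsupport_subset (n := ⊤) (x := (0 : ℝ)) (s := univ) univ_mem
  exact ⟨u, h₃, h₂, h₄⟩

theorem exists_norm_le_of_hasCompactSupport {χ : ℝ → ℝ} (h : Continuous χ)
    (hc : HasCompactSupport χ) : ∃ C : ℝ, ∀ y, ‖χ y‖ ≤ C :=
  h.bounded_above_of_compact_support hc

theorem deriv_deriv_mul {f g : ℝ → ℂ} (hf : ContDiff ℝ ∞ f) (hg : ContDiff ℝ ∞ g) (y : ℝ) :
    deriv (deriv (fun y => f y * g y)) y =
      deriv (deriv f) y * g y + 2 * (deriv f y * deriv g y) + f y * deriv (deriv g) y := by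
  have df : Differentiable ℝ f := hf.differentiable (by simp)
  have dg : Differentiable ℝ g := hg.differentiable (by simp)
  have hf' : ContDiff ℝ ∞ (deriv f) := (contDiff_infty_iff_deriv.1 hf).2
  have hg' : ContDiff ℝ ∞ (deriv g) := (contDiff_infty_iff_deriv.1 hg).2
  have df' : Differentiable ℝ (deriv f) := hf'.differentiable (by simp)
  have dg' : Differentiable ℝ (deriv g) := hg'.differentiable (by simp)
  have e : deriv (fun y => f y * g y) = fun y => deriv f y * g y + f y * deriv g y := by
    funext z; exact deriv_fun_mul (df z) (dg z)
  rw [e, deriv_fun_add ((df' y).fun_mul (dg y)) ((df y).fun_mul (dg' y)), deriv_fun_mul (df' y) (dg y),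
    deriv_fun_mul (df y) (dg' y)]
  ring

/-- A second-order identity tested against compactly supported smooth functions extends to
Schwartz functions. -/
theorem weak_identity_schwartz {A₀ A₁ A₂ : LineL2}
    (h : ∀ ρ : ℝ → ℂ, ContDiff ℝ ∞ ρ → HasCompactSupport ρ →
      (∫ y, A₀ y * ρ y) + (∫ y, A₁ y * deriv ρ y) + ∫ y, A₂ y * deriv (deriv ρ) y = 0)
    (ρ : 𝓢(ℝ, ℂ)) :
    (∫ y, A₀ y * ρ y) + (∫ y, A₁ y * deriv ρ y) + ∫ y, A₂ y * deriv (deriv ρ) y = 0 := by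
  obtain ⟨χ, hχ, hχc, hχ0⟩ := exists_cutoff
  have hχ' : ContDiff ℝ ∞ (deriv χ) := (contDiff_infty_iff_deriv.1 hχ).2
  have hχ'' : ContDiff ℝ ∞ (deriv (deriv χ)) := (contDiff_infty_iff_deriv.1 hχ').2
  obtain ⟨C₀, hC₀⟩ := exists_norm_le_of_hasCompactSupport hχ.continuous hχc
  obtain ⟨C₁, hC₁⟩ := exists_norm_le_of_hasCompactSupport hχ'.continuous hχc.deriv
  obtain ⟨C₂, hC₂⟩ := exists_norm_le_of_hasCompactSupport hχ''.continuous hχc.deriv.deriv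
  -- the rescaled cutoffs and their derivatives
  let c : ℕ → ℝ → ℂ := fun n y => ((χ (y / (n + 1)) : ℝ) : ℂ)
  have dχ : Differentiable ℝ χ := hχ.differentiable (by simp)
  have dχ' : Differentiable ℝ (deriv χ) := hχ'.differentiable (by simp)
  have hc1 : ∀ n y, HasDerivAt (c n) (((deriv χ (y / (n + 1)) / (n + 1) : ℝ)) : ℂ) y := fun n y => by
    have h1 : HasDerivAt (fun y : ℝ => y / ((n : ℝ) + 1)) (1 / ((n : ℝ) + 1)) y :=
      (hasDerivAt_id y).div_const _
    have := ((dχ (y / (n + 1))).hasDerivAt.comp y h1).ofReal_comp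
    simpa [c, div_eq_mul_inv, Function.comp_def] using this
  have hcd : ∀ n, deriv (c n) = fun y => (((deriv χ (y / (n + 1)) / (n + 1) : ℝ)) : ℂ) :=
    fun n => funext fun y => (hc1 n y).deriv
  have hc2 : ∀ n y, deriv (deriv (c n)) y =
      (((deriv (deriv χ) (y / (n + 1)) / (n + 1) / (n + 1) : ℝ)) : ℂ) := fun n y => by
    rw [hcd]
    have h1 : HasDerivAt (fun y : ℝ => y / ((n : ℝ) + 1)) (1 / ((n : ℝ) + 1)) y :=
      (hasDerivAt_id y).div_const _
    have := (((dχ' (y / (n + 1))).hasDerivAt.comp y h1).div_const ((n : ℝ) + 1)).ofReal_comp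
    refine HasDerivAt.deriv ?_
    simpa [div_eq_mul_inv, Function.comp_def] using this
  have hcs : ∀ n, ContDiff ℝ ∞ (c n) := fun n =>
    Complex.ofRealCLM.contDiff.comp (hχ.comp (contDiff_id.div_const _))
  have hcc : ∀ n, HasCompactSupport (c n) := fun n => by
    have h0 : ((n : ℝ) + 1)⁻¹ ≠ 0 := by positivity
    have h1 : HasCompactSupport (fun y : ℝ => χ (y / (n + 1))) := by
      have := hχc.comp_homeomorph (Homeomorph.mulRight₀ (((n : ℝ) + 1)⁻¹) h0)
      simpa [Function.comp_def, div_eq_mul_inv] using this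
    exact h1.comp_left (g := fun r : ℝ => (r : ℂ)) (by simp)
  have hn1 : ∀ n : ℕ, (1 : ℝ) ≤ (n : ℝ) + 1 := fun n => by
    have : (0 : ℝ) ≤ n := Nat.cast_nonneg n
    linarith
  have hb0 : ∀ n y, ‖c n y‖ ≤ C₀ := fun n y => by
    simpa [c] using hC₀ (y / (n + 1))
  have hdivb : ∀ (n : ℕ) (x : ℝ), |x / (n + 1)| ≤ |x| := fun n x => by
    rw [abs_div, abs_of_pos (lt_of_lt_of_le one_pos (hn1 n))]
    exact div_le_self (abs_nonneg _) (hn1 n)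
  have hb1 : ∀ n y, ‖deriv (c n) y‖ ≤ C₁ := fun n y => by
    rw [hcd, Complex.norm_real, Real.norm_eq_abs]
    exact (hdivb n _).trans (hC₁ _)
  have hb2 : ∀ n y, ‖deriv (deriv (c n)) y‖ ≤ C₂ := fun n y => by
    rw [hc2, Complex.norm_real, Real.norm_eq_abs]
    exact (hdivb n _).trans ((hdivb n _).trans (hC₂ _))
  have hinv : Tendsto (fun n : ℕ => ((n : ℝ) + 1)⁻¹) atTop (𝓝 0) := by
    simpa [one_div] using tendsto_one_div_add_atTop_nhds_zero_nat (𝕜 := ℝ)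
  have hscale : ∀ y : ℝ, Tendsto (fun n : ℕ => y / ((n : ℝ) + 1)) atTop (𝓝 0) := fun y => by
    simpa [div_eq_mul_inv] using hinv.const_mul y
  have ht0 : ∀ y, Tendsto (fun n => c n y) atTop (𝓝 1) := fun y => by
    have := (hχ.continuous.tendsto 0).comp (hscale y)
    rw [hχ0] at this
    simpa [c, Function.comp_def] using (Complex.continuous_ofReal.tendsto 1).comp this
  have ht1 : ∀ y, Tendsto (fun n => deriv (c n) y) atTop (𝓝 0) := fun y => by
    have := ((hχ'.continuous.tendsto 0).comp (hscale y)).mul hinv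
    rw [mul_zero] at this
    simpa [hcd, Function.comp_def, div_eq_mul_inv] using
      (Complex.continuous_ofReal.tendsto 0).comp this
  have ht2 : ∀ y, Tendsto (fun n => deriv (deriv (c n)) y) atTop (𝓝 0) := fun y => by
    have := (((hχ''.continuous.tendsto 0).comp (hscale y)).mul hinv).mul hinv
    rw [mul_zero] at this
    simpa [hc2, Function.comp_def, div_eq_mul_inv] using
      (Complex.continuous_ofReal.tendsto 0).comp this
  -- the approximating identities
  let ρ₁ : 𝓢(ℝ, ℂ) := SchwartzMap.derivCLM ℂ ℂ ρ
  let ρ₂ : 𝓢(ℝ, ℂ) := SchwartzMap.derivCLM ℂ ℂ ρ₁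
  have e1 : deriv ρ = ρ₁ := by funext y; simp [ρ₁]
  have e2 : deriv (deriv ρ) = ρ₂ := by rw [e1]; funext y; simp [ρ₂]
  rw [e2, e1]
  have hn := fun n => h (fun y => c n y * ρ y) ((hcs n).mul (ρ.smooth ⊤)) (hcc n).mul_right
  have hd1 : ∀ n y, deriv (fun y => c n y * ρ y) y = deriv (c n) y * ρ y + c n y * ρ₁ y :=
    fun n y => by
      rw [deriv_fun_mul (hc1 n y).differentiableAt ρ.differentiableAt, e1]
  have hd2 : ∀ n y, deriv (deriv (fun y => c n y * ρ y)) y = deriv (deriv (c n)) y * ρ y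
      + 2 * (deriv (c n) y * ρ₁ y) + c n y * ρ₂ y := fun n y => by
    rw [deriv_deriv_mul (hcs n) (ρ.smooth ⊤), e1, ← e2, e1]
  have hm : ∀ σ : 𝓢(ℝ, ℂ), MemLp σ 2 := fun σ => σ.memLp 2
  have hi : ∀ (A : LineL2) (σ : 𝓢(ℝ, ℂ)), Integrable (fun y => ‖A y‖ * ‖σ y‖) := fun A σ => by
    simpa using (integrable_lineL2_mul A (hm σ)).norm
  have hmeas : ∀ (A : LineL2) {q : ℝ → ℂ}, Continuous q →
      AEStronglyMeasurable (fun y => A y * q y) volume := fun A q hq =>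
    (Lp.aestronglyMeasurable A).mul hq.aestronglyMeasurable
  have cc : ∀ n, Continuous (c n) := fun n => (hcs n).continuous
  have cc1 : ∀ n, Continuous (deriv (c n)) := fun n =>
    (contDiff_infty_iff_deriv.1 (hcs n)).2.continuous
  have cc2 : ∀ n, Continuous (deriv (deriv (c n))) := fun n =>
    (contDiff_infty_iff_deriv.1 (contDiff_infty_iff_deriv.1 (hcs n)).2).2.continuous
  -- Each `Aᵢ` and each Schwartz factor lies in `L²`, so the products are integrable and dominate.
  -- Derivatives that fall on the cutoff carry a factor `1/(n+1)` and vanish in the limit.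
  have hl0 : Tendsto (fun n => ∫ y, A₀ y * (c n y * ρ y)) atTop (𝓝 (∫ y, A₀ y * ρ y)) := by
    refine tendsto_integral_of_dominated_convergence (fun y => C₀ * (‖A₀ y‖ * ‖ρ y‖))
      (fun n => hmeas A₀ ((cc n).mul ρ.continuous)) ((hi A₀ ρ).const_mul _)
      (fun n => Eventually.of_forall fun y => ?_) (Eventually.of_forall fun y => ?_)
    · rw [norm_mul, norm_mul]
      calc _ = ‖c n y‖ * (‖A₀ y‖ * ‖ρ y‖) := by ring
        _ ≤ _ := by gcongr; exact hb0 n y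
    · simpa using ((ht0 y).mul_const (ρ y)).const_mul (A₀ y)
  have hl1 : Tendsto (fun n => ∫ y, A₁ y * (deriv (c n) y * ρ y + c n y * ρ₁ y)) atTop
      (𝓝 (∫ y, A₁ y * ρ₁ y)) := by
    refine tendsto_integral_of_dominated_convergence
      (fun y => C₁ * (‖A₁ y‖ * ‖ρ y‖) + C₀ * (‖A₁ y‖ * ‖ρ₁ y‖))
      (fun n => hmeas A₁ (((cc1 n).mul ρ.continuous).add ((cc n).mul ρ₁.continuous)))
      (((hi A₁ ρ).const_mul _).add ((hi A₁ ρ₁).const_mul _))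
      (fun n => Eventually.of_forall fun y => ?_) (Eventually.of_forall fun y => ?_)
    · rw [norm_mul]
      calc _ ≤ ‖A₁ y‖ * (‖deriv (c n) y‖ * ‖ρ y‖ + ‖c n y‖ * ‖ρ₁ y‖) := by
            gcongr; simpa using norm_add_le (deriv (c n) y * ρ y) (c n y * ρ₁ y)
        _ ≤ ‖A₁ y‖ * (C₁ * ‖ρ y‖ + C₀ * ‖ρ₁ y‖) := by
            gcongr
            exacts [hb1 n y, hb0 n y]
        _ = _ := by ring
    · simpa using (((ht1 y).mul_const (ρ y)).add ((ht0 y).mul_const (ρ₁ y))).const_mul (A₁ y)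
  have hl2 : Tendsto (fun n => ∫ y, A₂ y * (deriv (deriv (c n)) y * ρ y
      + 2 * (deriv (c n) y * ρ₁ y) + c n y * ρ₂ y)) atTop (𝓝 (∫ y, A₂ y * ρ₂ y)) := by
    refine tendsto_integral_of_dominated_convergence
      (fun y => C₂ * (‖A₂ y‖ * ‖ρ y‖) + 2 * (C₁ * (‖A₂ y‖ * ‖ρ₁ y‖)) + C₀ * (‖A₂ y‖ * ‖ρ₂ y‖))
      (fun n => hmeas A₂ ((((cc2 n).mul ρ.continuous).add
        (continuous_const.mul ((cc1 n).mul ρ₁.continuous))).add ((cc n).mul ρ₂.continuous)))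
      ((((hi A₂ ρ).const_mul _).add (((hi A₂ ρ₁).const_mul _).const_mul _)).add
        ((hi A₂ ρ₂).const_mul _))
      (fun n => Eventually.of_forall fun y => ?_) (Eventually.of_forall fun y => ?_)
    · rw [norm_mul]
      calc _ ≤ ‖A₂ y‖ * (‖deriv (deriv (c n)) y‖ * ‖ρ y‖ + 2 * (‖deriv (c n) y‖ * ‖ρ₁ y‖)
              + ‖c n y‖ * ‖ρ₂ y‖) := by
            gcongr
            simpa using norm_add₃_le (a := deriv (deriv (c n)) y * ρ y)
              (b := 2 * (deriv (c n) y * ρ₁ y)) (c := c n y * ρ₂ y)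
        _ ≤ ‖A₂ y‖ * (C₂ * ‖ρ y‖ + 2 * (C₁ * ‖ρ₁ y‖) + C₀ * ‖ρ₂ y‖) := by
            gcongr
            exacts [hb2 n y, hb1 n y, hb0 n y]
        _ = _ := by ring
    · simpa using ((((ht2 y).mul_const (ρ y)).add
        (((ht1 y).mul_const (ρ₁ y)).const_mul 2)).add ((ht0 y).mul_const (ρ₂ y))).const_mul (A₂ y)
  refine tendsto_nhds_unique ((hl0.add hl1).add hl2) ?_
  refine tendsto_const_nhds.congr fun n => ?_
  rw [← hn n]
  congr 1
  · congr 1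
    exact integral_congr_ae (Eventually.of_forall fun y => by simp only [hd1])
  · exact integral_congr_ae (Eventually.of_forall fun y => by simp only [hd2])

/-- The Fourier symbol of a second-order identity between `L²` functions. -/
theorem fourier_of_weak_identity {A₀ A₁ A₂ : LineL2}
    (h : ∀ ρ : ℝ → ℂ, ContDiff ℝ ∞ ρ → HasCompactSupport ρ →
      (∫ y, A₀ y * ρ y) + (∫ y, A₁ y * deriv ρ y) + ∫ y, A₂ y * deriv (deriv ρ) y = 0) :
    ∀ᵐ ξ : ℝ, (𝓕 A₀) ξ - 2 * π * Complex.I * ξ * (𝓕 A₁) ξ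
      + (2 * π * Complex.I * ξ) ^ 2 * (𝓕 A₂) ξ = 0 := by
  have hloc : ∀ A : LineL2, LocallyIntegrable A volume := fun A =>
    (Lp.memLp A).locallyIntegrable (by norm_num)
  have hcont : Continuous (fun ξ : ℝ => (2 * π * Complex.I * ξ : ℂ)) := by fun_prop
  have hint : ∀ (A : LineL2) {θ : ℝ → ℂ}, Continuous θ → HasCompactSupport θ →
      Integrable (fun ξ => A ξ * θ ξ) := fun A θ hθ hc =>
    integrable_lineL2_mul A (hθ.memLp_of_hasCompactSupport hc)
  refine ae_eq_zero_of_integral_contDiff_smul_eq_zero ?_ fun g hg hgc => ?_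
  · have l1 : LocallyIntegrable (fun ξ : ℝ => 2 * π * Complex.I * ξ * (𝓕 A₁) ξ) := by
      rw [← locallyIntegrableOn_univ] at *
      exact ((hloc (𝓕 A₁)).locallyIntegrableOn univ).continuousOn_mul
        hcont.continuousOn isOpen_univ.isLocallyClosed
    have l2 : LocallyIntegrable (fun ξ : ℝ => (2 * π * Complex.I * ξ) ^ 2 * (𝓕 A₂) ξ) := by
      rw [← locallyIntegrableOn_univ] at *
      exact ((hloc (𝓕 A₂)).locallyIntegrableOn univ).continuousOn_mul
        (hcont.pow 2).continuousOn isOpen_univ.isLocallyClosed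
    exact ((hloc (𝓕 A₀)).sub l1).add l2
  · let θ₀ : ℝ → ℂ := fun ξ => (g ξ : ℂ)
    have s0 : ContDiff ℝ ∞ θ₀ := Complex.ofRealCLM.contDiff.comp hg
    have c0 : HasCompactSupport θ₀ := hgc.comp_left (g := fun r : ℝ => (r : ℂ)) (by simp)
    let μ : ℝ → ℂ := fun ξ => -2 * π * Complex.I * ξ
    have sμ : ContDiff ℝ ∞ μ := contDiff_const.mul Complex.ofRealCLM.contDiff
    let θ₁ : ℝ → ℂ := fun ξ => μ ξ * θ₀ ξ
    let θ₂ : ℝ → ℂ := fun ξ => μ ξ * θ₁ ξ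
    have s1 : ContDiff ℝ ∞ θ₁ := sμ.mul s0
    have s2 : ContDiff ℝ ∞ θ₂ := sμ.mul s1
    have c1 : HasCompactSupport θ₁ := c0.mul_left
    have c2 : HasCompactSupport θ₂ := c1.mul_left
    let S₀ := c0.toSchwartzMap s0
    let S₁ := c1.toSchwartzMap s1
    let S₂ := c2.toSchwartzMap s2
    have ii : ∀ {θ : ℝ → ℂ}, ContDiff ℝ ∞ θ → HasCompactSupport θ → Integrable θ := fun hs hc =>
      hs.continuous.integrable_of_hasCompactSupport hc
    have d1 : deriv (𝓕 S₀ : 𝓢(ℝ, ℂ)) = (𝓕 S₁ : 𝓢(ℝ, ℂ)) := by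
      rw [SchwartzMap.fourier_coe, SchwartzMap.fourier_coe]
      refine (Real.deriv_fourier (ii s0 c0) (ii (contDiff_id.smul s0)
        (c0.smul_left (f := fun x : ℝ => x)))).trans ?_
      rfl
    have d2 : deriv (𝓕 S₁ : 𝓢(ℝ, ℂ)) = (𝓕 S₂ : 𝓢(ℝ, ℂ)) := by
      rw [SchwartzMap.fourier_coe, SchwartzMap.fourier_coe]
      refine (Real.deriv_fourier (ii s1 c1) (ii (contDiff_id.smul s1)
        (c1.smul_left (f := fun x : ℝ => x)))).trans ?_
      rfl
    -- Test with the transform of a compactly supported function: it is Schwartz but in general not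
    -- compactly supported, hence the extension above. Its derivatives are transforms of `-2πiξ`
    -- times the function, and duality moves the transform onto the `Aᵢ`.
    have key := weak_identity_schwartz h (𝓕 S₀)
    rw [d1, d2, ← integral_fourier_mul, ← integral_fourier_mul, ← integral_fourier_mul] at key
    have i0 : Integrable (fun ξ => (𝓕 A₀) ξ * S₀ ξ) := hint _ s0.continuous c0
    have i1 : Integrable (fun ξ => (𝓕 A₁) ξ * S₁ ξ) := hint _ s1.continuous c1
    have i2 : Integrable (fun ξ => (𝓕 A₂) ξ * S₂ ξ) := hint _ s2.continuous c2
    have i01 : Integrable (fun ξ => (𝓕 A₀) ξ * S₀ ξ + (𝓕 A₁) ξ * S₁ ξ) := i0.add i1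
    rw [← integral_add i0 i1, ← integral_add i01 i2] at key
    rw [← key]
    refine integral_congr_ae (Eventually.of_forall fun ξ => ?_)
    simp only [S₀, S₁, S₂, θ₂, θ₁, θ₀, μ, HasCompactSupport.toSchwartzMap_toFun,
      Complex.real_smul]
    change _ = 𝓕 A₀ ξ * (g ξ : ℂ) + 𝓕 A₁ ξ * (-2 * π * Complex.I * ξ * (g ξ : ℂ)) +
      𝓕 A₂ ξ * (-2 * π * Complex.I * ξ * (-2 * π * Complex.I * ξ * (g ξ : ℂ)))
    ring

end

/-! ### Fourier inversion bounds and a product rule along the diagonal -/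

section

/-- An `L²` function with integrable Fourier transform is essentially bounded. -/
theorem ae_norm_le_integral_fourier (a : LineL2) (h : Integrable (𝓕 a : LineL2)) :
    ∀ᵐ y : ℝ, ‖a y‖ ≤ ∫ ξ, ‖(𝓕 a) ξ‖ := by
  -- The reflection makes the forward Fourier integral of `b` the inverse transform of `𝓕 a`.
  let b : ℝ → ℂ := fun ξ => (𝓕 a) (-ξ)
  have hb : Integrable b := h.comp_neg
  have key : ∀ᵐ y : ℝ, a y = 𝓕 b y := by
    refine ae_eq_of_integral_contDiff_smul_eq ((Lp.memLp a).locallyIntegrable (by norm_num))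
      ?_ fun g hg hgc => ?_
    · exact (VectorFourier.fourierIntegral_continuous Real.continuous_fourierChar
        (L := innerₗ ℝ) continuous_inner hb).locallyIntegrable
    · have s0 : ContDiff ℝ ∞ (fun ξ => (g ξ : ℂ)) := Complex.ofRealCLM.contDiff.comp hg
      have c0 : HasCompactSupport (fun ξ => (g ξ : ℂ)) :=
        hgc.comp_left (g := fun r : ℝ => (r : ℂ)) (by simp)
      let S := c0.toSchwartzMap s0
      have e1 := integral_fourier_mul a (𝓕⁻ S)
      rw [FourierTransform.fourier_fourierInv_eq] at e1
      have e2 : ∫ x, g x • a x = ∫ y, a y * S y := integral_congr_ae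
        (Eventually.of_forall fun y => by
          change g y • a y = a y * (g y : ℂ)
          rw [Complex.real_smul, mul_comm])
      have e3 : ∫ ξ, (𝓕 a) ξ * (𝓕⁻ S : 𝓢(ℝ, ℂ)) ξ = ∫ ξ, b ξ * 𝓕 (S : ℝ → ℂ) ξ := by
        rw [← integral_neg_eq_self]
        refine integral_congr_ae (Eventually.of_forall fun ξ => ?_)
        simp only [b, SchwartzMap.fourierInv_coe, Real.fourierInv_eq_fourier_neg, neg_neg]
      have e4 := VectorFourier.integral_fourierIntegral_smul_eq_flip (L := innerₗ ℝ)
        (μ := volume) (ν := volume) Real.continuous_fourierChar continuous_inner hb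
        (s0.continuous.integrable_of_hasCompactSupport c0)
      rw [flip_innerₗ] at e4
      rw [e2, ← e1, e3]
      calc _ = ∫ ξ, b ξ • 𝓕 (S : ℝ → ℂ) ξ := rfl
        _ = ∫ ξ, 𝓕 b ξ • (g ξ : ℂ) := e4.symm
        _ = _ := integral_congr_ae (Eventually.of_forall fun ξ => by
          simp only [Complex.real_smul, smul_eq_mul, mul_comm])
  have e5 : ∫ ξ, ‖b ξ‖ = ∫ ξ, ‖(𝓕 a) ξ‖ := integral_neg_eq_self (fun ξ => ‖(𝓕 a) ξ‖) volume
  filter_upwards [key] with y hy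
  rw [hy, ← e5]
  exact VectorFourier.norm_fourierIntegral_le_integral_norm _ _ _ _ _

/-! ### A product rule for separately absolutely continuous functions -/

/-- If `Φ` is an indefinite integral in each variable, with densities that depend continuously on
the other variable relative to an integrable majorant, then its restriction to the diagonal is an
indefinite integral. -/
theorem diagonal_sub_eq_integral {Φ G₁ G₂ : ℝ → ℝ → ℂ} {M : ℝ → ℝ} {T : ℝ} (hT : 0 ≤ T)
    (hM : IntervalIntegrable M volume 0 T)
    (i₁ : ∀ t ∈ Icc 0 T, IntervalIntegrable (fun r => G₁ r t) volume 0 T)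
    (i₂ : ∀ s ∈ Icc 0 T, IntervalIntegrable (fun r => G₂ s r) volume 0 T)
    (hd : IntervalIntegrable (fun r => G₁ r r + G₂ r r) volume 0 T)
    (h₁ : ∀ s ∈ Icc 0 T, ∀ s' ∈ Icc 0 T, ∀ t ∈ Icc 0 T, s ≤ s' →
      Φ s' t - Φ s t = ∫ r in s..s', G₁ r t)
    (h₂ : ∀ s ∈ Icc 0 T, ∀ t ∈ Icc 0 T, ∀ t' ∈ Icc 0 T, t ≤ t' →
      Φ s t' - Φ s t = ∫ r in t..t', G₂ s r)
    (c₁ : ∀ ε > 0, ∃ δ > 0, ∀ r ∈ Icc 0 T, ∀ t ∈ Icc 0 T, ∀ t' ∈ Icc 0 T, |t - t'| < δ →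
      ‖G₁ r t - G₁ r t'‖ ≤ ε * M r)
    (c₂ : ∀ ε > 0, ∃ δ > 0, ∀ r ∈ Icc 0 T, ∀ s ∈ Icc 0 T, ∀ s' ∈ Icc 0 T, |s - s'| < δ →
      ‖G₂ s r - G₂ s' r‖ ≤ ε * M r) :
    Φ T T - Φ 0 0 = ∫ r in (0 : ℝ)..T, (G₁ r r + G₂ r r) := by
  have sub : ∀ {f : ℝ → ℂ}, IntervalIntegrable f volume 0 T → ∀ a ∈ Icc 0 T, ∀ b ∈ Icc 0 T,
      IntervalIntegrable f volume a b := fun hf a ha b hb =>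
    hf.mono_set (by rw [uIcc_of_le hT]; exact uIcc_subset_Icc ha hb)
  have subR : ∀ {f : ℝ → ℝ}, IntervalIntegrable f volume 0 T → ∀ a ∈ Icc 0 T, ∀ b ∈ Icc 0 T,
      IntervalIntegrable f volume a b := fun hf a ha b hb =>
    hf.mono_set (by rw [uIcc_of_le hT]; exact uIcc_subset_Icc ha hb)
  have bound : ∀ ε > 0, ‖Φ T T - Φ 0 0 - ∫ r in (0 : ℝ)..T, (G₁ r r + G₂ r r)‖ ≤
      ε * (2 * ∫ r in (0 : ℝ)..T, M r) := by
    intro ε hε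
    obtain ⟨δ₁, hδ₁, H₁⟩ := c₁ ε hε
    obtain ⟨δ₂, hδ₂, H₂⟩ := c₂ ε hε
    -- A uniform partition with mesh below both moduli of continuity.
    obtain ⟨n, hn⟩ := exists_nat_gt (T / min δ₁ δ₂)
    have hδ : 0 < min δ₁ δ₂ := lt_min hδ₁ hδ₂
    have hn0 : (0 : ℝ) < n := lt_of_le_of_lt (by positivity) hn
    let a : ℕ → ℝ := fun i => i * (T / n)
    have a0 : a 0 = 0 := by simp [a]
    have an : a n = T := by simp only [a]; field_simp
    have amem : ∀ i ≤ n, a i ∈ Icc 0 T := fun i hi => by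
      have hi' : (i : ℝ) ≤ n := by exact_mod_cast hi
      refine ⟨by positivity, ?_⟩
      calc a i ≤ n * (T / n) := by simp only [a]; gcongr
        _ = T := by field_simp
    have astep : ∀ i, a (i + 1) - a i = T / n := fun i => by simp only [a]; push_cast; ring
    have hstep : T / n < min δ₁ δ₂ := by
      rw [div_lt_iff₀ hδ] at hn
      rw [div_lt_iff₀ hn0]; linarith
    have hTn : 0 ≤ T / n := by positivity
    have tel : Φ T T - Φ 0 0 - ∫ r in (0 : ℝ)..T, (G₁ r r + G₂ r r) =
        ∑ i ∈ Finset.range n, (Φ (a (i + 1)) (a (i + 1)) - Φ (a i) (a i)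
          - ∫ r in a i..a (i + 1), (G₁ r r + G₂ r r)) := by
      rw [Finset.sum_sub_distrib, Finset.sum_range_sub (fun i => Φ (a i) (a i)),
        intervalIntegral.sum_integral_adjacent_intervals, a0, an]
      intro k hk
      exact sub hd _ (amem k hk.le) _ (amem (k + 1) hk)
    have telM : ∑ i ∈ Finset.range n, ∫ r in a i..a (i + 1), M r = ∫ r in (0 : ℝ)..T, M r := by
      rw [intervalIntegral.sum_integral_adjacent_intervals, a0, an]
      intro k hk
      exact subR hM _ (amem k hk.le) _ (amem (k + 1) hk)
    rw [tel, ← telM, Finset.mul_sum, Finset.mul_sum]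
    refine norm_sum_le_of_le _ fun i hi => ?_
    rw [Finset.mem_range] at hi
    have m0 := amem i hi.le
    have m1 := amem (i + 1) hi
    have hle : a i ≤ a (i + 1) := by linarith [astep i]
    have e1 := h₁ _ m0 _ m1 _ m1 hle
    have e2 := h₂ _ m0 _ m0 _ m1 hle
    have j1 := sub (i₁ _ m1) _ m0 _ m1
    have j2 := sub (i₂ _ m0) _ m0 _ m1
    have j3 := sub hd _ m0 _ m1
    -- Each diagonal step passes through the corner `(a i, a (i + 1))`; on each leg, replacing the
    -- frozen variable by `r` costs at most `ε * M r`.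
    have e3 : Φ (a (i + 1)) (a (i + 1)) - Φ (a i) (a i)
          - ∫ r in a i..a (i + 1), (G₁ r r + G₂ r r) =
        ∫ r in a i..a (i + 1), (G₁ r (a (i + 1)) + G₂ (a i) r - (G₁ r r + G₂ r r)) := by
      rw [intervalIntegral.integral_sub (j1.add j2) j3, intervalIntegral.integral_add j1 j2,
        ← e1, ← e2]
      ring
    rw [e3, ← intervalIntegral.integral_const_mul, ← intervalIntegral.integral_const_mul]
    refine intervalIntegral.norm_integral_le_of_norm_le hle (Eventually.of_forall fun r hr => ?_)
      (((subR hM _ m0 _ m1).const_mul 2).const_mul ε)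
    have hrT : r ∈ Icc 0 T := ⟨m0.1.trans hr.1.le, hr.2.trans m1.2⟩
    have b1 := H₁ r hrT _ m1 r hrT (by
      rw [abs_of_nonneg (by linarith [hr.2])]
      linarith [hr.1, astep i, min_le_left δ₁ δ₂])
    have b2 := H₂ r hrT _ m0 r hrT (by
      rw [abs_of_nonpos (by linarith [hr.1])]
      linarith [hr.2, astep i, min_le_right δ₁ δ₂])
    calc _ = ‖(G₁ r (a (i + 1)) - G₁ r r) + (G₂ (a i) r - G₂ r r)‖ := by congr 1; ring
      _ ≤ ε * M r + ε * M r := (norm_add_le _ _).trans (add_le_add b1 b2)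
      _ = _ := by ring
  have : ‖Φ T T - Φ 0 0 - ∫ r in (0 : ℝ)..T, (G₁ r r + G₂ r r)‖ ≤ 0 := by
    have ht : Tendsto (fun ε : ℝ => ε * (2 * ∫ r in (0 : ℝ)..T, M r)) (𝓝[>] 0) (𝓝 0) := by
      have : Tendsto (fun ε : ℝ => ε * (2 * ∫ r in (0 : ℝ)..T, M r)) (𝓝 0) (𝓝 (0 * _)) :=
        tendsto_id.mul_const _
      rw [zero_mul] at this
      exact this.mono_left nhdsWithin_le_nhds
    exact ge_of_tendsto ht (eventually_mem_nhdsWithin.mono fun ε hε => bound ε hε)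
  exact sub_eq_zero.1 (norm_le_zero_iff.1 this)

end

section

/-! ### Fourier modes in `x` -/

/-- Slices at fixed height `y` fix the second coordinate of the channel, so the product is swapped
before Fubini is applied. -/
theorem ae_ae_slice {P : Channel → Prop} (h : ∀ᵐ p : Channel, P p) :
    ∀ᵐ y : ℝ, ∀ᵐ x : Torus, P (x, y) := by
  have h1 : ∀ᵐ q : ℝ × Torus ∂((volume : Measure ℝ).prod (volume : Measure Torus)), P q.swap :=
    (Measure.measurePreserving_swap (μ := (volume : Measure ℝ))
      (ν := (volume : Measure Torus))).quasiMeasurePreserving.ae h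
  exact Measure.ae_ae_of_ae_prod h1

theorem volume_torus_eq :
    (volume : Measure Torus) = ENNReal.ofReal (2 * π) • AddCircle.haarAddCircle :=
  AddCircle.volume_eq_smul_haarAddCircle

theorem ae_haar_iff {P : Torus → Prop} :
    (∀ᵐ x ∂(AddCircle.haarAddCircle : Measure Torus), P x) ↔ ∀ᵐ x : Torus, P x := by
  rw [volume_torus_eq, Measure.ae_ennreal_smul_measure_iff (by simp [Real.pi_pos])]

theorem mode_ae (f : L2) (k : ℤ) :
    ∀ᵐ y : ℝ, mode f k y = fourierCoeff (fun x : Torus => ((f (x, y) : ℝ) : ℂ)) k :=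
  (memLp_mode f k).coeFn_toLp

theorem fourierCoeff_congr_volume {f g : Torus → ℂ} (h : ∀ᵐ x : Torus, f x = g x) (k : ℤ) :
    fourierCoeff f k = fourierCoeff g k :=
  congrFun (fourierCoeff_congr_ae (ae_haar_iff.2 h)) k

/-- Almost every slice of an `L²` function on the channel is square integrable. -/
theorem ae_memLp_slice {f : Channel → ℝ} (hf : MemLp f 2) :
    ∀ᵐ y : ℝ, MemLp (fun x : Torus => f (x, y)) 2 volume := by
  have hm := (AEStronglyMeasurable.prod_swap (μ := (volume : Measure ℝ))
    (ν := (volume : Measure Torus)) hf.1).prodMk_left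
  have hmeas : AEMeasurable (fun p : Channel => ‖f p‖ₑ ^ (2 : ℝ)) volume := hf.1.enorm.pow_const _
  have hfin := (eLpNorm_lt_top_iff_lintegral_rpow_enorm_lt_top (by norm_num) (by norm_num)).1 hf.2
  simp only [ENNReal.toReal_ofNat] at hfin
  have hsym : ∫⁻ p : Channel, ‖f p‖ₑ ^ (2 : ℝ) = ∫⁻ y : ℝ, ∫⁻ x : Torus, ‖f (x, y)‖ₑ ^ (2 : ℝ) :=
    lintegral_prod_symm _ hmeas
  rw [hsym] at hfin
  have hm2 : AEMeasurable (fun y : ℝ => ∫⁻ x : Torus, ‖f (x, y)‖ₑ ^ (2 : ℝ)) volume :=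
    AEMeasurable.lintegral_prod_right'
      (f := fun q : ℝ × Torus => ‖f (q.2, q.1)‖ₑ ^ (2 : ℝ))
      ((AEStronglyMeasurable.prod_swap (μ := (volume : Measure ℝ))
        (ν := (volume : Measure Torus)) hf.1).enorm.pow_const _)
  filter_upwards [hm, ae_lt_top' hm2 hfin.ne] with y h1 h2
  refine ⟨h1, ?_⟩
  rw [eLpNorm_lt_top_iff_lintegral_rpow_enorm_lt_top (by norm_num) (by norm_num)]
  simpa using h2

theorem memLp_haar_of_memLp {f : Torus → ℝ} (hf : MemLp f 2 volume) :
    MemLp (fun x => (f x : ℂ)) 2 AddCircle.haarAddCircle := by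
  have : MemLp (fun x => (f x : ℂ)) 2 volume := hf.ofReal
  exact memLp_haarAddCircle_iff.2 this

theorem integrable_slice_haar {f : Torus → ℝ} (hf : MemLp f 2 volume) :
    Integrable (fun x => (f x : ℂ)) (AddCircle.haarAddCircle : Measure Torus) :=
  (memLp_haar_of_memLp hf).integrable (by norm_num)

theorem mode_add (f g : L2) (k : ℤ) : mode (f + g) k = mode f k + mode g k := by
  refine Lp.ext ?_
  filter_upwards [mode_ae (f + g) k, mode_ae f k, mode_ae g k,
    Lp.coeFn_add (mode f k) (mode g k), ae_ae_slice (Lp.coeFn_add f g),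
    ae_memLp_slice (Lp.memLp f), ae_memLp_slice (Lp.memLp g)] with y h1 h2 h3 h4 h5 h6 h7
  rw [h4, h1, Pi.add_apply, h2, h3]
  have e : fourierCoeff (fun x : Torus => (((f + g : L2) (x, y) : ℝ) : ℂ)) k =
      fourierCoeff ((fun x : Torus => ((f (x, y) : ℝ) : ℂ)) + fun x => ((g (x, y) : ℝ) : ℂ)) k :=
    fourierCoeff_congr_volume (h5.mono fun x hx => by rw [hx]; simp) k
  rw [e, fourierCoeff.add (integrable_slice_haar h6) (integrable_slice_haar h7)]
  rfl

theorem mode_smul (c : ℝ) (f : L2) (k : ℤ) : mode (c • f) k = c • mode f k := by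
  refine Lp.ext ?_
  filter_upwards [mode_ae (c • f) k, mode_ae f k, Lp.coeFn_smul c (mode f k),
    ae_ae_slice (Lp.coeFn_smul c f)] with y h1 h2 h3 h4
  rw [h3, h1, Pi.smul_apply, h2]
  have e : fourierCoeff (fun x : Torus => (((c • f : L2) (x, y) : ℝ) : ℂ)) k =
      fourierCoeff (fun x : Torus => (c : ℂ) * ((f (x, y) : ℝ) : ℂ)) k :=
    fourierCoeff_congr_volume (h4.mono fun x hx => by rw [hx]; simp) k
  rw [e, fourierCoeff.const_mul]
  simp

/-- Parseval's identity on a slice. -/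
theorem tsum_enorm_sq_fourierCoeff {f : Torus → ℝ} (hf : MemLp f 2 volume) :
    ENNReal.ofReal (2 * π) * ∑' k : ℤ, ‖fourierCoeff (fun x => (f x : ℂ)) k‖ₑ ^ 2
      = ∫⁻ x, ‖f x‖ₑ ^ 2 := by
  have hF := memLp_haar_of_memLp hf
  have h := hasSum_sq_fourierCoeff hF.toLp
  have hc : ∀ k, fourierCoeff (hF.toLp : Torus → ℂ) k = fourierCoeff (fun x => (f x : ℂ)) k :=
    fun k => congrFun (fourierCoeff_congr_ae hF.coeFn_toLp) k
  simp_rw [hc] at h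
  have e1 : ∑' k : ℤ, ‖fourierCoeff (fun x => (f x : ℂ)) k‖ₑ ^ 2 =
      ENNReal.ofReal (∫ x, ‖(hF.toLp : Torus → ℂ) x‖ ^ 2 ∂AddCircle.haarAddCircle) := by
    rw [← h.tsum_eq, ENNReal.ofReal_tsum_of_nonneg (fun _ => by positivity) h.summable]
    refine tsum_congr fun k => ?_
    rw [ENNReal.ofReal_pow (norm_nonneg _), ofReal_norm]
  have e2 : ∫ x, ‖(hF.toLp : Torus → ℂ) x‖ ^ 2 ∂AddCircle.haarAddCircle =
      ∫ x, ‖(f x : ℂ)‖ ^ 2 ∂AddCircle.haarAddCircle :=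
    integral_congr_ae (hF.coeFn_toLp.mono fun x hx => by simp only [hx])
  rw [e1, e2, ofReal_integral_eq_lintegral_ofReal
    ((memLp_two_iff_integrable_sq_norm hF.1).1 hF) (Eventually.of_forall fun x => by positivity),
    volume_torus_eq, lintegral_smul_measure, smul_eq_mul]
  congr 1
  refine lintegral_congr fun x => ?_
  rw [ENNReal.ofReal_pow (norm_nonneg _), ofReal_norm, ← ofReal_norm, Complex.norm_real, ofReal_norm]

theorem enorm_sq_eq_lintegral {α E : Type*} [MeasurableSpace α] {μ : Measure α}
    [NormedAddCommGroup E] (f : Lp E 2 μ) : ‖f‖ₑ ^ 2 = ∫⁻ x, ‖f x‖ₑ ^ 2 ∂μ := by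
  rw [Lp.enorm_def, eLpNorm_eq_lintegral_rpow_enorm_toReal (by norm_num) (by norm_num),
    ← ENNReal.rpow_natCast, ← ENNReal.rpow_mul]
  simp

/-- Parseval on almost every horizontal slice, integrated in `y` by Tonelli. The factor `2π` is the
mass of the torus, the coefficients being taken for the normalised measure. -/
theorem enorm_sq_eq_tsum_mode (f : L2) :
    ‖f‖ₑ ^ 2 = ENNReal.ofReal (2 * π) * ∑' k : ℤ, ‖mode f k‖ₑ ^ 2 := by
  have hmeas : AEMeasurable (fun p : Channel => ‖f p‖ₑ ^ 2) volume :=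
    (Lp.aestronglyMeasurable f).enorm.pow_const _
  have hsym : ∫⁻ p : Channel, ‖f p‖ₑ ^ 2 = ∫⁻ y : ℝ, ∫⁻ x : Torus, ‖f (x, y)‖ₑ ^ 2 :=
    lintegral_prod_symm _ hmeas
  have hk : ∀ k : ℤ, AEMeasurable (fun y : ℝ => ‖mode f k y‖ₑ ^ 2) volume := fun k =>
    (Lp.aestronglyMeasurable (mode f k)).enorm.pow_const _
  have e : ∀ᵐ y : ℝ, ∫⁻ x : Torus, ‖f (x, y)‖ₑ ^ 2 =
      ENNReal.ofReal (2 * π) * ∑' k : ℤ, ‖mode f k y‖ₑ ^ 2 := by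
    filter_upwards [ae_memLp_slice (Lp.memLp f), ae_all_iff.2 (mode_ae f)] with y h1 h2
    rw [← tsum_enorm_sq_fourierCoeff h1]
    simp_rw [h2]
  rw [enorm_sq_eq_lintegral, hsym, lintegral_congr_ae e,
    lintegral_const_mul' _ _ ENNReal.ofReal_ne_top, lintegral_tsum hk]
  simp_rw [← enorm_sq_eq_lintegral]

theorem hasSum_norm_sq_mode (f : L2) :
    HasSum (fun k : ℤ => 2 * π * ‖mode f k‖ ^ 2) (‖f‖ ^ 2) := by
  have h := enorm_sq_eq_tsum_mode f
  rw [← ENNReal.tsum_mul_left] at h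
  have e : ∀ k : ℤ, ENNReal.ofReal (2 * π) * ‖mode f k‖ₑ ^ 2 =
      ENNReal.ofReal (2 * π * ‖mode f k‖ ^ 2) := fun k => by
    rw [ENNReal.ofReal_mul Real.two_pi_pos.le, ENNReal.ofReal_pow (norm_nonneg _), ofReal_norm]
  simp_rw [e] at h
  have hne : ∑' k : ℤ, ENNReal.ofReal (2 * π * ‖mode f k‖ ^ 2) ≠ ⊤ := by
    rw [← h]; exact ENNReal.pow_ne_top enorm_ne_top
  have hs : Summable (fun k : ℤ => 2 * π * ‖mode f k‖ ^ 2) := by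
    have := ENNReal.summable_toReal hne
    refine this.congr fun k => ENNReal.toReal_ofReal (by positivity)
  rw [← ENNReal.ofReal_tsum_of_nonneg (fun k => by positivity) hs, ← ofReal_norm,
    ← ENNReal.ofReal_pow (norm_nonneg _),
    ENNReal.ofReal_eq_ofReal_iff (by positivity) (tsum_nonneg fun k => by positivity)] at h
  rw [h]
  exact hs.hasSum

/-- Square-summable families of functions of `y`. -/
abbrev Modes : Type := lp (fun _ : ℤ => LineL2) 2

theorem memℓp_mode (f : L2) : Memℓp (fun k : ℤ => √(2 * π) • mode f k) 2 := by
  refine memℓp_gen ((hasSum_norm_sq_mode f).summable.congr fun k => ?_)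
  rw [norm_smul, ENNReal.toReal_ofNat, Real.rpow_two, mul_pow, Real.norm_eq_abs, sq_abs,
    Real.sq_sqrt Real.two_pi_pos.le]

/-- The decomposition of `L²` into Fourier modes, normalised to be an isometry. -/
def modes : L2 →ₗᵢ[ℝ] Modes where
  toFun f := ⟨fun k => √(2 * π) • mode f k, memℓp_mode f⟩
  map_add' f g := by
    refine lp.ext (funext fun k => ?_)
    change √(2 * π) • mode (f + g) k = √(2 * π) • mode f k + √(2 * π) • mode g k
    rw [mode_add, smul_add]
  map_smul' c f := by
    refine lp.ext (funext fun k => ?_)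
    change √(2 * π) • mode (c • f) k = c • √(2 * π) • mode f k
    rw [mode_smul, smul_comm]
  norm_map' f := by
    have h1 := lp.hasSum_norm (p := 2) (by norm_num)
      (⟨fun k => √(2 * π) • mode f k, memℓp_mode f⟩ : Modes)
    simp only [ENNReal.toReal_ofNat, Real.rpow_two] at h1
    have e : ∀ k : ℤ, ‖√(2 * π) • mode f k‖ ^ 2 = 2 * π * ‖mode f k‖ ^ 2 := fun k => by
      rw [norm_smul, mul_pow, Real.norm_eq_abs, sq_abs, Real.sq_sqrt Real.two_pi_pos.le]
    simp_rw [e] at h1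
    have := h1.unique (hasSum_norm_sq_mode f)
    exact (pow_left_inj₀ (norm_nonneg _) (norm_nonneg _) two_ne_zero).1 this

theorem modes_apply (f : L2) (k : ℤ) : modes f k = √(2 * π) • mode f k := rfl

/-- The `k`-th mode as a continuous linear map. -/
def modeL (k : ℤ) : L2 →L[ℝ] LineL2 :=
  LinearMap.mkContinuous ⟨⟨fun f => mode f k, fun f g => mode_add f g k⟩,
    fun c f => mode_smul c f k⟩ 1 fun f => by
      have h := (hasSum_norm_sq_mode f).summable.le_tsum k (fun j _ => by positivity)
      rw [(hasSum_norm_sq_mode f).tsum_eq] at h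
      have h1 : 1 * ‖mode f k‖ ^ 2 ≤ 2 * π * ‖mode f k‖ ^ 2 := by
        gcongr; linarith [Real.pi_gt_three]
      rw [one_mul]
      exact (pow_le_pow_iff_left₀ (norm_nonneg _) (norm_nonneg _) two_ne_zero).1
        ((one_mul (‖mode f k‖ ^ 2)).symm.le.trans (h1.trans h))

theorem hasSum_inner_mode (f g : L2) :
    HasSum (fun k : ℤ => 2 * π * ⟪mode f k, mode g k⟫_ℝ) ⟪f, g⟫_ℝ := by
  have h := lp.hasSum_inner (𝕜 := ℝ) (modes f) (modes g)
  rw [modes.inner_map_map] at h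
  convert! h using 2 with k
  rw [modes_apply, modes_apply, inner_smul_left, inner_smul_right, ← mul_assoc, conj_trivial,
    Real.mul_self_sqrt Real.two_pi_pos.le]

theorem ext_mode {f g : L2} (h : ∀ k, mode f k = mode g k) : f = g := by
  refine modes.injective (lp.ext (funext fun k => ?_))
  rw [modes_apply, modes_apply, h]

end

section

/-! ### The Fourier transform of the modes -/

/-- The Fourier transform on `L²(ℝ)` as a real-linear isometry. -/
def fourierR : LineL2 →ₗᵢ[ℝ] LineL2 where
  toFun a := 𝓕 a
  map_add' a b := FourierTransform.fourier_add a b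
  map_smul' c a := by
    have h := FourierTransform.fourier_smul (c : ℂ) a
    rwa [Complex.coe_smul, Complex.coe_smul] at h
  norm_map' a := Lp.norm_fourier_eq a

/-- The Fourier transform in both variables. -/
def hat (f : L2) (k : ℤ) : LineL2 := 𝓕 (mode f k)

/-- `hat · k` as a continuous linear map. -/
def hatL (k : ℤ) : L2 →L[ℝ] LineL2 := fourierR.toContinuousLinearMap.comp (modeL k)

@[simp]
theorem hatL_apply (k : ℤ) (f : L2) : hatL k f = hat f k := rfl

theorem norm_hat (f : L2) (k : ℤ) : ‖hat f k‖ = ‖mode f k‖ := Lp.norm_fourier_eq _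

theorem inner_hat (f g : L2) (k : ℤ) : ⟪hat f k, hat g k⟫_ℝ = ⟪mode f k, mode g k⟫_ℝ :=
  fourierR.inner_map_map _ _

theorem hasSum_norm_sq_hat (f : L2) : HasSum (fun k : ℤ => 2 * π * ‖hat f k‖ ^ 2) (‖f‖ ^ 2) := by
  simpa only [norm_hat] using hasSum_norm_sq_mode f

theorem hasSum_inner_hat (f g : L2) :
    HasSum (fun k : ℤ => 2 * π * ⟪hat f k, hat g k⟫_ℝ) ⟪f, g⟫_ℝ := by
  simpa only [inner_hat] using hasSum_inner_mode f g

theorem mode_eq_of_hat_eq {f g : L2} {k : ℤ} (h : hat f k = hat g k) : mode f k = mode g k :=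
  fourierR.injective h

theorem ext_hat {f g : L2} (h : ∀ k, hat f k = hat g k) : f = g :=
  ext_mode fun k => mode_eq_of_hat_eq (h k)

/-! ### Vanishing `x`-average -/

theorem zeroXMean_iff (f : L2) : ZeroXMean f ↔ mode f 0 = 0 := by
  have e : ∀ᵐ y : ℝ, mode f 0 y = (((2 * π)⁻¹ * ∫ x : Torus, f (x, y) : ℝ) : ℂ) := by
    filter_upwards [mode_ae f 0] with y hy
    rw [hy, fourierCoeff]
    simp only [neg_zero, fourier_zero, one_smul]
    have := AddCircle.integral_haarAddCircle (T := 2 * π) (f := fun x : Torus => ((f (x, y) : ℝ) : ℂ))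
    rw [this, integral_complex_ofReal]
    simp
  rw [Lp.eq_zero_iff_ae_eq_zero]
  constructor
  · intro h
    filter_upwards [e, h] with y h1 h2
    rw [h1, h2]; simp
  · intro h
    filter_upwards [e, h] with y h1 h2
    rw [h2] at h1
    have h3 : (2 * π)⁻¹ * ∫ x : Torus, f (x, y) = 0 := Complex.ofReal_eq_zero.1 h1.symm
    exact (mul_eq_zero.1 h3).resolve_left (by positivity)

theorem zeroXMean_iff_hat (f : L2) : ZeroXMean f ↔ hat f 0 = 0 := by
  rw [zeroXMean_iff]
  refine ⟨fun h => ?_, fun h => ?_⟩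
  · change fourierR (mode f 0) = 0
    rw [h, map_zero]
  · exact fourierR.injective (by rw [map_zero]; exact h)

/-! ### Transport by the shear -/

/-- The Couette flow map. -/
def shearMap (t : ℝ) (p : Channel) : Channel := (p.1 - ((t * p.2 : ℝ) : Torus), p.2)

theorem continuous_shearMap_uncurry : Continuous (fun q : ℝ × Channel => shearMap q.1 q.2) := by
  have h : Continuous (fun s : ℝ => (s : Torus)) := AddCircle.continuous_mk' _
  exact ((continuous_fst.comp continuous_snd).sub
    (h.comp (continuous_fst.mul (continuous_snd.comp continuous_snd)))).prodMk
      (continuous_snd.comp continuous_snd)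

/-- A skew product over the identity in `y` whose fibre maps are rotations of the torus. -/
theorem measurePreserving_shearMap (t : ℝ) : MeasurePreserving (shearMap t) := by
  have h : Continuous (fun s : ℝ => (s : Torus)) := AddCircle.continuous_mk' _
  have h1 : MeasurePreserving (fun q : ℝ × Torus => (q.1, q.2 - ((t * q.1 : ℝ) : Torus)))
      ((volume : Measure ℝ).prod (volume : Measure Torus))
      ((volume : Measure ℝ).prod (volume : Measure Torus)) := by
    refine (MeasurePreserving.id (volume : Measure ℝ)).skew_product
      (g := fun y x => x - ((t * y : ℝ) : Torus)) ?_ (Eventually.of_forall fun y => ?_)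
    · exact (continuous_snd.sub (h.comp (continuous_const.mul continuous_fst))).measurable
    · exact (measurePreserving_sub_right (volume : Measure Torus) _).map_eq
  exact Measure.measurePreserving_swap.comp (h1.comp Measure.measurePreserving_swap)

/-- The shear as an isometry of `L²`. -/
def shearL (t : ℝ) : L2 →ₗᵢ[ℝ] L2 :=
  Lp.compMeasurePreservingₗᵢ ℝ (shearMap t) (measurePreserving_shearMap t)

theorem shearL_ae (t : ℝ) (f : L2) : shearL t f =ᵐ[volume] shear t f :=
  Lp.coeFn_compMeasurePreserving f (measurePreserving_shearMap t)

/-- The shear is only strongly continuous in time; this follows from joint continuity of the flow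
map together with preservation of measure. -/
theorem continuousOn_shearL {s : Set ℝ} {u : ℝ → L2} (hu : ContinuousOn u s) {τ : ℝ → ℝ}
    (hτ : Continuous τ) : ContinuousOn (fun t => shearL (τ t) (u t)) s := by
  let S : C(ℝ, C(Channel, Channel)) :=
    ContinuousMap.curry ⟨fun q : ℝ × Channel => shearMap q.1 q.2, continuous_shearMap_uncurry⟩
  exact hu.compMeasurePreservingLp (g := fun t => S (τ t))
    (S.continuous.comp hτ).continuousOn (fun t => measurePreserving_shearMap _) (by norm_num)

/-- On a slice the shear is a rotation by `t y`, which multiplies the coefficient by a phase linear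
in `y`. On the Fourier side in `y` it therefore translates `η` by a multiple of `kt`, the source of
the time-dependent symbol. -/
theorem mode_shearL (t : ℝ) (f : L2) (k : ℤ) :
    ∀ᵐ y : ℝ, mode (shearL t f) k y = Complex.exp (-(k * t * y) * Complex.I) * mode f k y := by
  filter_upwards [mode_ae (shearL t f) k, mode_ae f k, ae_ae_slice (shearL_ae t f)]
    with y h1 h2 h3
  rw [h1, h2, fourierCoeff_congr_volume (g := fun x : Torus =>
    ((f (x - ((t * y : ℝ) : Torus), y) : ℝ) : ℂ)) (h3.mono fun x hx => by rw [hx]; rfl) k]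
  rw [fourierCoeff, fourierCoeff, ← integral_add_right_eq_self _ ((t * y : ℝ) : Torus),
    ← integral_const_mul]
  refine integral_congr_ae (Eventually.of_forall fun x => ?_)
  simp only [add_sub_cancel_right]
  have e : (fourier (-k) (x + ((t * y : ℝ) : Torus)) : ℂ) =
      fourier (-k) x * Complex.exp (-(k * t * y) * Complex.I) := by
    rw [fourier_apply, fourier_apply, smul_add, AddCircle.toCircle_add, Circle.coe_mul,
      ← fourier_apply (x := ((t * y : ℝ) : Torus)), fourier_coe_apply]
    congr 2
    have : (π : ℂ) ≠ 0 := by exact_mod_cast Real.pi_ne_zero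
    push_cast
    field_simp
  rw [e]
  simp only [smul_eq_mul]
  ring

theorem shearL_shearL (s t : ℝ) (f : L2) : shearL s (shearL t f) = shearL (s + t) f := by
  refine ext_mode fun k => Lp.ext ?_
  filter_upwards [mode_shearL s (shearL t f) k, mode_shearL t f k, mode_shearL (s + t) f k]
    with y h1 h2 h3
  rw [h1, h2, h3, ← mul_assoc, ← Complex.exp_add]
  congr 2
  push_cast
  ring

theorem shearL_zero (f : L2) : shearL 0 f = f := by
  refine ext_mode fun k => Lp.ext ?_
  filter_upwards [mode_shearL 0 f k] with y h1
  rw [h1]; simp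

theorem shearL_neg_shearL (t : ℝ) (f : L2) : shearL (-t) (shearL t f) = f := by
  rw [shearL_shearL, neg_add_cancel, shearL_zero]

theorem shearL_shearL_neg (t : ℝ) (f : L2) : shearL t (shearL (-t) f) = f := by
  rw [shearL_shearL, add_neg_cancel, shearL_zero]

/-! ### Functions with a prescribed mode -/

theorem memLp_tensor (k : ℤ) (h : LineL2) :
    MemLp (fun p : Channel => (fourier k p.1 * h p.2 : ℂ).re) 2 := by
  have h1 : MemLp (fun p : Channel => h p.2) 2 :=
    (Lp.memLp h).comp_snd (volume : Measure Torus)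
  have h2 : MemLp (fun p : Channel => (fourier k p.1 * h p.2 : ℂ)) 2 := by
    refine h1.of_le ((((fourier k).continuous.comp continuous_fst).aestronglyMeasurable).mul h1.1)
      (Eventually.of_forall fun p => ?_)
    rw [norm_mul, fourier_apply, Circle.norm_coe, one_mul]
  exact h2.re

/-- The function `Re (e^{ikx} h(y))`. -/
def tensor (k : ℤ) (h : LineL2) : L2 := (memLp_tensor k h).toLp

theorem tensor_ae (k : ℤ) (h : LineL2) :
    ∀ᵐ p : Channel, tensor k h p = (fourier k p.1 * h p.2 : ℂ).re :=
  (memLp_tensor k h).coeFn_toLp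

/-- `Re z = (z + z̄)/2` spreads the function over the modes `k` and `-k`. For `k = 0` both summands
fall on the same mode. -/
theorem mode_tensor (k j : ℤ) (h : LineL2) :
    mode (tensor k h) j = (if j = k then (1 / 2 : ℝ) • h else 0)
      + if j = -k then (1 / 2 : ℝ) • star h else 0 := by
  refine Lp.ext ?_
  have e : ∀ (P : Prop) [Decidable P] (a : LineL2), ∀ᵐ y : ℝ,
      (if P then (1 / 2 : ℝ) • a else 0 : LineL2) y = if P then (1 / 2 : ℂ) * a y else 0 := by
    intro P _ a
    by_cases hP : P
    · filter_upwards [Lp.coeFn_smul (1 / 2 : ℝ) a] with y hy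
      simp only [hP, if_true]
      rw [hy]; simp
    · filter_upwards [Lp.coeFn_zero ℂ 2 (volume : Measure ℝ)] with y hy
      simp only [hP, if_false]
      rw [hy]; rfl
  filter_upwards [mode_ae (tensor k h) j, ae_ae_slice (tensor_ae k h), e (j = k) h,
    e (j = -k) (star h), Lp.coeFn_add (if j = k then (1 / 2 : ℝ) • h else 0)
      (if j = -k then (1 / 2 : ℝ) • star h else 0), Lp.coeFn_star h] with y h1 h2 h3 h4 h5 h6
  rw [h5, Pi.add_apply, h3, h4, h6, h1]
  have e2 : fourierCoeff (fun x : Torus => ((tensor k h (x, y) : ℝ) : ℂ)) j =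
      fourierCoeff ((fun x : Torus => (h y / 2) * fourier k x)
        + fun x : Torus => (conj (h y) / 2) * fourier (-k) x) j := by
    refine fourierCoeff_congr_volume (h2.mono fun x hx => ?_) j
    rw [hx, Pi.add_apply, fourier_neg]
    rw [Complex.re_eq_add_conj, map_mul]
    ring
  have i : ∀ (c : ℂ) (m : ℤ), Integrable (fun x : Torus => c * fourier m x)
      (AddCircle.haarAddCircle : Measure Torus) := fun c m =>
    (continuous_const.mul (fourier m).continuous).integrable_of_hasCompactSupport
      (HasCompactSupport.of_compactSpace _)
  rw [e2, fourierCoeff.add (i _ _) (i _ _), Pi.add_apply, fourierCoeff.const_mul,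
    fourierCoeff.const_mul, fourierCoeff_fourier, fourierCoeff_fourier]
  simp only [Pi.single_apply, Pi.star_apply, RCLike.star_def]
  congr 1 <;> split_ifs <;> ring

theorem inner_star_star (a b : LineL2) : ⟪star a, star b⟫_ℝ = ⟪a, b⟫_ℝ := by
  rw [L2.inner_def, L2.inner_def]
  refine integral_congr_ae ?_
  filter_upwards [Lp.coeFn_star a, Lp.coeFn_star b] with y h1 h2
  rw [h1, h2]
  simp only [Pi.star_apply, RCLike.star_def, Complex.inner, Complex.conj_conj, Complex.mul_re,
    Complex.conj_re, Complex.conj_im]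
  ring

theorem mode_neg (f : L2) (k : ℤ) : mode f (-k) = star (mode f k) := by
  refine Lp.ext ?_
  filter_upwards [mode_ae f k, mode_ae f (-k), Lp.coeFn_star (mode f k)] with y h1 h2 h3
  rw [h2, h3, Pi.star_apply, h1, fourierCoeff, fourierCoeff, RCLike.star_def, ← integral_conj]
  refine integral_congr_ae (Eventually.of_forall fun x => ?_)
  simp only [smul_eq_mul, map_mul, Complex.conj_ofReal, fourier_neg, Complex.conj_conj]

/-- Every square-summable Hermitian family is the family of modes of a real function. -/
theorem exists_mode_eq {h : ℤ → LineL2} (hs : Summable fun k => ‖h k‖ ^ 2)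
    (hh : ∀ k, h (-k) = star (h k)) : ∃ g : L2, ∀ k, mode g k = h k := by
  have hm : Memℓp (fun k : ℤ => √(2 * π) • h k) 2 := by
    refine memℓp_gen ((hs.mul_left (2 * π)).congr fun k => ?_)
    rw [norm_smul, ENNReal.toReal_ofNat, Real.rpow_two, mul_pow, Real.norm_eq_abs, sq_abs,
      Real.sq_sqrt Real.two_pi_pos.le]
  let X : Modes := ⟨_, hm⟩
  let A : L2 →L[ℝ] Modes := modes.toContinuousLinearMap
  -- The adjoint of the isometry `modes` gives the candidate. The error `modes g - X` is orthogonal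
  -- to the range of `modes`; real functions with two modes suffice to show that it vanishes.
  let g : L2 := A.adjoint X
  refine ⟨g, fun k => ?_⟩
  let d : ℤ → LineL2 := fun j => mode g j - h j
  have hd : ∀ j, d (-j) = star (d j) := fun j => by
    have e : star (mode g j - h j) = star (mode g j) - star (h j) := by
      refine Lp.ext ?_
      filter_upwards [Lp.coeFn_star (mode g j - h j), Lp.coeFn_sub (mode g j) (h j),
        Lp.coeFn_star (mode g j), Lp.coeFn_star (h j),
        Lp.coeFn_sub (star (mode g j)) (star (h j))] with y h1 h2 h3 h4 h5
      rw [h1, h5, Pi.sub_apply, h3, h4, Pi.star_apply, h2]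
      simp
    simp only [d, mode_neg, hh, e]
  have key : ∀ ρ : LineL2, ⟪ρ, d k⟫_ℝ = 0 := by
    intro ρ
    have h1 : ⟪modes (tensor k ρ), modes g - X⟫_ℝ = 0 := by
      rw [inner_sub_right, modes.inner_map_map]
      have : ⟪modes (tensor k ρ), X⟫_ℝ = ⟪tensor k ρ, g⟫_ℝ :=
        (ContinuousLinearMap.adjoint_inner_right A (tensor k ρ) X).symm
      rw [this, sub_self]
    have h2 := lp.hasSum_inner (𝕜 := ℝ) (modes (tensor k ρ)) (modes g - X)
    rw [h1] at h2
    -- Hermitian symmetry of `d` makes the modes `k` and `-k` contribute equally instead of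
    -- cancelling.
    have e : ∀ j, ⟪modes (tensor k ρ) j, (modes g - X : Modes) j⟫_ℝ =
        2 * π * ((if j = k then 1 / 2 * ⟪ρ, d k⟫_ℝ else 0)
          + if j = -k then 1 / 2 * ⟪ρ, d k⟫_ℝ else 0) := fun j => by
      have e1 : (modes g - X : Modes) j = √(2 * π) • d j := by
        change √(2 * π) • mode g j - √(2 * π) • h j = _
        rw [← smul_sub]
      rw [e1, modes_apply, inner_smul_left, inner_smul_right, ← mul_assoc, conj_trivial,
        Real.mul_self_sqrt Real.two_pi_pos.le, mode_tensor, inner_add_left]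
      congr 2
      · split_ifs with hj
        · rw [hj, inner_smul_left]; simp
        · simp
      · split_ifs with hj
        · rw [hj, hd, inner_smul_left, inner_star_star]; simp
        · simp
    simp_rw [e] at h2
    have h3 : HasSum (fun j : ℤ => 2 * π * ((if j = k then 1 / 2 * ⟪ρ, d k⟫_ℝ else 0)
          + if j = -k then 1 / 2 * ⟪ρ, d k⟫_ℝ else 0))
        (2 * π * (1 / 2 * ⟪ρ, d k⟫_ℝ + 1 / 2 * ⟪ρ, d k⟫_ℝ)) :=
      ((hasSum_ite_eq k _).add (hasSum_ite_eq (-k) _)).mul_left _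
    have h4 := h3.unique h2
    have := (mul_eq_zero.1 h4).resolve_left (by positivity)
    linarith
  exact sub_eq_zero.1 (inner_self_eq_zero.1 (key (d k)))

/-- For test functions, conjugating the Fourier integral reflects the argument; duality carries this
to `L²`. It expresses reality of a function as Hermitian symmetry of `hat`. -/
theorem fourier_star (a : LineL2) : ∀ᵐ ξ : ℝ, (𝓕 (star a)) ξ = conj ((𝓕 a) (-ξ)) := by
  have hl : ∀ b : LineL2, LocallyIntegrable b volume := fun b =>
    (Lp.memLp b).locallyIntegrable (by norm_num)
  have hn : LocallyIntegrable (fun ξ => conj ((𝓕 a) (-ξ))) volume := by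
    have h1 : MemLp (fun ξ : ℝ => (𝓕 a) (-ξ)) 2 volume :=
      (Lp.memLp (𝓕 a)).comp_measurePreserving (Measure.measurePreserving_neg volume)
    exact h1.star.locallyIntegrable (by norm_num)
  refine ae_eq_of_integral_contDiff_smul_eq (hl _) hn fun g hg hgc => ?_
  have s0 : ContDiff ℝ ∞ (fun ξ => (g ξ : ℂ)) := Complex.ofRealCLM.contDiff.comp hg
  have c0 : HasCompactSupport (fun ξ => (g ξ : ℂ)) :=
    hgc.comp_left (g := fun r : ℝ => (r : ℂ)) (by simp)
  let S := c0.toSchwartzMap s0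
  have s1 : ContDiff ℝ ∞ (fun ξ => (g (-ξ) : ℂ)) := s0.comp contDiff_neg
  have c1 : HasCompactSupport (fun ξ => (g (-ξ) : ℂ)) :=
    c0.comp_homeomorph (Homeomorph.neg ℝ)
  let R := c1.toSchwartzMap s1
  have eR : ∀ y, conj ((𝓕 S : 𝓢(ℝ, ℂ)) y) = (𝓕 R : 𝓢(ℝ, ℂ)) y := fun y => by
    rw [SchwartzMap.fourier_coe, SchwartzMap.fourier_coe, Real.fourier_eq, Real.fourier_eq,
      ← integral_conj, ← integral_neg_eq_self]
    refine integral_congr_ae (Eventually.of_forall fun ξ => ?_)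
    simp only [S, R, HasCompactSupport.toSchwartzMap_toFun, Circle.smul_def, smul_eq_mul, map_mul,
      inner_neg_left, neg_neg]
    change conj _ * conj ((g (-ξ) : ℝ) : ℂ) = _ * ((g (-ξ) : ℝ) : ℂ)
    rw [Complex.conj_ofReal]
    congr 1
    rw [← Circle.coe_inv_eq_conj, ← AddChar.map_neg_eq_inv]
  calc ∫ ξ, g ξ • (𝓕 (star a)) ξ = ∫ ξ, (𝓕 (star a)) ξ * S ξ :=
        integral_congr_ae (Eventually.of_forall fun ξ => by
          change g ξ • _ = _ * ((g ξ : ℝ) : ℂ); rw [Complex.real_smul, mul_comm])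
    _ = ∫ y, (star a : LineL2) y * (𝓕 S) y := integral_fourier_mul _ _
    _ = ∫ y, conj (a y * (𝓕 R) y) := by
        refine integral_congr_ae ?_
        filter_upwards [Lp.coeFn_star a] with y hy
        rw [hy, Pi.star_apply, RCLike.star_def, map_mul, ← eR, Complex.conj_conj]
    _ = conj (∫ ξ, (𝓕 a) ξ * R ξ) := by rw [integral_conj, integral_fourier_mul]
    _ = ∫ ξ, conj ((𝓕 a) (-ξ) * R (-ξ)) := by
        rw [← integral_conj, ← integral_neg_eq_self]
    _ = _ := integral_congr_ae (Eventually.of_forall fun ξ => by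
        change conj ((𝓕 a) (-ξ) * ((g (- -ξ) : ℝ) : ℂ)) = g ξ • conj ((𝓕 a) (-ξ))
        rw [map_mul, Complex.conj_ofReal, neg_neg, Complex.real_smul, mul_comm])

/-- A bounded real Fourier multiplier that is even maps real functions to real functions. -/
theorem exists_hat_eq_mul (f : L2) {m : ℤ → ℝ → ℝ} (hm : ∀ k, Measurable (m k)) {C : ℝ}
    (hC : ∀ k ξ, hat f k = 0 ∨ |m k ξ| ≤ C) (he : ∀ k ξ, m (-k) (-ξ) = m k ξ) :
    ∃ g : L2, ∀ k, ∀ᵐ ξ : ℝ, hat g k ξ = m k ξ * hat f k ξ := by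
  have bound : ∀ k, ∀ᵐ ξ : ℝ, ‖(m k ξ : ℂ) * hat f k ξ‖ ≤ |C| * ‖hat f k ξ‖ := fun k => by
    -- Where `f` has no mode the multiplier may violate the bound; for mean-zero data this exempts
    -- `k = 0`, at which there is no damping at `ξ = 0`.
    by_cases h0 : hat f k = 0
    · have : hat f k =ᵐ[volume] 0 := by rw [h0]; exact Lp.coeFn_zero _ _ _
      filter_upwards [this] with ξ hξ
      rw [hξ]; simp
    · refine Eventually.of_forall fun ξ => ?_
      rw [norm_mul, Complex.norm_real, Real.norm_eq_abs]
      exact mul_le_mul_of_nonneg_right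
        (((hC k ξ).resolve_left h0).trans (le_abs_self C)) (norm_nonneg _)
  have mem : ∀ k, MemLp (fun ξ => (m k ξ : ℂ) * hat f k ξ) 2 := fun k =>
    (Lp.memLp (hat f k)).of_le_mul ((Complex.measurable_ofReal.comp
      (hm k)).aestronglyMeasurable.mul (Lp.aestronglyMeasurable _)) (bound k)
  let G : ℤ → LineL2 := fun k => (mem k).toLp
  have hG : ∀ k, ∀ᵐ ξ : ℝ, G k ξ = m k ξ * hat f k ξ := fun k => (mem k).coeFn_toLp
  have nG : ∀ k, ‖G k‖ ≤ |C| * ‖hat f k‖ := fun k => by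
    refine Lp.norm_le_mul_norm_of_ae_le_mul ?_
    filter_upwards [hG k, bound k] with ξ h1 h2
    rw [h1]; exact h2
  have hinj : Function.Injective (fun a : LineL2 => 𝓕 a) := fourierR.injective
  have hsum : Summable fun k => ‖(𝓕⁻ (G k) : LineL2)‖ ^ 2 := by
    have h0 : Summable fun k => |C| ^ 2 * (2 * π)⁻¹ * (2 * π * ‖hat f k‖ ^ 2) :=
      (hasSum_norm_sq_hat f).summable.mul_left _
    refine Summable.of_nonneg_of_le (fun k => by positivity) (fun k => ?_) h0
    have e : ‖(𝓕⁻ (G k) : LineL2)‖ = ‖G k‖ := by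
      rw [← Lp.norm_fourier_eq, FourierTransform.fourier_fourierInv_eq]
    rw [e]
    calc ‖G k‖ ^ 2 ≤ (|C| * ‖hat f k‖) ^ 2 := by gcongr; exact nG k
      _ = _ := by field_simp
  have herm : ∀ k, (𝓕⁻ (G (-k)) : LineL2) = star (𝓕⁻ (G k) : LineL2) := fun k => by
    refine hinj (Lp.ext ?_)
    have hneg : ∀ᵐ ξ : ℝ, G k (-ξ) = m k (-ξ) * hat f k (-ξ) :=
      (Measure.measurePreserving_neg (volume : Measure ℝ)).quasiMeasurePreserving.ae (hG k)
    have hf' : ∀ᵐ ξ : ℝ, hat f (-k) ξ = conj (hat f k (-ξ)) := by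
      rw [hat, mode_neg]; exact fourier_star _
    simp only [FourierTransform.fourier_fourierInv_eq]
    filter_upwards [hG (-k), fourier_star (𝓕⁻ (G k)), hneg, hf'] with ξ h1 h2 h3 h4
    rw [h2, FourierTransform.fourier_fourierInv_eq, h3, h1, h4, map_mul, Complex.conj_ofReal]
    congr 2
    rw [← he k (-ξ), neg_neg]
  obtain ⟨g, hg⟩ := exists_mode_eq (h := fun k => 𝓕⁻ (G k)) hsum herm
  refine ⟨g, fun k => ?_⟩
  have : hat g k = G k := by
    rw [hat, hg, FourierTransform.fourier_fourierInv_eq]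
  rw [this]; exact hG k

end

section

/-! ### Calculus of test functions -/

/-- A function on the channel as a function on the plane that is periodic in `x`. -/
def unroll (ψ : Channel → ℝ) (q : ℝ × ℝ) : ℝ := ψ ((q.1 : Torus), q.2)

theorem unroll_injective {φ ψ : Channel → ℝ} (h : unroll φ = unroll ψ) : φ = ψ := by
  funext ⟨x, y⟩
  induction x using QuotientAddGroup.induction_on with
  | H x => exact congrFun h (x, y)

/-- Smoothness of test functions is stated for the periodic lift to the plane; the quotient map
brings continuity and derivatives back to the channel. -/
theorem isOpenQuotientMap_cover :
    IsOpenQuotientMap (fun q : ℝ × ℝ => (((q.1 : Torus), q.2) : Channel)) :=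
  (QuotientAddGroup.isOpenQuotientMap_mk).prodMap IsOpenQuotientMap.id

variable {φ ψ : Channel → ℝ}

theorem IsTest.contDiff_unroll (h : IsTest ψ) : ContDiff ℝ ∞ (unroll ψ) := h.smooth

theorem IsTest.continuous (h : IsTest ψ) : Continuous ψ :=
  isOpenQuotientMap_cover.isQuotientMap.continuous_iff.2 h.contDiff_unroll.continuous

theorem IsTest.differentiable_unroll (h : IsTest ψ) : Differentiable ℝ (unroll ψ) :=
  h.contDiff_unroll.differentiable (by simp)

theorem IsTest.hasDerivAt_unroll_fst (h : IsTest ψ) (q : ℝ × ℝ) :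
    HasDerivAt (fun s : ℝ => unroll ψ (q.1 + s, q.2)) (fderiv ℝ (unroll ψ) q (1, 0)) 0 := by
  have h1 : HasDerivAt (fun s : ℝ => (q.1 + s, q.2)) ((1 : ℝ), (0 : ℝ)) 0 :=
    ((hasDerivAt_id (0 : ℝ)).const_add q.1).prodMk (hasDerivAt_const _ _)
  have h2 : HasFDerivAt (unroll ψ) (fderiv ℝ (unroll ψ) q) (q.1 + 0, q.2) := by
    simpa using (h.differentiable_unroll q).hasFDerivAt
  exact h2.comp_hasDerivAt (0 : ℝ) h1

theorem IsTest.hasDerivAt_unroll_snd (h : IsTest ψ) (q : ℝ × ℝ) :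
    HasDerivAt (fun s : ℝ => unroll ψ (q.1, s)) (fderiv ℝ (unroll ψ) q (0, 1)) q.2 := by
  have h1 : HasDerivAt (fun s : ℝ => (q.1, s)) ((0 : ℝ), (1 : ℝ)) q.2 :=
    (hasDerivAt_const _ _).prodMk (hasDerivAt_id q.2)
  have h2 : HasFDerivAt (unroll ψ) (fderiv ℝ (unroll ψ) q) (q.1, q.2) :=
    (h.differentiable_unroll q).hasFDerivAt
  exact h2.comp_hasDerivAt q.2 h1

theorem unroll_dx (h : IsTest ψ) : unroll (dx ψ) = fun q => fderiv ℝ (unroll ψ) q (1, 0) := by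
  funext q
  rw [← (h.hasDerivAt_unroll_fst q).deriv]
  simp only [unroll, dx, AddCircle.coe_add]

theorem unroll_dy (h : IsTest ψ) : unroll (dy ψ) = fun q => fderiv ℝ (unroll ψ) q (0, 1) := by
  funext q
  rw [← (h.hasDerivAt_unroll_snd q).deriv]
  rfl

theorem IsTest.hasDerivAt_fst (h : IsTest ψ) (p : Channel) :
    HasDerivAt (fun s : ℝ => ψ (p.1 + (s : Torus), p.2)) (dx ψ p) 0 := by
  obtain ⟨q, rfl⟩ := isOpenQuotientMap_cover.surjective p
  have := h.hasDerivAt_unroll_fst q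
  rw [← congrFun (unroll_dx h) q] at this
  simpa only [unroll, AddCircle.coe_add] using this

theorem IsTest.hasDerivAt_snd (h : IsTest ψ) (p : Channel) :
    HasDerivAt (fun s : ℝ => ψ (p.1, s)) (dy ψ p) p.2 := by
  obtain ⟨q, rfl⟩ := isOpenQuotientMap_cover.surjective p
  have := h.hasDerivAt_unroll_snd q
  rwa [← congrFun (unroll_dy h) q] at this

theorem support_dx_subset (ψ : Channel → ℝ) : Function.support (dx ψ) ⊆ tsupport ψ := by
  intro p hp
  by_contra hn
  refine hp ?_
  have h1 : ψ =ᶠ[𝓝 p] 0 := notMem_tsupport_iff_eventuallyEq.1 hn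
  have hc : Continuous (fun s : ℝ => ((p.1 + (s : Torus), p.2) : Channel)) :=
    (continuous_const.add (AddCircle.continuous_mk' _)).prodMk continuous_const
  have h2 : Tendsto (fun s : ℝ => ((p.1 + (s : Torus), p.2) : Channel)) (𝓝 0) (𝓝 p) := by
    have := hc.tendsto 0
    simpa using this
  have h3 : (fun s : ℝ => ψ (p.1 + (s : Torus), p.2)) =ᶠ[𝓝 0] fun _ => 0 :=
    h2.eventually h1
  rw [dx, h3.deriv_eq, deriv_const]

theorem support_dy_subset (ψ : Channel → ℝ) : Function.support (dy ψ) ⊆ tsupport ψ := by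
  intro p hp
  by_contra hn
  refine hp ?_
  have h1 : ψ =ᶠ[𝓝 p] 0 := notMem_tsupport_iff_eventuallyEq.1 hn
  have hc : Continuous (fun s : ℝ => ((p.1, s) : Channel)) := continuous_const.prodMk continuous_id
  have h3 : (fun s : ℝ => ψ (p.1, s)) =ᶠ[𝓝 p.2] fun _ => 0 := (hc.tendsto p.2).eventually h1
  rw [dy, h3.deriv_eq, deriv_const]

theorem IsTest.dx (h : IsTest ψ) : IsTest (dx ψ) where
  smooth := by
    change ContDiff ℝ ∞ (unroll (Couette.dx ψ))
    rw [unroll_dx h]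
    exact (h.contDiff_unroll.fderiv_right (m := ∞) (by simp)).clm_apply contDiff_const
  compact_support := h.compact_support.mono' (support_dx_subset ψ)

theorem IsTest.dy (h : IsTest ψ) : IsTest (dy ψ) where
  smooth := by
    change ContDiff ℝ ∞ (unroll (Couette.dy ψ))
    rw [unroll_dy h]
    exact (h.contDiff_unroll.fderiv_right (m := ∞) (by simp)).clm_apply contDiff_const
  compact_support := h.compact_support.mono' (support_dy_subset ψ)

theorem IsTest.add (h : IsTest ψ) (h' : IsTest φ) : IsTest (ψ + φ) where
  smooth := h.smooth.add h'.smooth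
  compact_support := h.compact_support.add h'.compact_support

theorem IsTest.smul (c : ℝ) (h : IsTest ψ) : IsTest (c • ψ) where
  smooth := contDiff_const.mul h.smooth
  compact_support := h.compact_support.smul_left (f := fun _ : Channel => c)

theorem isTest_zero : IsTest 0 := ⟨contDiff_const, HasCompactSupport.zero⟩

theorem IsTest.mul (h : IsTest ψ) (h' : IsTest φ) : IsTest (fun p => ψ p * φ p) where
  smooth := h.smooth.mul h'.smooth
  compact_support := h.compact_support.mul_right

theorem IsTest.snd_mul (h : IsTest ψ) : IsTest (fun p => p.2 * ψ p) where
  smooth := contDiff_snd.mul h.smooth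
  compact_support := h.compact_support.mul_left

theorem IsTest.lap (h : IsTest ψ) : IsTest (lap ψ) := h.dx.dx.add h.dy.dy

theorem IsTest.memLp (h : IsTest ψ) (r : ℝ≥0∞) : MemLp ψ r :=
  h.continuous.memLp_of_hasCompactSupport h.compact_support

theorem IsTest.integrable (h : IsTest ψ) : Integrable ψ :=
  h.continuous.integrable_of_hasCompactSupport h.compact_support

theorem dx_add (h : IsTest ψ) (h' : IsTest φ) : dx (ψ + φ) = dx ψ + dx φ :=
  funext fun p => ((h.hasDerivAt_fst p).add (h'.hasDerivAt_fst p)).deriv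

theorem dy_add (h : IsTest ψ) (h' : IsTest φ) : dy (ψ + φ) = dy ψ + dy φ :=
  funext fun p => ((h.hasDerivAt_snd p).add (h'.hasDerivAt_snd p)).deriv

theorem dx_smul (c : ℝ) (h : IsTest ψ) : dx (c • ψ) = c • dx ψ :=
  funext fun p => ((h.hasDerivAt_fst p).const_mul c).deriv

theorem dy_smul (c : ℝ) (h : IsTest ψ) : dy (c • ψ) = c • dy ψ :=
  funext fun p => ((h.hasDerivAt_snd p).const_mul c).deriv

theorem dx_mul (h : IsTest ψ) (h' : IsTest φ) (p : Channel) :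
    dx (fun p => ψ p * φ p) p = dx ψ p * φ p + ψ p * dx φ p := by
  have e := ((h.hasDerivAt_fst p).fun_mul (h'.hasDerivAt_fst p)).deriv
  simp only [AddCircle.coe_zero, add_zero] at e
  exact e

theorem dy_mul (h : IsTest ψ) (h' : IsTest φ) (p : Channel) :
    dy (fun p => ψ p * φ p) p = dy ψ p * φ p + ψ p * dy φ p :=
  ((h.hasDerivAt_snd p).mul (h'.hasDerivAt_snd p)).deriv

theorem dx_snd_mul (h : IsTest ψ) (p : Channel) : dx (fun p => p.2 * ψ p) p = p.2 * dx ψ p :=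
  ((h.hasDerivAt_fst p).const_mul p.2).deriv

/-- Symmetry of second derivatives is what makes `∇^⊥φ` divergence free in the weak sense. -/
theorem dx_dy_comm (h : IsTest ψ) : dx (dy ψ) = dy (dx ψ) := by
  refine unroll_injective ?_
  rw [unroll_dx h.dy, unroll_dy h.dx, unroll_dx h, unroll_dy h]
  funext q
  have hd : DifferentiableAt ℝ (fderiv ℝ (unroll ψ)) q :=
    ((h.contDiff_unroll.fderiv_right (m := ∞) (by simp)).differentiable (by simp)) q
  have hs : IsSymmSndFDerivAt ℝ (unroll ψ) q :=
    h.contDiff_unroll.contDiffAt.isSymmSndFDerivAt (by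
      rw [minSmoothness_of_isRCLikeNormedField]; exact WithTop.coe_le_coe.2 le_top)
  rw [fderiv_clm_apply hd (differentiableAt_const _), fderiv_clm_apply hd (differentiableAt_const _)]
  simpa using hs.eq (1, 0) (0, 1)

theorem integral_dy_eq_zero (h : IsTest ψ) : ∫ p, dy ψ p = 0 := by
  have e : ∫ p, dy ψ p = ∫ x : Torus, ∫ y : ℝ, dy ψ (x, y) := integral_prod _ h.dy.integrable
  rw [e, ← integral_zero Torus ℝ]
  refine integral_congr_ae (Eventually.of_forall fun x => ?_)
  have hcl : Topology.IsClosedEmbedding (fun y : ℝ => ((x, y) : Channel)) :=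
    (Isometry.of_dist_eq fun a b => by simp [Prod.dist_eq]).isClosedEmbedding
  have c0 : HasCompactSupport (fun y : ℝ => ψ (x, y)) :=
    h.compact_support.comp_isClosedEmbedding hcl
  have c1 : HasCompactSupport (fun y : ℝ => dy ψ (x, y)) :=
    h.dy.compact_support.comp_isClosedEmbedding hcl
  exact integral_eq_zero_of_hasDerivAt_of_integrable (f := fun y : ℝ => ψ (x, y))
    (fun y => h.hasDerivAt_snd (x, y))
    ((h.dy.continuous.comp hcl.continuous).integrable_of_hasCompactSupport c1)
    ((h.continuous.comp hcl.continuous).integrable_of_hasCompactSupport c0)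

theorem integral_dx_eq_zero (h : IsTest ψ) : ∫ p, dx ψ p = 0 := by
  have e : ∫ p, dx ψ p = ∫ y : ℝ, ∫ x : Torus, dx ψ (x, y) := integral_prod_symm _ h.dx.integrable
  rw [e, ← integral_zero ℝ ℝ]
  refine integral_congr_ae (Eventually.of_forall fun y => ?_)
  change ∫ x : Torus, dx ψ (x, y) = 0
  rw [← AddCircle.intervalIntegral_preimage (2 * π) 0 (fun x : Torus => dx ψ (x, y))]
  have hd : ∀ s : ℝ, HasDerivAt (fun s : ℝ => ψ ((s : Torus), y)) (dx ψ ((s : Torus), y)) s := by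
    intro s
    have h1 := h.hasDerivAt_fst ((s : Torus), y)
    have h2 : HasDerivAt (fun r : ℝ => ψ ((s : Torus) + ((r - s : ℝ) : Torus), y))
        (dx ψ ((s : Torus), y)) s := by
      have h3 : HasDerivAt (fun r : ℝ => r - s) 1 s := (hasDerivAt_id s).sub_const s
      have := HasDerivAt.comp s (by rw [sub_self]; exact h1) h3
      simpa [Function.comp_def] using this
    refine h2.congr_of_eventuallyEq (Eventually.of_forall fun r => ?_)
    simp only [← AddCircle.coe_add, add_sub_cancel]
  have hc : Continuous (fun s : ℝ => dx ψ ((s : Torus), y)) :=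
    h.dx.continuous.comp ((AddCircle.continuous_mk' _).prodMk continuous_const)
  rw [intervalIntegral.integral_eq_sub_of_hasDerivAt (fun s _ => hd s)
    (hc.intervalIntegrable _ _), zero_add, AddCircle.coe_period]
  simp

theorem integral_mul_dx (h : IsTest ψ) (h' : IsTest φ) :
    ∫ p, ψ p * dx φ p = -∫ p, dx ψ p * φ p := by
  have h1 := integral_dx_eq_zero (h.mul h')
  simp_rw [dx_mul h h'] at h1
  rw [integral_add (h.dx.mul h').integrable (h.mul h'.dx).integrable] at h1
  linarith

theorem integral_mul_dy (h : IsTest ψ) (h' : IsTest φ) :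
    ∫ p, ψ p * dy φ p = -∫ p, dy ψ p * φ p := by
  have h1 := integral_dy_eq_zero (h.mul h')
  simp_rw [dy_mul h h'] at h1
  rw [integral_add (h.dy.mul h').integrable (h.mul h'.dy).integrable] at h1
  linarith

/-- The class in `L²` of a test function. -/
def IsTest.toL2 (h : IsTest ψ) : L2 := (h.memLp 2).toLp

theorem IsTest.toL2_ae (h : IsTest ψ) : h.toL2 =ᵐ[volume] ψ := (h.memLp 2).coeFn_toLp

theorem inner_eq_integral (f g : L2) : ⟪f, g⟫_ℝ = ∫ p, f p * g p := by
  rw [L2.inner_def]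
  simp [mul_comm]

theorem inner_toL2 (f : L2) (h : IsTest ψ) : ⟪f, h.toL2⟫_ℝ = ∫ p, f p * ψ p := by
  rw [inner_eq_integral]
  exact integral_congr_ae (h.toL2_ae.mono fun p hp => by simp only [hp])

theorem IsTest.hasWeakGrad (h : IsTest ψ) : HasWeakGrad h.toL2 h.dx.toL2 h.dy.toL2 where
  weak_dx φ hφ := by
    have e1 : ∫ p, h.toL2 p * Couette.dx φ p = ∫ p, ψ p * Couette.dx φ p :=
      integral_congr_ae (h.toL2_ae.mono fun p hp => by simp only [hp])
    have e2 : ∫ p, h.dx.toL2 p * φ p = ∫ p, Couette.dx ψ p * φ p :=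
      integral_congr_ae (h.dx.toL2_ae.mono fun p hp => by simp only [hp])
    rw [e1, e2, integral_mul_dx h hφ]
  weak_dy φ hφ := by
    have e1 : ∫ p, h.toL2 p * Couette.dy φ p = ∫ p, ψ p * Couette.dy φ p :=
      integral_congr_ae (h.toL2_ae.mono fun p hp => by simp only [hp])
    have e2 : ∫ p, h.dy.toL2 p * φ p = ∫ p, Couette.dy ψ p * φ p :=
      integral_congr_ae (h.dy.toL2_ae.mono fun p hp => by simp only [hp])
    rw [e1, e2, integral_mul_dy h hφ]

/-! ### Test functions with a single mode -/

/-- The function `Re (e^{-ikx} q(y))`. -/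
def wave (k : ℤ) (q : ℝ → ℂ) (p : Channel) : ℝ := (fourier (-k) p.1 * q p.2 : ℂ).re

theorem fourier_coe_eq_exp (k : ℤ) (x : ℝ) :
    (fourier (-k) (x : Torus) : ℂ) = Complex.exp (-(k * x) * Complex.I) := by
  rw [fourier_coe_apply]
  congr 1
  have : (π : ℂ) ≠ 0 := by exact_mod_cast Real.pi_ne_zero
  push_cast
  field_simp

theorem isTest_wave (k : ℤ) {q : ℝ → ℂ} (hq : ContDiff ℝ ∞ q) (hc : HasCompactSupport q) :
    IsTest (wave k q) where
  smooth := by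
    have e : (fun p : ℝ × ℝ => wave k q ((p.1 : Torus), p.2)) =
        fun p : ℝ × ℝ => Complex.reCLM (Complex.exp (-(k * p.1) * Complex.I) * q p.2) := by
      funext p
      simp only [wave, fourier_coe_eq_exp, Complex.reCLM_apply]
    rw [e]
    refine Complex.reCLM.contDiff.comp (ContDiff.mul ?_ (hq.comp contDiff_snd))
    have h1 : ContDiff ℝ ∞ (fun p : ℝ × ℝ => (p.1 : ℂ)) := Complex.ofRealCLM.contDiff.comp contDiff_fst
    exact ((contDiff_const.mul h1).neg.mul contDiff_const).cexp
  compact_support := by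
    refine HasCompactSupport.of_support_subset_isCompact
      (K := (univ : Set Torus) ×ˢ tsupport q) (isCompact_univ.prod hc) fun p hp => ?_
    refine ⟨trivial, subset_tsupport q fun h0 => hp ?_⟩
    simp [wave, h0]

theorem dx_wave (k : ℤ) (q : ℝ → ℂ) : dx (wave k q) = wave k (fun y => -(k * Complex.I) * q y) := by
  funext p
  have h1 : HasDerivAt (fun s : ℝ => Complex.exp (-(k * s) * Complex.I)) (-(k * Complex.I)) 0 := by
    have h2 : HasDerivAt (fun s : ℝ => (-(k * (s : ℂ)) * Complex.I)) (-(k * Complex.I)) 0 := by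
      have := (((hasDerivAt_id (0 : ℝ)).ofReal_comp.const_mul (k : ℂ)).neg.mul_const Complex.I)
      simpa using this
    have := h2.cexp
    simpa using this
  have h3 : HasDerivAt (fun s : ℝ => wave k q (p.1 + (s : Torus), p.2))
      (wave k (fun y => -(k * Complex.I) * q y) p) 0 := by
    have h4 := ((h1.const_mul (fourier (-k) p.1 : ℂ)).mul_const (q p.2))
    have h5 := (Complex.reCLM.hasFDerivAt).comp_hasDerivAt (0 : ℝ) h4
    have e : (fun s : ℝ => wave k q (p.1 + (s : Torus), p.2)) = Complex.reCLM ∘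
        fun s : ℝ => (fourier (-k) p.1 : ℂ) * Complex.exp (-(k * s) * Complex.I) * q p.2 := by
      funext s
      simp only [wave, Function.comp_apply, Complex.reCLM_apply, ← fourier_coe_eq_exp]
      congr 2
      simp only [fourier_apply, smul_add, AddCircle.toCircle_add, Circle.coe_mul]
    rw [e]
    convert! h5 using 1
    simp only [wave, Complex.reCLM_apply]
    congr 1
    ring
  exact h3.deriv

theorem dy_wave (k : ℤ) {q : ℝ → ℂ} (hq : Differentiable ℝ q) :
    dy (wave k q) = wave k (deriv q) := by
  funext p
  exact ((Complex.reCLM.hasFDerivAt).comp_hasDerivAt p.2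
    ((hq p.2).hasDerivAt.const_mul (fourier (-k) p.1 : ℂ))).deriv

theorem lap_wave (k : ℤ) {q : ℝ → ℂ} (hq : ContDiff ℝ ∞ q) :
    lap (wave k q) = wave k (fun y => deriv (deriv q) y - k ^ 2 * q y) := by
  have hq' : ContDiff ℝ ∞ (deriv q) := (contDiff_infty_iff_deriv.1 hq).2
  funext p
  rw [lap, dx_wave, dx_wave, dy_wave k (hq.differentiable (by simp)),
    dy_wave k (hq'.differentiable (by simp))]
  simp only [wave, ← Complex.add_re]
  congr 1
  ring_nf
  simp only [Complex.I_sq]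
  ring

/-- Pairing with a single-mode function only sees that mode. -/
theorem integral_mul_wave (f : L2) (k : ℤ) {q : ℝ → ℂ} (hq : MemLp q 2) :
    ∫ p, f p * wave k q p = (2 * π * ∫ y, mode f k y * q y).re := by
  have h1 : MemLp (fun p : Channel => q p.2) 2 := hq.comp_snd (volume : Measure Torus)
  have h2 : MemLp (wave k q) 2 := by
    have : MemLp (fun p : Channel => (fourier (-k) p.1 * q p.2 : ℂ)) 2 :=
      h1.of_le ((((fourier (-k)).continuous.comp continuous_fst).aestronglyMeasurable).mul h1.1)
        (Eventually.of_forall fun p => by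
          rw [norm_mul, fourier_apply, Circle.norm_coe, one_mul])
    exact this.re
  have hint : Integrable (fun p => f p * wave k q p) :=
    MemLp.integrable_mul (p := 2) (q := 2) (Lp.memLp f) h2
  have hs : ∫ p, f p * wave k q p = ∫ y : ℝ, ∫ x : Torus, f (x, y) * wave k q (x, y) :=
    integral_prod_symm _ hint
  have hi : Integrable (fun y => mode f k y * q y) := integrable_lineL2_mul _ hq
  rw [hs, ← integral_const_mul]
  have e : ∀ᵐ y : ℝ, ∫ x : Torus, f (x, y) * wave k q (x, y) =
      (2 * π * (mode f k y * q y)).re := by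
    filter_upwards [mode_ae f k, ae_memLp_slice (Lp.memLp f)] with y hy hm
    rw [hy, fourierCoeff, AddCircle.integral_haarAddCircle]
    have i1 : Integrable (fun x : Torus => ((f (x, y) : ℝ) : ℂ)) :=
      (hm.integrable (by norm_num)).ofReal
    have i2 : Integrable (fun x : Torus => (fourier (-k) x : ℂ) • ((f (x, y) : ℝ) : ℂ)) :=
      i1.bdd_mul (c := 1) (fourier (-k)).continuous.aestronglyMeasurable
        (Eventually.of_forall fun x => by rw [fourier_apply, Circle.norm_coe])
    have e1 : (2 * π * (((2 * π)⁻¹ • ∫ x : Torus, (fourier (-k) x : ℂ) • ((f (x, y) : ℝ) : ℂ))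
        * q y)).re = Complex.reCLM (∫ x : Torus, ((fourier (-k) x : ℂ) • ((f (x, y) : ℝ) : ℂ)) * q y) := by
      rw [Complex.reCLM_apply, integral_mul_const]
      congr 1
      rw [Complex.real_smul]
      have : (π : ℂ) ≠ 0 := by exact_mod_cast Real.pi_ne_zero
      push_cast
      field_simp
    rw [e1, ← ContinuousLinearMap.integral_comp_comm _ (i2.mul_const _)]
    refine integral_congr_ae (Eventually.of_forall fun x => ?_)
    simp only [wave, Complex.reCLM_apply, smul_eq_mul, Complex.mul_re, Complex.mul_im,
      Complex.ofReal_re, Complex.ofReal_im]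
    ring
  rw [integral_congr_ae e]
  exact ContinuousLinearMap.integral_comp_comm Complex.reCLM (hi.const_mul _)

end

section

/-! ### Weak identities on the Fourier side -/

/-- Test functions on the channel are real, so only real parts are accessible directly; replacing
`ρ` by `iρ` recovers the imaginary part. -/
theorem weak_identity_of_re {A₀ A₁ A₂ : LineL2}
    (h : ∀ ρ : ℝ → ℂ, ContDiff ℝ ∞ ρ → HasCompactSupport ρ →
      (2 * π * ((∫ y, A₀ y * ρ y) + (∫ y, A₁ y * deriv ρ y)
        + ∫ y, A₂ y * deriv (deriv ρ) y) : ℂ).re = 0)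
    (ρ : ℝ → ℂ) (hρ : ContDiff ℝ ∞ ρ) (hc : HasCompactSupport ρ) :
    (∫ y, A₀ y * ρ y) + (∫ y, A₁ y * deriv ρ y) + ∫ y, A₂ y * deriv (deriv ρ) y = 0 := by
  have h1 := h ρ hρ hc
  have h2 := h (fun y => Complex.I * ρ y) (contDiff_const.mul hρ) hc.mul_left
  have d1 : deriv (fun y => Complex.I * ρ y) = fun y => Complex.I * deriv ρ y := by
    funext y; exact deriv_const_mul_field _
  have d2 : deriv (fun y => Complex.I * deriv ρ y) = fun y => Complex.I * deriv (deriv ρ) y := by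
    funext y; exact deriv_const_mul_field _
  simp only [d1, d2, mul_left_comm _ Complex.I, integral_const_mul, ← mul_add] at h2
  rw [← Complex.ofReal_ofNat, ← Complex.ofReal_mul, Complex.re_ofReal_mul] at h1
  have h3 : (((2 * π : ℝ) : ℂ) * (Complex.I * ((∫ y, A₀ y * ρ y) + (∫ y, A₁ y * deriv ρ y)
      + ∫ y, A₂ y * deriv (deriv ρ) y))).re = 0 := by
    rw [← h2]; congr 1; push_cast; ring
  rw [Complex.re_ofReal_mul, Complex.I_mul_re] at h3
  have hp : (2 * π : ℝ) ≠ 0 := by positivity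
  exact Complex.ext ((mul_eq_zero.1 h1).resolve_left hp)
    (neg_eq_zero.1 ((mul_eq_zero.1 h3).resolve_left hp))

theorem fourier_of_weak_identity_re {A₀ A₁ A₂ : LineL2}
    (h : ∀ ρ : ℝ → ℂ, ContDiff ℝ ∞ ρ → HasCompactSupport ρ →
      (2 * π * ((∫ y, A₀ y * ρ y) + (∫ y, A₁ y * deriv ρ y)
        + ∫ y, A₂ y * deriv (deriv ρ) y) : ℂ).re = 0) :
    ∀ᵐ ξ : ℝ, (𝓕 A₀) ξ - 2 * π * Complex.I * ξ * (𝓕 A₁) ξ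
      + (2 * π * Complex.I * ξ) ^ 2 * (𝓕 A₂) ξ = 0 :=
  fourier_of_weak_identity (weak_identity_of_re h)

theorem memLp_of_smooth {ρ : ℝ → ℂ} (hρ : ContDiff ℝ ∞ ρ) (hc : HasCompactSupport ρ) :
    MemLp ρ 2 := hρ.continuous.memLp_of_hasCompactSupport hc

theorem zero_mul_integral (ρ : ℝ → ℂ) : ∫ y, (0 : LineL2) y * ρ y = 0 := by
  rw [← integral_zero ℝ ℂ]
  refine integral_congr_ae ?_
  filter_upwards [Lp.coeFn_zero ℂ 2 (volume : Measure ℝ)] with y hy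
  rw [hy]; simp

theorem fourier_add_smul (A B : LineL2) (c : ℂ) :
    ∀ᵐ ξ : ℝ, (𝓕 (A + c • B)) ξ = (𝓕 A) ξ + c * (𝓕 B) ξ := by
  have e : 𝓕 (A + c • B) = 𝓕 A + c • 𝓕 B := by
    rw [FourierTransform.fourier_add, FourierTransform.fourier_smul]
  rw [e]
  filter_upwards [Lp.coeFn_add (𝓕 A) (c • 𝓕 B), Lp.coeFn_smul c (𝓕 B)] with ξ h1 h2
  rw [h1, Pi.add_apply, h2]; rfl

theorem fourier_zero_ae : ∀ᵐ ξ : ℝ, (𝓕 (0 : LineL2)) ξ = 0 := by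
  have : 𝓕 (0 : LineL2) = 0 := fourierR.map_zero
  rw [this]; exact Lp.coeFn_zero _ _ _

theorem integral_add_smul_mul (A B : LineL2) (c : ℂ) {ρ : ℝ → ℂ} (hρ : MemLp ρ 2) :
    ∫ y, (A + c • B : LineL2) y * ρ y = (∫ y, A y * ρ y) + c * ∫ y, B y * ρ y := by
  rw [← integral_const_mul, ← integral_add (integrable_lineL2_mul A hρ)
    ((integrable_lineL2_mul B hρ).const_mul c)]
  refine integral_congr_ae ?_
  filter_upwards [Lp.coeFn_add A (c • B), Lp.coeFn_smul c B] with y h1 h2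
  rw [h1, Pi.add_apply, h2]
  simp only [Pi.smul_apply, smul_eq_mul]
  ring

/-! ### The weak gradient -/

/-- Testing with single-mode waves turns the weak derivative into an identity in `y`, whose Fourier
symbol is read off almost everywhere. -/
theorem HasWeakGrad.hat_dx {u ux uy : L2} (h : HasWeakGrad u ux uy) (k : ℤ) :
    ∀ᵐ ξ : ℝ, hat ux k ξ = Complex.I * k * hat u k ξ := by
  have key := fourier_of_weak_identity_re (A₀ := mode ux k + (-(k * Complex.I)) • mode u k)
    (A₁ := 0) (A₂ := 0) fun ρ hρ hc => by
      have m := memLp_of_smooth hρ hc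
      have h1 := h.weak_dx _ (isTest_wave k hρ hc)
      rw [dx_wave, integral_mul_wave u k (m.const_mul _), integral_mul_wave ux k m] at h1
      rw [zero_mul_integral, zero_mul_integral, add_zero, add_zero, integral_add_smul_mul _ _ _ m,
        mul_add, Complex.add_re]
      simp_rw [mul_left_comm (mode u k _) _, integral_const_mul] at h1
      rw [h1]; ring
  filter_upwards [key, fourier_add_smul (mode ux k) (mode u k) (-(k * Complex.I)),
    fourier_zero_ae] with ξ h1 h2 h3
  rw [h2, h3] at h1
  change hat ux k ξ + -(k * Complex.I) * hat u k ξ - _ + _ = 0 at h1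
  linear_combination h1

theorem HasWeakGrad.hat_dy {u ux uy : L2} (h : HasWeakGrad u ux uy) (k : ℤ) :
    ∀ᵐ ξ : ℝ, hat uy k ξ = Complex.I * ((2 * π * ξ : ℝ) : ℂ) * hat u k ξ := by
  have key := fourier_of_weak_identity_re (A₀ := mode uy k) (A₁ := mode u k) (A₂ := 0)
    fun ρ hρ hc => by
      have m := memLp_of_smooth hρ hc
      have m' := memLp_of_smooth (contDiff_infty_iff_deriv.1 hρ).2 hc.deriv
      have h1 := h.weak_dy _ (isTest_wave k hρ hc)
      rw [dy_wave k (hρ.differentiable (by simp)), integral_mul_wave u k m',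
        integral_mul_wave uy k m] at h1
      rw [zero_mul_integral, add_zero, mul_add, Complex.add_re, h1]
      ring
  filter_upwards [key, fourier_zero_ae] with ξ h1 h3
  rw [h3] at h1
  change hat uy k ξ - 2 * π * Complex.I * ξ * hat u k ξ + _ = 0 at h1
  push_cast
  linear_combination h1

/-- A purely imaginary multiplier is skew-adjoint: integration by parts on the Fourier side. -/
theorem inner_eq_neg_inner_of_imaginary {a a' b b' : LineL2} {c : ℝ → ℝ}
    (ha : ∀ᵐ ξ : ℝ, a' ξ = Complex.I * (c ξ : ℂ) * a ξ)
    (hb : ∀ᵐ ξ : ℝ, b' ξ = Complex.I * (c ξ : ℂ) * b ξ) : ⟪a, b'⟫_ℝ = -⟪a', b⟫_ℝ := by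
  rw [L2.inner_def, L2.inner_def, ← integral_neg]
  refine integral_congr_ae ?_
  filter_upwards [ha, hb] with ξ h1 h2
  rw [h1, h2]
  simp only [Complex.inner, Complex.mul_re, Complex.mul_im, Complex.conj_re, Complex.conj_im,
    Complex.I_re, Complex.I_im, Complex.ofReal_re, Complex.ofReal_im]
  ring

/-- The weak gradient is characterised by its Fourier symbol. -/
theorem hasWeakGrad_of_hat {u ux uy : L2}
    (hx : ∀ k : ℤ, ∀ᵐ ξ : ℝ, hat ux k ξ = Complex.I * k * hat u k ξ)
    (hy : ∀ k : ℤ, ∀ᵐ ξ : ℝ, hat uy k ξ = Complex.I * ((2 * π * ξ : ℝ) : ℂ) * hat u k ξ) :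
    HasWeakGrad u ux uy where
  weak_dx ψ hψ := by
    -- Both sides become sums over modes by Parseval, and the identity is checked mode by mode.
    rw [← inner_toL2 u hψ.dx, ← inner_toL2 ux hψ]
    refine (hasSum_inner_hat u hψ.dx.toL2).unique ?_
    convert! (hasSum_inner_hat ux hψ.toL2).neg using 2 with k
    rw [inner_eq_neg_inner_of_imaginary (a := hat u k) (a' := hat ux k) (b := hat hψ.toL2 k)
      (c := fun _ => (k : ℝ)) (by simpa using hx k) (by simpa using hψ.hasWeakGrad.hat_dx k)]
    ring
  weak_dy ψ hψ := by
    rw [← inner_toL2 u hψ.dy, ← inner_toL2 uy hψ]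
    refine (hasSum_inner_hat u hψ.dy.toL2).unique ?_
    convert! (hasSum_inner_hat uy hψ.toL2).neg using 2 with k
    rw [inner_eq_neg_inner_of_imaginary (a := hat u k) (a' := hat uy k) (b := hat hψ.toL2 k)
      (c := fun ξ => 2 * π * ξ) (hy k) (hψ.hasWeakGrad.hat_dy k)]
    ring

theorem HasWeakGrad.add {u ux uy w wx wy : L2} (h : HasWeakGrad u ux uy)
    (h' : HasWeakGrad w wx wy) : HasWeakGrad (u + w) (ux + wx) (uy + wy) where
  weak_dx ψ hψ := by
    rw [← inner_toL2 _ hψ.dx, ← inner_toL2 _ hψ, inner_add_left, inner_add_left]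
    simp only [inner_toL2]
    rw [h.weak_dx ψ hψ, h'.weak_dx ψ hψ]; ring
  weak_dy ψ hψ := by
    rw [← inner_toL2 _ hψ.dy, ← inner_toL2 _ hψ, inner_add_left, inner_add_left]
    simp only [inner_toL2]
    rw [h.weak_dy ψ hψ, h'.weak_dy ψ hψ]; ring

theorem HasWeakGrad.smul {u ux uy : L2} (c : ℝ) (h : HasWeakGrad u ux uy) :
    HasWeakGrad (c • u) (c • ux) (c • uy) where
  weak_dx ψ hψ := by
    rw [← inner_toL2 _ hψ.dx, ← inner_toL2 _ hψ, real_inner_smul_left, real_inner_smul_left]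
    simp only [inner_toL2]
    rw [h.weak_dx ψ hψ]; ring
  weak_dy ψ hψ := by
    rw [← inner_toL2 _ hψ.dy, ← inner_toL2 _ hψ, real_inner_smul_left, real_inner_smul_left]
    simp only [inner_toL2]
    rw [h.weak_dy ψ hψ]; ring

theorem HasWeakGrad.sub {u ux uy w wx wy : L2} (h : HasWeakGrad u ux uy)
    (h' : HasWeakGrad w wx wy) : HasWeakGrad (u - w) (ux - wx) (uy - wy) := by
  simpa [sub_eq_add_neg] using h.add (h'.smul (-1))

/-- Poincaré's inequality for functions with vanishing `x`-average. -/
theorem HasWeakGrad.norm_le {u ux uy : L2} (h : HasWeakGrad u ux uy) (h0 : ZeroXMean u) :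
    ‖u‖ ≤ ‖ux‖ := by
  refine (pow_le_pow_iff_left₀ (norm_nonneg _) (norm_nonneg _) two_ne_zero).1 ?_
  refine hasSum_le (fun k => ?_) (hasSum_norm_sq_hat u) (hasSum_norm_sq_hat ux)
  gcongr 2 * π * ?_ ^ 2
  by_cases hk : k = 0
  · rw [hk, (zeroXMean_iff_hat u).1 h0]; simp
  · refine Lp.norm_le_norm_of_ae_le ?_
    filter_upwards [h.hat_dx k] with ξ hξ
    rw [hξ, norm_mul, norm_mul, Complex.norm_I, one_mul, Complex.norm_intCast]
    have : (1 : ℝ) ≤ |(k : ℝ)| := by exact_mod_cast Int.one_le_abs hk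
    exact le_mul_of_one_le_left (norm_nonneg _) this

/-! ### The projection onto functions with vanishing `x`-average -/

theorem mode_sub (f g : L2) (k : ℤ) : mode (f - g) k = mode f k - mode g k := (modeL k).map_sub f g

theorem hat_sub (f g : L2) (k : ℤ) : hat (f - g) k = hat f k - hat g k := (hatL k).map_sub f g

theorem hat_add (f g : L2) (k : ℤ) : hat (f + g) k = hat f k + hat g k := (hatL k).map_add f g

/-- The zeroth mode of a real function is real, so the two halves in `mode_tensor` add up to it
exactly. -/
theorem mode_sub_tensor (f : L2) (k : ℤ) :
    mode (f - tensor 0 (mode f 0)) k = if k = 0 then 0 else mode f k := by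
  rw [mode_sub, mode_tensor]
  have h := mode_neg f 0
  rw [neg_zero] at h
  by_cases hk : k = 0
  · simp only [hk, neg_zero, if_true, ← h]
    rw [← add_smul]; norm_num
  · simp [hk]

/-- The projection `f ↦ f_≠`. -/
def projL : L2 →L[ℝ] L2 :=
  LinearMap.mkContinuous
    { toFun := fun f => f - tensor 0 (mode f 0)
      map_add' := fun f g => ext_mode fun k => by
        rw [mode_sub_tensor (f + g), mode_add (f - _), mode_sub_tensor, mode_sub_tensor, mode_add]
        split_ifs <;> simp
      map_smul' := fun c f => ext_mode fun k => by
        rw [RingHom.id_apply, mode_sub_tensor (c • f), mode_smul c (f - _), mode_sub_tensor, mode_smul]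
        split_ifs <;> simp } 1 fun f => by
      rw [one_mul]
      refine (pow_le_pow_iff_left₀ (norm_nonneg _) (norm_nonneg _) two_ne_zero).1 ?_
      refine hasSum_le (fun k => ?_) (hasSum_norm_sq_mode _) (hasSum_norm_sq_mode f)
      gcongr 2 * π * ?_ ^ 2
      change ‖mode (f - tensor 0 (mode f 0)) k‖ ≤ _
      rw [mode_sub_tensor]
      split_ifs <;> simp

theorem mode_projL (f : L2) (k : ℤ) : mode (projL f) k = if k = 0 then 0 else mode f k :=
  mode_sub_tensor f k

theorem hat_projL (f : L2) (k : ℤ) : hat (projL f) k = if k = 0 then 0 else hat f k := by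
  rw [hat, mode_projL]
  split_ifs
  · exact fourierR.map_zero
  · rfl

theorem norm_projL_le (f : L2) : ‖projL f‖ ≤ ‖f‖ := by
  refine (pow_le_pow_iff_left₀ (norm_nonneg _) (norm_nonneg _) two_ne_zero).1 ?_
  refine hasSum_le (fun k => ?_) (hasSum_norm_sq_mode _) (hasSum_norm_sq_mode f)
  gcongr 2 * π * ?_ ^ 2
  rw [mode_projL]
  split_ifs <;> simp

theorem zeroXMean_projL (f : L2) : ZeroXMean (projL f) := by
  rw [zeroXMean_iff, mode_projL, if_pos rfl]

theorem projL_eq_self {f : L2} (h : ZeroXMean f) : projL f = f := by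
  refine ext_mode fun k => ?_
  rw [mode_projL]
  split_ifs with hk
  · rw [hk, (zeroXMean_iff f).1 h]
  · rfl

theorem inner_projL (f g : L2) : ⟪projL f, g⟫_ℝ = ⟪f, projL g⟫_ℝ := by
  refine (hasSum_inner_mode _ _).unique ?_
  convert! hasSum_inner_mode f (projL g) using 2 with k
  rw [mode_projL, mode_projL]
  split_ifs <;> simp

theorem inner_projL_of_zeroXMean (f : L2) {g : L2} (h : ZeroXMean g) :
    ⟪projL f, g⟫_ℝ = ⟪f, g⟫_ℝ := by
  rw [inner_projL, projL_eq_self h]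

/-- Identifies the projection defined through modes with the explicit formula used to state the
nonlinear problem. -/
theorem projL_ae (f : L2) : projL f =ᵐ[volume] projNonzero f := by
  have h0 : ∀ᵐ y : ℝ, mode f 0 y = (((2 * π)⁻¹ * ∫ x : Torus, f (x, y) : ℝ) : ℂ) := by
    filter_upwards [mode_ae f 0] with y hy
    rw [hy, fourierCoeff]
    simp only [neg_zero, fourier_zero, one_smul]
    have := AddCircle.integral_haarAddCircle (T := 2 * π)
      (f := fun x : Torus => ((f (x, y) : ℝ) : ℂ))
    rw [this, integral_complex_ofReal]
    simp
  have h1 : ∀ᵐ p : Channel, mode f 0 p.2 = (((2 * π)⁻¹ * ∫ x : Torus, f (x, p.2) : ℝ) : ℂ) :=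
    Measure.quasiMeasurePreserving_snd.ae h0
  filter_upwards [Lp.coeFn_sub f (tensor 0 (mode f 0)), tensor_ae 0 (mode f 0), h1] with p h2 h3 h4
  change (f - tensor 0 (mode f 0) : L2) p = _
  rw [h2, Pi.sub_apply, h3, h4, fourier_zero, one_mul, Complex.ofReal_re, projNonzero]

theorem HasWeakGrad.projL {u ux uy : L2} (h : HasWeakGrad u ux uy) :
    HasWeakGrad (projL u) (projL ux) (projL uy) := by
  refine hasWeakGrad_of_hat (fun k => ?_) fun k => ?_
  · by_cases hk : k = 0
    · simp only [hat_projL, hk, if_true]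
      filter_upwards [Lp.coeFn_zero ℂ 2 (volume : Measure ℝ)] with ξ hξ
      rw [hξ]; simp
    · simpa only [hat_projL, hk, if_false] using h.hat_dx k
  · by_cases hk : k = 0
    · simp only [hat_projL, hk, if_true]
      filter_upwards [Lp.coeFn_zero ℂ 2 (volume : Measure ℝ)] with ξ hξ
      rw [hξ]; simp
    · simpa only [hat_projL, hk, if_false] using h.hat_dy k

end

section

/-! ### Weak solutions of the linear evolution with a forcing in `L¹_loc(L²)` -/

/-- Weak solutions of `∂ₜu + y ∂ₓu - νΔu = F` with `F` in `L¹_loc([0,∞); L²)`. -/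
structure IsWeakSolution (ν : ℝ) (F u : ℝ → L2) : Prop where
  continuousOn : ContinuousOn u (Ici 0)
  integrable : ∀ T : ℝ, 0 ≤ T → IntervalIntegrable F volume 0 T
  weak : ∀ t : ℝ, 0 ≤ t → ∀ ψ : Channel → ℝ, IsTest ψ →
    (∫ p, u t p * ψ p) - ∫ p, u 0 p * ψ p =
      ∫ s in (0 : ℝ)..t, ((∫ p, u s p * (p.2 * dx ψ p + ν * lap ψ p)) + ∫ p, F s p * ψ p)

/-- The bilinear pairing `(a, c) ↦ ∫ a c` on `L²(ℝ)`. -/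
def linePair : LineL2 →L[ℂ] LineL2 →L[ℂ] ℂ :=
  (ContinuousLinearMap.mul ℂ ℂ).lpPairing volume 2 2

theorem linePair_toLp (a : LineL2) {q : ℝ → ℂ} (hq : MemLp q 2) :
    linePair a hq.toLp = ∫ y, a y * q y := by
  rw [linePair, ContinuousLinearMap.lpPairing_eq_integral]
  refine integral_congr_ae (hq.coeFn_toLp.mono fun y hy => ?_)
  simp only [hy, ContinuousLinearMap.mul_apply']

theorem Icc_subset_Ici_zero (T : ℝ) : Icc 0 T ⊆ Ici (0 : ℝ) := fun _ h => h.1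

theorem intervalIntegrable_of_continuousOn_Ici {E : Type*} [NormedAddCommGroup E]
    {g : ℝ → E} (hg : ContinuousOn g (Ici 0)) {s t : ℝ} (hs : 0 ≤ s) (ht : 0 ≤ t) :
    IntervalIntegrable g volume s t :=
  (hg.mono fun _ h => (le_min hs ht).trans h.1).intervalIntegrable

theorem IntervalIntegrable.clm_comp {E G : Type*} [NormedAddCommGroup E] [NormedSpace ℝ E]
    [NormedAddCommGroup G] [NormedSpace ℝ G] (L : E →L[ℝ] G) {g : ℝ → E} {s t : ℝ}
    (hg : IntervalIntegrable g volume s t) :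
    IntervalIntegrable (fun r => L (g r)) volume s t :=
  ⟨L.integrable_comp hg.1, L.integrable_comp hg.2⟩

theorem continuousOn_integral_mul {a : ℝ → LineL2} {s : Set ℝ} (ha : ContinuousOn a s)
    {q : ℝ → ℂ} (hq : MemLp q 2) : ContinuousOn (fun r => ∫ y, a r y * q y) s := by
  simp_rw [← linePair_toLp _ hq]
  exact (linePair.flip hq.toLp).continuous.comp_continuousOn ha

theorem intervalIntegrable_integral_mul {a : ℝ → LineL2} {s t : ℝ}
    (ha : IntervalIntegrable a volume s t) {q : ℝ → ℂ} (hq : MemLp q 2) :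
    IntervalIntegrable (fun r => ∫ y, a r y * q y) volume s t := by
  simp_rw [← linePair_toLp _ hq]
  exact IntervalIntegrable.clm_comp ((linePair.flip hq.toLp).restrictScalars ℝ) ha

variable {ν : ℝ} {F u : ℝ → L2}

theorem IsWeakSolution.continuousOn_mode (h : IsWeakSolution ν F u) (k : ℤ) :
    ContinuousOn (fun s => mode (u s) k) (Ici 0) :=
  (modeL k).continuous.comp_continuousOn h.continuousOn

theorem IsWeakSolution.integrable_mode (h : IsWeakSolution ν F u) (k : ℤ) {T : ℝ} (hT : 0 ≤ T) :
    IntervalIntegrable (fun s => mode (F s) k) volume 0 T :=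
  IntervalIntegrable.clm_comp (modeL k) (h.integrable T hT)

/-- The operator dual to the evolution, acting on the `k`-th mode. -/
def dualOp (ν : ℝ) (k : ℤ) (ρ : ℝ → ℂ) (y : ℝ) : ℂ :=
  -(k * Complex.I) * (y * ρ y) + ν * (deriv (deriv ρ) y - k ^ 2 * ρ y)

theorem contDiff_dualOp (ν : ℝ) (k : ℤ) {ρ : ℝ → ℂ} (hρ : ContDiff ℝ ∞ ρ) :
    ContDiff ℝ ∞ (dualOp ν k ρ) := by
  have h2 : ContDiff ℝ ∞ (deriv (deriv ρ)) :=
    (contDiff_infty_iff_deriv.1 (contDiff_infty_iff_deriv.1 hρ).2).2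
  exact (contDiff_const.mul (Complex.ofRealCLM.contDiff.mul hρ)).add
    (contDiff_const.mul (h2.sub (contDiff_const.mul hρ)))

theorem hasCompactSupport_dualOp (ν : ℝ) (k : ℤ) {ρ : ℝ → ℂ} (hc : HasCompactSupport ρ) :
    HasCompactSupport (dualOp ν k ρ) :=
  (hc.mul_left.mul_left).add ((hc.deriv.deriv.sub hc.mul_left).mul_left)

theorem dualOp_I_mul (ν : ℝ) (k : ℤ) (ρ : ℝ → ℂ) (y : ℝ) :
    dualOp ν k (fun y => Complex.I * ρ y) y = Complex.I * dualOp ν k ρ y := by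
  have d1 : deriv (fun y => Complex.I * ρ y) = fun y => Complex.I * deriv ρ y := by
    funext y; exact deriv_const_mul_field _
  have d2 : deriv (fun y => Complex.I * deriv ρ y) = fun y => Complex.I * deriv (deriv ρ) y := by
    funext y; exact deriv_const_mul_field _
  rw [dualOp, d1, d2, dualOp]
  ring

/-- The real wave with profile `ρ` isolates the mode but yields only a real part; since the defect
`D` is complex linear in `ρ`, testing with `iρ` gives the rest. -/
theorem IsWeakSolution.mode_weak (h : IsWeakSolution ν F u) (k : ℤ) {t : ℝ} (ht : 0 ≤ t)
    {ρ : ℝ → ℂ} (hρ : ContDiff ℝ ∞ ρ) (hc : HasCompactSupport ρ) :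
    (∫ y, mode (u t) k y * ρ y) - ∫ y, mode (u 0) k y * ρ y =
      ∫ s in (0 : ℝ)..t, ((∫ y, mode (u s) k y * dualOp ν k ρ y) + ∫ y, mode (F s) k y * ρ y) := by
  let D : (ℝ → ℂ) → ℂ := fun ρ => (∫ y, mode (u t) k y * ρ y) - (∫ y, mode (u 0) k y * ρ y) -
    ∫ s in (0 : ℝ)..t, ((∫ y, mode (u s) k y * dualOp ν k ρ y) + ∫ y, mode (F s) k y * ρ y)
  have hre : ∀ ρ : ℝ → ℂ, ContDiff ℝ ∞ ρ → HasCompactSupport ρ → (D ρ).re = 0 := by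
    intro ρ hρ hc
    have m := memLp_of_smooth hρ hc
    have m' := memLp_of_smooth (contDiff_dualOp ν k hρ) (hasCompactSupport_dualOp ν k hc)
    have h1 := h.weak t ht _ (isTest_wave k hρ hc)
    have e : ∀ p : Channel, p.2 * dx (wave k ρ) p + ν * lap (wave k ρ) p =
        wave k (dualOp ν k ρ) p := fun p => by
      rw [dx_wave, lap_wave k hρ]
      simp only [wave, dualOp, ← Complex.re_ofReal_mul, ← Complex.add_re]
      congr 1
      ring
    simp only [e, integral_mul_wave _ k m, integral_mul_wave _ k m'] at h1
    have i1 : IntervalIntegrable (fun s => ∫ y, mode (u s) k y * dualOp ν k ρ y) volume 0 t :=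
      intervalIntegrable_of_continuousOn_Ici
        (continuousOn_integral_mul (h.continuousOn_mode k) m') le_rfl ht
    have i2 : IntervalIntegrable (fun s => ∫ y, mode (F s) k y * ρ y) volume 0 t :=
      intervalIntegrable_integral_mul (h.integrable_mode k ht) m
    have e2 : ∫ s in (0 : ℝ)..t, ((2 * π * ∫ y, mode (u s) k y * dualOp ν k ρ y).re +
        (2 * π * ∫ y, mode (F s) k y * ρ y).re) = (2 * π * ∫ s in (0 : ℝ)..t,
          ((∫ y, mode (u s) k y * dualOp ν k ρ y) + ∫ y, mode (F s) k y * ρ y)).re := by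
      rw [← intervalIntegral.integral_const_mul]
      refine Eq.trans ?_
        (Complex.reCLM.intervalIntegral_comp_comm ((i1.add i2).const_mul (2 * π : ℂ)))
      refine intervalIntegral.integral_congr fun s _ => ?_
      simp only [Complex.reCLM_apply, mul_add, Complex.add_re]
    rw [e2] at h1
    have h2 : ((2 * π : ℝ) : ℂ) * D ρ = 2 * π * (∫ y, mode (u t) k y * ρ y) -
        2 * π * (∫ y, mode (u 0) k y * ρ y) - 2 * π * ∫ s in (0 : ℝ)..t,
          ((∫ y, mode (u s) k y * dualOp ν k ρ y) + ∫ y, mode (F s) k y * ρ y) := by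
      push_cast; simp only [D]; ring
    have h3 : (((2 * π : ℝ) : ℂ) * D ρ).re = 0 := by
      rw [h2, Complex.sub_re, Complex.sub_re, h1, sub_self]
    rw [Complex.re_ofReal_mul] at h3
    exact (mul_eq_zero.1 h3).resolve_left (by positivity)
  have hI : D (fun y => Complex.I * ρ y) = Complex.I * D ρ := by
    simp only [D, dualOp_I_mul, mul_left_comm _ Complex.I, integral_const_mul, ← mul_add,
      intervalIntegral.integral_const_mul, ← mul_sub]
  have h1 := hre ρ hρ hc
  have h2 := hre _ (contDiff_const.mul hρ) (hc.mul_left (f := fun _ => Complex.I))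
  rw [hI, Complex.I_mul_re, neg_eq_zero] at h2
  exact sub_eq_zero.1 (Complex.ext h1 h2)

/-! ### The moving frame -/

/-- The oscillation `y ↦ e^{ikty}`. -/
def osc (k : ℤ) (t y : ℝ) : ℂ := Complex.exp (((k * t * y : ℝ) : ℂ) * Complex.I)

theorem norm_osc (k : ℤ) (t y : ℝ) : ‖osc k t y‖ = 1 := Complex.norm_exp_ofReal_mul_I _

theorem contDiff_osc (k : ℤ) (t : ℝ) : ContDiff ℝ ∞ (osc k t) := by
  have h1 : ContDiff ℝ ∞ (fun y : ℝ => ((k * t * y : ℝ) : ℂ)) :=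
    Complex.ofRealCLM.contDiff.comp (contDiff_const.mul contDiff_id)
  exact (h1.mul contDiff_const).cexp

theorem hasDerivAt_osc_time (k : ℤ) (t y : ℝ) :
    HasDerivAt (fun t => osc k t y) (osc k t y * ((k * y : ℝ) * Complex.I)) t := by
  have h1 : HasDerivAt (fun t : ℝ => k * t * y) (k * 1 * y) t :=
    ((hasDerivAt_id t).const_mul (k : ℝ)).mul_const y
  have := (h1.ofReal_comp.mul_const Complex.I).cexp
  rw [mul_one] at this
  exact this

theorem hasDerivAt_osc (k : ℤ) (t y : ℝ) :
    HasDerivAt (osc k t) (k * t * Complex.I * osc k t y) y := by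
  have h1 : HasDerivAt (fun y : ℝ => k * t * y) (k * t) y := by
    simpa using (hasDerivAt_id y).const_mul (k * t)
  have := (h1.ofReal_comp.mul_const Complex.I).cexp
  push_cast at this
  rw [mul_comm]
  have e : osc k t = fun y : ℝ => Complex.exp (k * t * y * Complex.I) := by
    funext y; simp [osc]
  rw [e]
  simpa using this

theorem deriv_osc (k : ℤ) (t : ℝ) : deriv (osc k t) = fun y => k * t * Complex.I * osc k t y :=
  funext fun y => (hasDerivAt_osc k t y).deriv

theorem norm_osc_sub_le (k : ℤ) (t t' y : ℝ) : ‖osc k t y - osc k t' y‖ ≤ |t - t'| * |k * y| := by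
  have h1 : osc k t y - osc k t' y =
      osc k t' y * (Complex.exp (Complex.I * ((k * (t - t') * y : ℝ) : ℂ)) - 1) := by
    rw [mul_sub, mul_one, osc, osc, ← Complex.exp_add]
    congr 2
    push_cast
    ring
  rw [h1, norm_mul, norm_osc, one_mul]
  refine (Real.norm_exp_I_mul_ofReal_sub_one_le).trans (le_of_eq ?_)
  rw [Real.norm_eq_abs, ← abs_mul]
  congr 1
  ring

/-- Conjugation by `e^{ikty}` turns `∂_y` into `∂_y + ikt`. The term in `y` is untouched here; it is
cancelled later by the time derivative of the oscillation. -/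
theorem dualOp_osc_mul (ν : ℝ) (k : ℤ) (t : ℝ) {ρ : ℝ → ℂ} (hρ : ContDiff ℝ ∞ ρ) (y : ℝ) :
    dualOp ν k (fun y => osc k t y * ρ y) y = osc k t y * (dualOp ν k ρ y +
      ν * (2 * k * t * Complex.I) * deriv ρ y - ν * k ^ 2 * t ^ 2 * ρ y) := by
  rw [dualOp, deriv_deriv_mul (contDiff_osc k t) hρ, deriv_osc, deriv_const_mul_field, deriv_osc,
    dualOp]
  ring_nf
  simp only [Complex.I_sq]
  ring

/-- The multiplication of `q` by `e^{ikty}`, as a curve in `L²(ℝ)`. -/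
def oscLp (k : ℤ) {q : ℝ → ℂ} (hq : MemLp q 2) (t : ℝ) : LineL2 :=
  (hq.of_le ((contDiff_osc k t).continuous.aestronglyMeasurable.mul hq.1)
    (Eventually.of_forall fun y => by rw [Pi.mul_apply, norm_mul, norm_osc, one_mul]) :
      MemLp (osc k t * q) 2).toLp

theorem oscLp_ae (k : ℤ) {q : ℝ → ℂ} (hq : MemLp q 2) (t : ℝ) :
    oscLp k hq t =ᵐ[volume] fun y => osc k t y * q y := MemLp.coeFn_toLp _

theorem linePair_oscLp (a : LineL2) (k : ℤ) {q : ℝ → ℂ} (hq : MemLp q 2) (t : ℝ) :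
    linePair a (oscLp k hq t) = ∫ y, a y * (osc k t y * q y) := by
  rw [linePair, ContinuousLinearMap.lpPairing_eq_integral]
  refine integral_congr_ae ((oscLp_ae k hq t).mono fun y hy => ?_)
  simp only [hy, ContinuousLinearMap.mul_apply']

/-- The phases are Lipschitz in time with constant `|ky|`, so the weighted function `k y q` provides
a Lipschitz constant in `L²`. -/
theorem continuous_oscLp (k : ℤ) {q : ℝ → ℂ} (hq : MemLp q 2)
    (hq' : MemLp (fun y => ((k * y : ℝ) : ℂ) * q y) 2) : Continuous (oscLp k hq) := by
  refine (LipschitzWith.of_dist_le_mul (K := ‖hq'.toLp‖₊) fun t t' => ?_).continuous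
  rw [dist_eq_norm, Real.dist_eq, coe_nnnorm, mul_comm]
  refine Lp.norm_le_mul_norm_of_ae_le_mul ?_
  filter_upwards [oscLp_ae k hq t, oscLp_ae k hq t', hq'.coeFn_toLp,
    Lp.coeFn_sub (oscLp k hq t) (oscLp k hq t')] with y h1 h2 h3 h4
  rw [h4, Pi.sub_apply, h1, h2, h3, ← sub_mul, norm_mul, norm_mul, Complex.norm_real,
    Real.norm_eq_abs, ← mul_assoc]
  gcongr
  exact norm_osc_sub_le k t t' y

/-- Differentiation under the integral; phases have modulus one, so the integrable function `|a · k
y q|` dominates for all times. -/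
theorem hasDerivAt_linePair_oscLp (a : LineL2) (k : ℤ) {q : ℝ → ℂ} (hq : MemLp q 2)
    (hq' : MemLp (fun y => ((k * y : ℝ) * Complex.I) * q y) 2) (t : ℝ) :
    HasDerivAt (fun t => linePair a (oscLp k hq t)) (linePair a (oscLp k hq' t)) t := by
  simp_rw [linePair_oscLp]
  have hm : ∀ t, AEStronglyMeasurable (fun y => a y * (osc k t y * q y)) volume := fun t =>
    (Lp.aestronglyMeasurable a).mul
      ((contDiff_osc k t).continuous.aestronglyMeasurable.mul hq.1)
  refine (hasDerivAt_integral_of_dominated_loc_of_deriv_le (s := univ)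
    (bound := fun y => ‖a y * ((k * y : ℝ) * Complex.I * q y)‖)
    (F' := fun t y => a y * (osc k t y * ((k * y : ℝ) * Complex.I * q y)))
    univ_mem (Eventually.of_forall hm) ?_ ?_ (Eventually.of_forall fun y s _ => ?_)
    (integrable_lineL2_mul a hq').norm (Eventually.of_forall fun y s _ => ?_)).2
  · refine (integrable_lineL2_mul a hq).mono (hm t) (Eventually.of_forall fun y => ?_)
    rw [norm_mul, norm_mul, norm_osc, one_mul, norm_mul]
  · exact (Lp.aestronglyMeasurable a).mul
      ((contDiff_osc k t).continuous.aestronglyMeasurable.mul hq'.1)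
  · rw [norm_mul, norm_mul, norm_osc, one_mul, norm_mul (a y)]
  · have := ((hasDerivAt_osc_time k s y).mul_const (q y)).const_mul (a y)
    convert! this using 1
    ring

end

/-! ### The weak formulation in the moving frame -/

section

variable {ν : ℝ} {F u : ℝ → L2}

theorem linePair_oscLp_mode (f : L2) (k : ℤ) {q : ℝ → ℂ} (hq : MemLp q 2) (t : ℝ) :
    linePair (mode f k) (oscLp k hq t) = ∫ y, mode (shearL (-t) f) k y * q y := by
  rw [linePair_oscLp]
  refine integral_congr_ae ?_
  filter_upwards [mode_shearL (-t) f k] with y hy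
  rw [hy, osc]
  push_cast
  ring_nf

theorem continuous_shearL_uncurry {τ : ℝ → ℝ} (hτ : Continuous τ) :
    Continuous (fun q : ℝ × L2 => shearL (τ q.1) q.2) := by
  let S : C(ℝ, C(Channel, Channel)) :=
    ContinuousMap.curry ⟨fun q : ℝ × Channel => shearMap q.1 q.2, continuous_shearMap_uncurry⟩
  exact Continuous.compMeasurePreservingLp (g := fun q : ℝ × L2 => S (τ q.1))
    (f := fun q : ℝ × L2 => q.2) continuous_snd
    (S.continuous.comp (hτ.comp continuous_fst)) (fun q => measurePreserving_shearMap _)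
    (by norm_num)

/-- The family `S` is not continuous in operator norm; joint continuity gives measurability and the
isometry property gives the norm. -/
theorem integrable_isometry_comp {E : Type*} [NormedAddCommGroup E] {μ : Measure ℝ}
    {S : ℝ → E → E} (hS : Continuous (fun q : ℝ × E => S q.1 q.2)) (hn : ∀ r f, ‖S r f‖ = ‖f‖)
    {G : ℝ → E} (hG : Integrable G μ) : Integrable (fun r => S r (G r)) μ := by
  have hm : AEStronglyMeasurable (fun r => ((r, G r) : ℝ × E)) μ :=
    aestronglyMeasurable_id.prodMk hG.1
  exact hG.mono (hS.comp_aestronglyMeasurable hm) (Eventually.of_forall fun r => (hn _ _).le)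

theorem intervalIntegrable_shearL {T : ℝ} (h : IntervalIntegrable F volume 0 T) :
    IntervalIntegrable (fun r => shearL (-r) (F r)) volume 0 T :=
  have hS := continuous_shearL_uncurry (τ := fun r => -r) continuous_neg
  have hn : ∀ (r : ℝ) (f : L2), ‖shearL (-r) f‖ = ‖f‖ := fun r f => (shearL (-r)).norm_map f
  ⟨integrable_isometry_comp (S := fun r f => shearL (-r) f) hS hn h.1,
    integrable_isometry_comp (S := fun r f => shearL (-r) f) hS hn h.2⟩

/-- The `k`-th mode in the moving frame. -/
def movingMode (u : ℝ → L2) (k : ℤ) (t : ℝ) : LineL2 := mode (shearL (-t) (u t)) k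

theorem IsWeakSolution.continuousOn_movingMode (h : IsWeakSolution ν F u) (k : ℤ) :
    ContinuousOn (movingMode u k) (Ici 0) :=
  (modeL k).continuous.comp_continuousOn (continuousOn_shearL h.continuousOn continuous_neg)

theorem IsWeakSolution.intervalIntegrable_movingMode (h : IsWeakSolution ν F u) (k : ℤ) {T : ℝ}
    (hT : 0 ≤ T) : IntervalIntegrable (movingMode F k) volume 0 T :=
  IntervalIntegrable.clm_comp (modeL k) (intervalIntegrable_shearL (h.integrable T hT))

theorem memLp_mul_of_smooth {c ρ : ℝ → ℂ} (hcs : ContDiff ℝ ∞ c) (hρ : ContDiff ℝ ∞ ρ)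
    (hc : HasCompactSupport ρ) : MemLp (fun y => c y * ρ y) 2 :=
  memLp_of_smooth (hcs.mul hρ) hc.mul_left

theorem exists_norm_le_of_continuousOn {E : Type*} [NormedAddCommGroup E] {g : ℝ → E} {T : ℝ}
    (hg : ContinuousOn g (Icc 0 T)) : ∃ C : ℝ, 0 ≤ C ∧ ∀ t ∈ Icc 0 T, ‖g t‖ ≤ C := by
  obtain ⟨C, hC⟩ := isCompact_Icc.exists_bound_of_continuousOn hg
  exact ⟨max C 0, le_max_right _ _, fun t ht => (hC t ht).trans (le_max_left _ _)⟩

theorem exists_delta_of_continuousOn {E : Type*} [NormedAddCommGroup E] {g : ℝ → E} {T : ℝ}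
    (hg : ContinuousOn g (Icc 0 T)) {ε : ℝ} (hε : 0 < ε) :
    ∃ δ > 0, ∀ t ∈ Icc 0 T, ∀ t' ∈ Icc 0 T, |t - t'| < δ → ‖g t - g t'‖ < ε := by
  obtain ⟨δ, hδ, H⟩ := Metric.uniformContinuousOn_iff.1
    (isCompact_Icc.uniformContinuousOn_of_continuous hg) ε hε
  exact ⟨δ, hδ, fun t ht t' ht' h => by
    rw [← dist_eq_norm]; exact H t ht t' ht' (by rwa [Real.dist_eq])⟩

theorem norm_linePair_le (a c : LineL2) : ‖linePair a c‖ ≤ ‖linePair‖ * (‖a‖ * ‖c‖) := by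
  rw [← mul_assoc]; exact linePair.le_opNorm₂ a c

/-- The integral of a bilinear pairing of an integrable curve with a continuous one. -/
theorem intervalIntegrable_linePair {b c : ℝ → LineL2} {T : ℝ} (hT : 0 ≤ T)
    (hb : IntervalIntegrable b volume 0 T) (hc : ContinuousOn c (Icc 0 T)) :
    IntervalIntegrable (fun r => linePair (b r) (c r)) volume 0 T := by
  obtain ⟨C, hC0, hC⟩ := exists_norm_le_of_continuousOn hc
  rw [intervalIntegrable_iff_integrableOn_Ioc_of_le hT] at *
  refine Integrable.mono' (hb.norm.const_mul (‖linePair‖ * C)) ?_ ?_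
  · have hcm : AEStronglyMeasurable c (volume.restrict (Ioc 0 T)) :=
      (hc.mono Ioc_subset_Icc_self).aestronglyMeasurable measurableSet_Ioc
    exact linePair.aestronglyMeasurable_comp₂ hb.1 hcm
  · filter_upwards [ae_restrict_mem measurableSet_Ioc] with r hr
    refine (norm_linePair_le _ _).trans ?_
    have := hC r (Ioc_subset_Icc_self hr)
    calc ‖linePair‖ * (‖b r‖ * ‖c r‖) ≤ ‖linePair‖ * (‖b r‖ * C) := by gcongr
      _ = _ := by ring

/-- The weak formulation in the moving frame. -/
theorem IsWeakSolution.moving_weak (h : IsWeakSolution ν F u) (k : ℤ) {T : ℝ} (hT : 0 ≤ T)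
    {ρ : ℝ → ℂ} (hρ : ContDiff ℝ ∞ ρ) (hc : HasCompactSupport ρ) :
    (∫ y, movingMode u k T y * ρ y) - ∫ y, movingMode u k 0 y * ρ y =
      ∫ r in (0 : ℝ)..T, (ν * (∫ y, movingMode u k r y * deriv (deriv ρ) y)
        + 2 * Complex.I * k * ν * (r * ∫ y, movingMode u k r y * deriv ρ y)
        - ν * k ^ 2 * ((∫ y, movingMode u k r y * ρ y) + r ^ 2 * ∫ y, movingMode u k r y * ρ y)
        + ∫ y, movingMode F k r y * ρ y) := by
  have sid : ContDiff ℝ ∞ (fun y : ℝ => ((k * y : ℝ) : ℂ)) :=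
    Complex.ofRealCLM.contDiff.comp (contDiff_const.mul contDiff_id)
  have sidI : ContDiff ℝ ∞ (fun y : ℝ => ((k * y : ℝ) : ℂ) * Complex.I) := sid.mul contDiff_const
  have sρ' : ContDiff ℝ ∞ (deriv ρ) := (contDiff_infty_iff_deriv.1 hρ).2
  have sd := contDiff_dualOp ν k hρ
  have cd := hasCompactSupport_dualOp ν k hc
  have m0 := memLp_of_smooth hρ hc
  have m1 := memLp_of_smooth sρ' hc.deriv
  have m2 := memLp_of_smooth (contDiff_infty_iff_deriv.1 sρ').2 hc.deriv.deriv
  have md := memLp_of_smooth sd cd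
  have mg := memLp_mul_of_smooth sidI hρ hc
  have c0 := continuous_oscLp k m0 (memLp_mul_of_smooth sid hρ hc)
  have c1 := continuous_oscLp k m1 (memLp_mul_of_smooth sid sρ' hc.deriv)
  have cd' := continuous_oscLp k md (memLp_mul_of_smooth sid sd cd)
  have cg := continuous_oscLp k mg (memLp_mul_of_smooth sid (sidI.mul hρ) hc.mul_left)
  let a : ℝ → LineL2 := fun s => mode (u s) k
  let b : ℝ → LineL2 := fun s => mode (F s) k
  let Q : ℝ → LineL2 := fun t => oscLp k md t + (ν * (2 * k * t * Complex.I) : ℂ) • oscLp k m1 t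
    - (ν * k ^ 2 * t ^ 2 : ℂ) • oscLp k m0 t
  have cQ : Continuous Q := by
    have f1 : Continuous (fun t : ℝ => (ν * (2 * k * t * Complex.I) : ℂ)) := by fun_prop
    have f2 : Continuous (fun t : ℝ => (ν * k ^ 2 * t ^ 2 : ℂ)) := by fun_prop
    exact (cd'.add (f1.smul c1)).sub (f2.smul c0)
  have ha : ContinuousOn a (Icc 0 T) := (h.continuousOn_mode k).mono (Icc_subset_Ici_zero T)
  have hb : IntervalIntegrable b volume 0 T := h.integrable_mode k hT
  have hai : IntervalIntegrable a volume 0 T :=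
    intervalIntegrable_of_continuousOn_Ici (h.continuousOn_mode k) le_rfl hT
  obtain ⟨Ca, hCa0, hCa⟩ := exists_norm_le_of_continuousOn ha
  obtain ⟨Cg, hCg0, hCg⟩ := exists_norm_le_of_continuousOn (T := T) cg.continuousOn
  -- Separate the two time dependences: `s` in the solution, `t` in the phase of the test function.
  -- The weak formulation differentiates in `s`, calculus in `t`, and the moving frame is the
  -- diagonal.
  have key := diagonal_sub_eq_integral (Φ := fun s t => linePair (a s) (oscLp k m0 t))
    (G₁ := fun r t => linePair (a r) (Q t) + linePair (b r) (oscLp k m0 t))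
    (G₂ := fun s r => linePair (a s) (oscLp k mg r))
    (M := fun r => ‖linePair‖ * (Ca + ‖b r‖ + Cg)) hT
    (((intervalIntegrable_const).add hb.norm |>.add intervalIntegrable_const).const_mul _)
    (fun t _ => (intervalIntegrable_linePair hT hai continuousOn_const).add
      (intervalIntegrable_linePair hT hb continuousOn_const))
    (fun s _ => intervalIntegrable_linePair hT intervalIntegrable_const cg.continuousOn)
    (((intervalIntegrable_linePair hT hai cQ.continuousOn).add
      (intervalIntegrable_linePair hT hb c0.continuousOn)).add
      (intervalIntegrable_linePair hT hai cg.continuousOn)) ?_ ?_ ?_ ?_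
  · simp only [a, linePair_oscLp_mode] at key
    change _ = _ at key
    refine key.trans (intervalIntegral.integral_congr fun r _ => ?_)
    -- The derivative of the phase cancels the transport part of the dual operator, leaving `ν (ρ''
    -- - k²ρ)`.
    have e1 : linePair (mode (u r) k) (oscLp k md r) + linePair (mode (u r) k) (oscLp k mg r) =
        ν * (∫ y, movingMode u k r y * deriv (deriv ρ) y) -
          ν * k ^ 2 * ∫ y, movingMode u k r y * ρ y := by
      rw [linePair_oscLp_mode, linePair_oscLp_mode, ← integral_const_mul, ← integral_const_mul,
        ← integral_add (integrable_lineL2_mul _ md) (integrable_lineL2_mul _ mg),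
        ← integral_sub ((integrable_lineL2_mul _ m2).const_mul _)
          ((integrable_lineL2_mul _ m0).const_mul _)]
      refine integral_congr_ae (Eventually.of_forall fun y => ?_)
      simp only [dualOp, movingMode]
      push_cast
      ring
    simp only [Q, map_add, map_sub, map_smul, smul_eq_mul, b]
    simp only [linePair_oscLp_mode] at e1 ⊢
    simp only [movingMode] at e1 ⊢
    linear_combination e1
  · intro s hs s' hs' t ht hss
    -- With `t` frozen, `e^{ikty} ρ` is itself an admissible test function, so the weak formulation
    -- of the mode applies to it.
    have e : ∀ r : ℝ, linePair (a r) (Q t) = ∫ y, a r y * dualOp ν k (fun y => osc k t y * ρ y) y := by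
      intro r
      simp only [Q, map_add, map_sub, map_smul, smul_eq_mul, linePair_oscLp]
      rw [← integral_const_mul, ← integral_const_mul]
      have j : ∀ {q : ℝ → ℂ}, MemLp q 2 → Integrable (fun y => a r y * (osc k t y * q y)) :=
        fun {q} hq => integrable_lineL2_mul (a r) (hq.of_le
          ((contDiff_osc k t).continuous.aestronglyMeasurable.mul hq.1)
          (Eventually.of_forall fun y => by rw [norm_mul, norm_osc, one_mul]))
      have j1 : Integrable (fun y => a r y * (osc k t y * dualOp ν k ρ y)
          + ν * (2 * k * t * Complex.I) * (a r y * (osc k t y * deriv ρ y))) :=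
        (j md).add ((j m1).const_mul _)
      rw [← integral_add (j md) ((j m1).const_mul _), ← integral_sub j1 ((j m0).const_mul _)]
      refine integral_congr_ae (Eventually.of_forall fun y => ?_)
      simp only [dualOp_osc_mul ν k t hρ]
      ring
    have hsm : ContDiff ℝ ∞ (fun y => osc k t y * ρ y) := (contDiff_osc k t).mul hρ
    have hcm : HasCompactSupport (fun y => osc k t y * ρ y) := hc.mul_left
    have w1 := h.mode_weak k hs.1 hsm hcm
    have w2 := h.mode_weak k hs'.1 hsm hcm
    have ii : ∀ {x : ℝ}, x ∈ Icc 0 T → IntervalIntegrable (fun r =>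
        (∫ y, mode (u r) k y * dualOp ν k (fun y => osc k t y * ρ y) y)
          + ∫ y, mode (F r) k y * (osc k t y * ρ y)) volume 0 x := fun {x} hx =>
      (intervalIntegrable_of_continuousOn_Ici (continuousOn_integral_mul (h.continuousOn_mode k)
        (memLp_of_smooth (contDiff_dualOp ν k hsm) (hasCompactSupport_dualOp ν k hcm)))
        le_rfl hx.1).add (intervalIntegrable_integral_mul (h.integrable_mode k hx.1)
          (memLp_of_smooth hsm hcm))
    simp only [e, linePair_oscLp]
    rw [← intervalIntegral.integral_interval_sub_left (ii hs') (ii hs), ← w1, ← w2]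
    ring
  · intro s _ t ht t' ht' htt
    refine (intervalIntegral.integral_eq_sub_of_hasDerivAt
      (fun r _ => hasDerivAt_linePair_oscLp (a s) k m0 mg r) ?_).symm
    exact ((linePair (a s)).continuous.comp cg).intervalIntegrable _ _
  · intro ε hε
    obtain ⟨δ₁, hδ₁, H₁⟩ := exists_delta_of_continuousOn (T := T) cQ.continuousOn hε
    obtain ⟨δ₂, hδ₂, H₂⟩ := exists_delta_of_continuousOn (T := T) c0.continuousOn hε
    refine ⟨min δ₁ δ₂, lt_min hδ₁ hδ₂, fun r hr t ht t' ht' htt => ?_⟩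
    have e1 := H₁ t ht t' ht' (htt.trans_le (min_le_left _ _))
    have e2 := H₂ t ht t' ht' (htt.trans_le (min_le_right _ _))
    calc _ = ‖linePair (a r) (Q t - Q t') + linePair (b r) (oscLp k m0 t - oscLp k m0 t')‖ := by
          congr 1
          rw [(linePair (a r)).map_sub (Q t) (Q t'),
            (linePair (b r)).map_sub (oscLp k m0 t) (oscLp k m0 t')]
          ring
      _ ≤ ‖linePair‖ * (‖a r‖ * ‖Q t - Q t'‖)
          + ‖linePair‖ * (‖b r‖ * ‖oscLp k m0 t - oscLp k m0 t'‖) :=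
          (norm_add_le _ _).trans (add_le_add (norm_linePair_le _ _) (norm_linePair_le _ _))
      _ ≤ ‖linePair‖ * (Ca * ε) + ‖linePair‖ * (‖b r‖ * ε) := by
          gcongr
          exact hCa r hr
      _ ≤ ε * (‖linePair‖ * (Ca + ‖b r‖ + Cg)) := by
          have : 0 ≤ ‖linePair‖ * Cg * ε := by positivity
          linarith
  · intro ε hε
    obtain ⟨δ, hδ, H⟩ := exists_delta_of_continuousOn ha hε
    refine ⟨δ, hδ, fun r hr s hs s' hs' hss => ?_⟩
    have e1 := H s hs s' hs' hss
    calc _ = ‖linePair (a s - a s') (oscLp k mg r)‖ := by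
          congr 1; rw [map_sub]; rfl
      _ ≤ ‖linePair‖ * (‖a s - a s'‖ * ‖oscLp k mg r‖) := norm_linePair_le _ _
      _ ≤ ‖linePair‖ * (ε * Cg) := by
          gcongr
          exact hCg r hr
      _ ≤ ε * (‖linePair‖ * (Ca + ‖b r‖ + Cg)) := by
          have : 0 ≤ ‖linePair‖ * (Ca + ‖b r‖) * ε := by positivity
          linarith

end

section

/-! ### Multipliers supported in a band of frequencies -/

/-- Real multipliers on the band `|ξ| ≤ N`. -/
abbrev Band (N : ℝ) : Type := C(Icc (-N) N, ℝ)

/-- Extension by zero. -/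
def bandExt {N : ℝ} (φ : Band N) (ξ : ℝ) : ℝ := if h : ξ ∈ Icc (-N) N then φ ⟨ξ, h⟩ else 0

theorem bandExt_of_mem {N : ℝ} (φ : Band N) {ξ : ℝ} (h : ξ ∈ Icc (-N) N) :
    bandExt φ ξ = φ ⟨ξ, h⟩ := dif_pos h

theorem bandExt_of_notMem {N : ℝ} (φ : Band N) {ξ : ℝ} (h : ξ ∉ Icc (-N) N) :
    bandExt φ ξ = 0 := dif_neg h

theorem abs_bandExt_le {N : ℝ} (φ : Band N) (ξ : ℝ) : |bandExt φ ξ| ≤ ‖φ‖ := by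
  by_cases h : ξ ∈ Icc (-N) N
  · rw [bandExt_of_mem φ h]; exact φ.norm_coe_le_norm _
  · rw [bandExt_of_notMem φ h, abs_zero]; exact norm_nonneg _

theorem measurable_bandExt {N : ℝ} (φ : Band N) : Measurable (bandExt φ) :=
  Measurable.dite φ.continuous.measurable measurable_const measurableSet_Icc

theorem memLp_bandExt {N : ℝ} (φ : Band N) : MemLp (bandExt φ) ⊤ (volume : Measure ℝ) :=
  memLp_top_of_bound (measurable_bandExt φ).aestronglyMeasurable ‖φ‖
    (Eventually.of_forall (abs_bandExt_le φ))

theorem bandExt_add {N : ℝ} (φ χ : Band N) : bandExt (φ + χ) = bandExt φ + bandExt χ := by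
  funext ξ; by_cases h : ξ ∈ Icc (-N) N <;> simp [bandExt, h]

theorem bandExt_smul {N : ℝ} (c : ℝ) (φ : Band N) : bandExt (c • φ) = c • bandExt φ := by
  funext ξ; by_cases h : ξ ∈ Icc (-N) N <;> simp [bandExt, h]

theorem bandExt_mul {N : ℝ} (φ χ : Band N) : bandExt (φ * χ) = bandExt φ * bandExt χ := by
  funext ξ; by_cases h : ξ ∈ Icc (-N) N <;> simp [bandExt, h]

/-- `bandExt` as a map into `L^∞`. -/
def bandL (N : ℝ) : Band N →L[ℝ] Lp ℝ ⊤ (volume : Measure ℝ) :=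
  LinearMap.mkContinuous
    { toFun := fun φ => (memLp_bandExt φ).toLp
      map_add' := fun φ χ => by
        rw [← MemLp.toLp_add]; exact MemLp.toLp_congr _ _ (by rw [bandExt_add])
      map_smul' := fun c φ => by
        rw [RingHom.id_apply, ← MemLp.toLp_const_smul]
        exact MemLp.toLp_congr _ _ (by rw [bandExt_smul]) } 1 fun φ => by
    rw [one_mul]
    change ‖(memLp_bandExt φ).toLp‖ ≤ ‖φ‖
    rw [Lp.norm_toLp]
    refine ENNReal.toReal_le_of_le_ofReal (norm_nonneg _) ?_
    rw [eLpNorm_exponent_top]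
    exact eLpNormEssSup_le_of_ae_bound (Eventually.of_forall (abs_bandExt_le φ))

/-- The Fourier multiplier `φ`, extended by zero off the band. -/
def bandMul (N : ℝ) : Band N →L[ℝ] LineL2 →L[ℝ] LineL2 :=
  ((ContinuousLinearMap.lsmul ℝ ℝ : ℝ →L[ℝ] ℂ →L[ℝ] ℂ).holderL volume ⊤ 2 2).comp (bandL N)

theorem bandMul_ae {N : ℝ} (φ : Band N) (a : LineL2) :
    ∀ᵐ ξ : ℝ, bandMul N φ a ξ = bandExt φ ξ * a ξ := by
  filter_upwards [ContinuousLinearMap.coeFn_holder (r := 2)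
    (ContinuousLinearMap.lsmul ℝ ℝ : ℝ →L[ℝ] ℂ →L[ℝ] ℂ) (bandL N φ) a,
    (memLp_bandExt φ).coeFn_toLp] with ξ h1 h2
  refine h1.trans ?_
  change bandL N φ ξ = _ at h2
  simp [h2]

theorem bandMul_bandMul {N : ℝ} (φ χ : Band N) (a : LineL2) :
    bandMul N φ (bandMul N χ a) = bandMul N (φ * χ) a := by
  refine Lp.ext ?_
  filter_upwards [bandMul_ae φ (bandMul N χ a), bandMul_ae χ a, bandMul_ae (φ * χ) a]
    with ξ h1 h2 h3
  rw [h1, h2, h3, bandExt_mul, Pi.mul_apply]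
  push_cast; ring

theorem inner_bandMul {N : ℝ} (φ : Band N) (a b : LineL2) :
    ⟪bandMul N φ a, b⟫_ℝ = ⟪a, bandMul N φ b⟫_ℝ := by
  rw [L2.inner_def, L2.inner_def]
  refine integral_congr_ae ?_
  filter_upwards [bandMul_ae φ a, bandMul_ae φ b] with ξ h1 h2
  rw [h1, h2, ← Complex.real_smul, ← Complex.real_smul, real_inner_smul_left,
    real_inner_smul_right]

theorem norm_bandMul_one_le (N : ℝ) (a : LineL2) : ‖bandMul N 1 a‖ ≤ ‖a‖ := by
  refine Lp.norm_le_norm_of_ae_le ?_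
  filter_upwards [bandMul_ae 1 a] with ξ h1
  rw [h1, norm_mul]
  refine mul_le_of_le_one_left (norm_nonneg _) ?_
  by_cases h : ξ ∈ Icc (-N) N <;> simp [bandExt, h]

/-- At each `ξ` the cutoff is eventually `1`, and `|a|²` dominates. This removes the restriction to
a band. -/
theorem tendsto_bandMul_one (a : LineL2) :
    Tendsto (fun N : ℕ => bandMul N 1 a) atTop (𝓝 a) := by
  have hb : ∀ᵐ ξ : ℝ, ∀ N : ℕ, (bandMul N 1 a - a : LineL2) ξ = (bandExt (1 : Band N) ξ - 1) * a ξ := by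
    refine ae_all_iff.2 fun N => ?_
    filter_upwards [bandMul_ae (1 : Band N) a, Lp.coeFn_sub (bandMul N 1 a) a] with ξ h1 h2
    rw [h2, Pi.sub_apply, h1]; ring
  have h1 : Tendsto (fun N : ℕ => ‖bandMul N 1 a - a‖ ^ 2) atTop (𝓝 0) := by
    simp_rw [← real_inner_self_eq_norm_sq, L2.inner_def, real_inner_self_eq_norm_sq]
    rw [← integral_zero ℝ ℝ]
    refine tendsto_integral_of_dominated_convergence (fun ξ => ‖a ξ‖ ^ 2)
      (fun N => ((Lp.aestronglyMeasurable _).norm.pow 2)) ((Lp.memLp a).integrable_norm_pow two_ne_zero)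
      (fun N => ?_) ?_
    · filter_upwards [hb] with ξ h
      rw [h N, norm_pow, norm_norm]
      gcongr
      rw [norm_mul]
      refine mul_le_of_le_one_left (norm_nonneg _) ?_
      by_cases hξ : ξ ∈ Icc (-(N : ℝ)) N <;> simp [bandExt, hξ]
    · filter_upwards [hb] with ξ h
      refine tendsto_const_nhds.congr' ?_
      obtain ⟨M, hM⟩ := exists_nat_ge |ξ|
      filter_upwards [eventually_ge_atTop M] with N hN
      have : ξ ∈ Icc (-(N : ℝ)) N := abs_le.1 (hM.trans (by exact_mod_cast hN))
      rw [h N, bandExt_of_mem _ this]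
      simp
  rw [tendsto_iff_norm_sub_tendsto_zero]
  have h2 := h1.sqrt
  simpa only [Real.sqrt_sq (norm_nonneg _), Real.sqrt_zero] using h2

/-- The restriction of a continuous function to the band. -/
def toBand (N : ℝ) (c : ℝ → ℝ) (hc : Continuous c) : Band N := ⟨fun ξ => c ξ, hc.comp continuous_subtype_val⟩

/-- `k² + η²`. -/
def symbZero (k : ℤ) (N : ℝ) : Band N :=
  toBand N (fun ξ => (k : ℝ) ^ 2 + (2 * π * ξ) ^ 2) (by fun_prop)

/-- `2kη`. -/
def symbOne (k : ℤ) (N : ℝ) : Band N := toBand N (fun ξ => 2 * k * (2 * π * ξ)) (by fun_prop)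

/-- The symbol `k² + (η - kt)²` of `-Δ` in the moving frame. -/
def symb (k : ℤ) (N t : ℝ) : Band N := symbZero k N - t • symbOne k N + t ^ 2 • ((k : ℝ) ^ 2 • 1)

theorem symb_apply (k : ℤ) (N t : ℝ) (ξ : Icc (-N) N) :
    symb k N t ξ = (k : ℝ) ^ 2 + (2 * π * ξ - k * t) ^ 2 := by
  simp [symb, symbZero, symbOne, toBand]
  ring

variable {ν : ℝ} {F u : ℝ → L2}

/-- The Fourier transform of the modes in the moving frame. -/
def movingHat (u : ℝ → L2) (k : ℤ) (t : ℝ) : LineL2 := 𝓕 (movingMode u k t)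

theorem IsWeakSolution.continuousOn_movingHat (h : IsWeakSolution ν F u) (k : ℤ) :
    ContinuousOn (movingHat u k) (Ici 0) :=
  fourierR.continuous.comp_continuousOn (h.continuousOn_movingMode k)

theorem IsWeakSolution.intervalIntegrable_movingHat (h : IsWeakSolution ν F u) (k : ℤ) {T : ℝ}
    (hT : 0 ≤ T) : IntervalIntegrable (movingHat F k) volume 0 T :=
  IntervalIntegrable.clm_comp fourierR.toContinuousLinearMap (h.intervalIntegrable_movingMode k hT)

theorem linePair_integral {g : ℝ → LineL2} {T : ℝ} (hg : IntervalIntegrable g volume 0 T)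
    {q : ℝ → ℂ} (hq : MemLp q 2) :
    ∫ r in (0 : ℝ)..T, (∫ y, g r y * q y) = ∫ y, (∫ r in (0 : ℝ)..T, g r) y * q y := by
  simp_rw [← linePair_toLp _ hq]
  exact ContinuousLinearMap.intervalIntegral_comp_comm
    ((linePair.flip hq.toLp).restrictScalars ℝ) hg

theorem fourier_integral {g : ℝ → LineL2} {T : ℝ} (hg : IntervalIntegrable g volume 0 T) :
    𝓕 (∫ r in (0 : ℝ)..T, g r) = ∫ r in (0 : ℝ)..T, fourierR (g r) :=
  (ContinuousLinearMap.intervalIntegral_comp_comm fourierR.toContinuousLinearMap hg).symm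

theorem integral_real_smul_mul (r : ℝ) (a : LineL2) (ρ : ℝ → ℂ) :
    ∫ y, (r • a : LineL2) y * ρ y = r * ∫ y, a y * ρ y := by
  rw [← integral_const_mul]
  refine integral_congr_ae ?_
  filter_upwards [Lp.coeFn_smul r a] with y h2
  rw [h2]
  simp only [Pi.smul_apply, Complex.real_smul]
  ring

/-- The evolution equation on the Fourier side, in integrated form. -/
theorem IsWeakSolution.fourier_identity (h : IsWeakSolution ν F u) (k : ℤ) {T : ℝ} (hT : 0 ≤ T) :
    ∀ᵐ ξ : ℝ, movingHat u k T ξ - movingHat u k 0 ξ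
      + ν * k ^ 2 * ((∫ r in (0 : ℝ)..T, movingHat u k r) ξ
        + (∫ r in (0 : ℝ)..T, r ^ 2 • movingHat u k r) ξ)
      - (∫ r in (0 : ℝ)..T, movingHat F k r) ξ
      - 4 * π * k * ν * ξ * (∫ r in (0 : ℝ)..T, r • movingHat u k r) ξ
      + (2 * π * ξ) ^ 2 * ν * (∫ r in (0 : ℝ)..T, movingHat u k r) ξ = 0 := by
  have hc := h.continuousOn_movingMode k
  have j0 : IntervalIntegrable (movingMode u k) volume 0 T :=
    intervalIntegrable_of_continuousOn_Ici hc le_rfl hT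
  have j1 : IntervalIntegrable (fun r => r • movingMode u k r) volume 0 T :=
    intervalIntegrable_of_continuousOn_Ici (continuousOn_id.smul hc) le_rfl hT
  have j2 : IntervalIntegrable (fun r => r ^ 2 • movingMode u k r) volume 0 T :=
    intervalIntegrable_of_continuousOn_Ici ((continuousOn_id.pow 2).smul hc) le_rfl hT
  have jF := h.intervalIntegrable_movingMode k hT
  -- The symbol `k² + (η - kr)²` is quadratic in `r`, so three time moments suffice and only fixed
  -- functions of `η` multiply the Bochner integrals.
  let I0 := ∫ r in (0 : ℝ)..T, movingMode u k r
  let I1 := ∫ r in (0 : ℝ)..T, r • movingMode u k r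
  let I2 := ∫ r in (0 : ℝ)..T, r ^ 2 • movingMode u k r
  let IF := ∫ r in (0 : ℝ)..T, movingMode F k r
  let D : LineL2 := movingMode u k T + (-1 : ℂ) • movingMode u k 0
  have key := fourier_of_weak_identity
    (A₀ := D + (ν * k ^ 2 : ℂ) • I0 + (ν * k ^ 2 : ℂ) • I2 + (-1 : ℂ) • IF)
    (A₁ := 0 + (-(2 * Complex.I * k * ν) : ℂ) • I1) (A₂ := 0 + (-ν : ℂ) • I0) fun ρ hρ hcs => by
      have sρ' : ContDiff ℝ ∞ (deriv ρ) := (contDiff_infty_iff_deriv.1 hρ).2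
      have m0 := memLp_of_smooth hρ hcs
      have m1 := memLp_of_smooth sρ' hcs.deriv
      have m2 := memLp_of_smooth (contDiff_infty_iff_deriv.1 sρ').2 hcs.deriv.deriv
      have e := h.moving_weak k hT hρ hcs
      have p := fun {q : ℝ → ℂ} (hq : MemLp q 2) => intervalIntegrable_integral_mul j0 hq
      have p1 := intervalIntegrable_integral_mul j1 m1
      have p2 := intervalIntegrable_integral_mul j2 m0
      have pF := intervalIntegrable_integral_mul jF m0
      simp only [integral_real_smul_mul] at p1 p2
      push_cast at p2
      have e0 := linePair_integral j0 m0
      have e0'' := linePair_integral j0 m2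
      have e1 := linePair_integral j1 m1
      have e2 := linePair_integral j2 m0
      have eF := linePair_integral jF m0
      simp only [integral_real_smul_mul] at e1 e2
      push_cast at e2
      rw [intervalIntegral.integral_add ((((p m2).const_mul _).add (p1.const_mul _)).sub
        (((p m0).add p2).const_mul _)) pF, intervalIntegral.integral_sub
        (((p m2).const_mul _).add (p1.const_mul _)) (((p m0).add p2).const_mul _),
        intervalIntegral.integral_add ((p m2).const_mul _) (p1.const_mul _),
        intervalIntegral.integral_const_mul, intervalIntegral.integral_const_mul,
        intervalIntegral.integral_const_mul, intervalIntegral.integral_add (p m0) p2,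
        e0, e0'', e1, e2, eF] at e
      simp only [D, integral_add_smul_mul _ _ _ m0, integral_add_smul_mul _ _ _ m1,
        integral_add_smul_mul _ _ _ m2, zero_mul_integral]
      linear_combination e
  have f0 : 𝓕 I0 = ∫ r in (0 : ℝ)..T, movingHat u k r := fourier_integral j0
  have f1 : 𝓕 I1 = ∫ r in (0 : ℝ)..T, r • movingHat u k r := 
    (fourier_integral j1).trans (by simp only [map_smul]; rfl)
  have f2 : 𝓕 I2 = ∫ r in (0 : ℝ)..T, r ^ 2 • movingHat u k r := 
    (fourier_integral j2).trans (by simp only [map_smul]; rfl)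
  have fF : 𝓕 IF = ∫ r in (0 : ℝ)..T, movingHat F k r := fourier_integral jF
  filter_upwards [key, fourier_zero_ae, fourier_add_smul (movingMode u k T) (movingMode u k 0) (-1),
    fourier_add_smul D I0 (ν * k ^ 2),
    fourier_add_smul (D + (ν * k ^ 2 : ℂ) • I0) I2 (ν * k ^ 2),
    fourier_add_smul (D + (ν * k ^ 2 : ℂ) • I0 + (ν * k ^ 2 : ℂ) • I2) IF (-1),
    fourier_add_smul 0 I1 (-(2 * Complex.I * k * ν)), fourier_add_smul 0 I0 (-ν)]
    with ξ g g0 g1 g2 g3 g4 g5 g6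
  rw [g4, g3, g2, g1, g5, g6, g0, f0, f1, f2, fF] at g
  change (𝓕 (movingMode u k T)) ξ - (𝓕 (movingMode u k 0)) ξ + _ - _ - _ + _ = _
  linear_combination g - 4 * π * k * ν * ξ * (∫ r in (0 : ℝ)..T, r • movingHat u k r) ξ *
    Complex.I_sq + (2 * π * ξ) ^ 2 * ν * (∫ r in (0 : ℝ)..T, movingHat u k r) ξ * Complex.I_sq

/-- The evolution equation on a band of frequencies. -/
theorem IsWeakSolution.band_equation (h : IsWeakSolution ν F u) (k : ℤ) (N : ℝ) {T : ℝ}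
    (hT : 0 ≤ T) :
    bandMul N 1 (movingHat u k T) - bandMul N 1 (movingHat u k 0) =
      ∫ r in (0 : ℝ)..T, (-(ν • bandMul N (symb k N r) (movingHat u k r))
        + bandMul N 1 (movingHat F k r)) := by
  have hc := h.continuousOn_movingHat k
  have j0 : IntervalIntegrable (movingHat u k) volume 0 T :=
    intervalIntegrable_of_continuousOn_Ici hc le_rfl hT
  have j1 : IntervalIntegrable (fun r => r • movingHat u k r) volume 0 T :=
    intervalIntegrable_of_continuousOn_Ici (continuousOn_id.smul hc) le_rfl hT
  have j2 : IntervalIntegrable (fun r => r ^ 2 • movingHat u k r) volume 0 T :=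
    intervalIntegrable_of_continuousOn_Ici ((continuousOn_id.pow 2).smul hc) le_rfl hT
  have jF := h.intervalIntegrable_movingHat k hT
  -- Expanding in powers of `r` leaves bounded multipliers independent of time, which can be taken
  -- out of the integral.
  have e : ∀ r, -(ν • bandMul N (symb k N r) (movingHat u k r)) + bandMul N 1 (movingHat F k r) =
      bandMul N (-(ν • symbZero k N)) (movingHat u k r)
      + bandMul N (ν • symbOne k N) (r • movingHat u k r)
      + bandMul N (-((ν * k ^ 2) • 1)) (r ^ 2 • movingHat u k r)
      + bandMul N 1 (movingHat F k r) := fun r => by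
    simp only [symb, map_add, map_sub, map_smul, map_neg, _root_.add_apply,
      _root_.sub_apply, _root_.smul_apply, _root_.neg_apply]
    module
  simp_rw [e]
  have b0 := IntervalIntegrable.clm_comp (bandMul N (-(ν • symbZero k N))) j0
  have b1 := IntervalIntegrable.clm_comp (bandMul N (ν • symbOne k N)) j1
  have b2 := IntervalIntegrable.clm_comp (bandMul N (-((ν * k ^ 2) • 1))) j2
  have bF := IntervalIntegrable.clm_comp (bandMul N 1) jF
  rw [intervalIntegral.integral_add ((b0.add b1).add b2) bF,
    intervalIntegral.integral_add (b0.add b1) b2, intervalIntegral.integral_add b0 b1,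
    ContinuousLinearMap.intervalIntegral_comp_comm _ j0,
    ContinuousLinearMap.intervalIntegral_comp_comm _ j1,
    ContinuousLinearMap.intervalIntegral_comp_comm _ j2,
    ContinuousLinearMap.intervalIntegral_comp_comm _ jF]
  set I0 := ∫ r in (0 : ℝ)..T, movingHat u k r
  set I1 := ∫ r in (0 : ℝ)..T, r • movingHat u k r
  set I2 := ∫ r in (0 : ℝ)..T, r ^ 2 • movingHat u k r
  set IF := ∫ r in (0 : ℝ)..T, movingHat F k r
  refine Lp.ext ?_
  filter_upwards [h.fourier_identity k hT, bandMul_ae (1 : Band N) (movingHat u k T),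
    bandMul_ae (1 : Band N) (movingHat u k 0), bandMul_ae (-(ν • symbZero k N)) I0,
    bandMul_ae (ν • symbOne k N) I1, bandMul_ae (-((ν * (k : ℝ) ^ 2) • (1 : Band N))) I2,
    bandMul_ae (1 : Band N) IF,
    Lp.coeFn_sub (bandMul N 1 (movingHat u k T)) (bandMul N 1 (movingHat u k 0)),
    Lp.coeFn_add (bandMul N (-(ν • symbZero k N)) I0) (bandMul N (ν • symbOne k N) I1),
    Lp.coeFn_add (bandMul N (-(ν • symbZero k N)) I0 + bandMul N (ν • symbOne k N) I1)
      (bandMul N (-((ν * (k : ℝ) ^ 2) • (1 : Band N))) I2),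
    Lp.coeFn_add (bandMul N (-(ν • symbZero k N)) I0 + bandMul N (ν • symbOne k N) I1 +
      bandMul N (-((ν * (k : ℝ) ^ 2) • (1 : Band N))) I2) (bandMul N 1 IF)]
    with ξ g a1 a2 a3 a4 a5 a6 s1 s2 s3 s4
  rw [s1, s4, Pi.sub_apply, Pi.add_apply, s3, Pi.add_apply, s2, Pi.add_apply, a1, a2, a3, a4, a5,
    a6]
  by_cases hξ : ξ ∈ Icc (-N) N
  · simp only [bandExt_of_mem _ hξ]
    simp only [symbZero, symbOne, toBand, ContinuousMap.coe_neg, ContinuousMap.coe_smul,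
      ContinuousMap.coe_mk, Pi.neg_apply, Pi.smul_apply, smul_eq_mul, ContinuousMap.one_apply]
    push_cast
    linear_combination g
  · simp only [bandExt_of_notMem _ hξ]
    simp

end

section

/-! ### Duhamel's formula -/

/-- The accumulated symbol `∫₀ᵗ k² + (η - ks)² ds`, with `η = 2πξ`. -/
def decay (k : ℤ) (ξ t : ℝ) : ℝ :=
  ((k : ℝ) ^ 2 + (2 * π * ξ) ^ 2) * t - k * (2 * π * ξ) * t ^ 2 + (k : ℝ) ^ 2 * (t ^ 3 / 3)

/-- The multiplier `∫₀ᵗ exp(-ν ∫ₛᵗ k² + (η - kr)² dr) ds` of a resonant force. -/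
def forceMul (ν : ℝ) (k : ℤ) (t ξ : ℝ) : ℝ :=
  ∫ s in (0 : ℝ)..t, Real.exp (-(ν * (decay k ξ t - decay k ξ s)))

theorem continuous_decay (k : ℤ) (ξ : ℝ) : Continuous (decay k ξ) := by
  unfold decay; fun_prop

/-- The exponent of the integrating factor. -/
def bandExponent (ν : ℝ) (k : ℤ) (N t : ℝ) : Band N :=
  ν • (t • symbZero k N - (t ^ 2 / 2) • symbOne k N + (t ^ 3 / 3) • ((k : ℝ) ^ 2 • 1))

/-- The integrating factor. -/
def bandFactor (ν : ℝ) (k : ℤ) (N t : ℝ) : Band N := NormedSpace.exp (bandExponent ν k N t)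

/-- Evaluation at a frequency is a continuous algebra homomorphism, hence commutes with the
exponential series. -/
theorem bandFactor_apply (ν : ℝ) (k : ℤ) (N t : ℝ) (ξ : Icc (-N) N) :
    bandFactor ν k N t ξ = Real.exp (ν * decay k ξ t) := by
  have h := NormedSpace.map_exp (ContinuousMap.evalAlgHom ℝ ℝ ξ)
    (ContinuousMap.evalCLM ℝ ξ).continuous (bandExponent ν k N t)
  change bandFactor ν k N t ξ = _ at h
  rw [h, Real.exp_eq_exp_ℝ]
  congr 1
  simp [bandExponent, symbZero, symbOne, toBand, decay]
  ring

theorem hasDerivAt_bandExponent (ν : ℝ) (k : ℤ) (N t : ℝ) :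
    HasDerivAt (bandExponent ν k N) (ν • symb k N t) t := by
  have h2 : HasDerivAt (fun t : ℝ => t ^ 2 / 2) t t := by
    simpa using (hasDerivAt_pow 2 t).div_const 2
  have h3 : HasDerivAt (fun t : ℝ => t ^ 3 / 3) (t ^ 2) t := by
    simpa using (hasDerivAt_pow 3 t).div_const 3
  have := ((((hasDerivAt_id t).smul_const (symbZero k N)).sub (h2.smul_const (symbOne k N))).add
    (h3.smul_const ((k : ℝ) ^ 2 • (1 : Band N)))).const_smul ν
  rw [one_smul] at this
  exact this

/-- The algebra of multipliers is commutative, so the exponential obeys the scalar chain rule in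
norm. Restriction to a band keeps the symbol bounded. -/
theorem hasDerivAt_bandFactor (ν : ℝ) (k : ℤ) (N t : ℝ) :
    HasDerivAt (bandFactor ν k N) (bandFactor ν k N t * ν • symb k N t) t := by
  have := (hasFDerivAt_exp (𝕂 := ℝ) (x := bandExponent ν k N t)).comp_hasDerivAt t
    (hasDerivAt_bandExponent ν k N t)
  convert! this using 1

theorem continuous_bandFactor (ν : ℝ) (k : ℤ) (N : ℝ) : Continuous (bandFactor ν k N) :=
  continuous_iff_continuousAt.2 fun t => (hasDerivAt_bandFactor ν k N t).continuousAt

theorem integral_bandFactor_apply (ν : ℝ) (k : ℤ) (N t : ℝ) (ξ : Icc (-N) N) :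
    (∫ s in (0 : ℝ)..t, bandFactor ν k N s) ξ = ∫ s in (0 : ℝ)..t, Real.exp (ν * decay k ξ s) := by
  simp_rw [← bandFactor_apply]
  exact (ContinuousLinearMap.intervalIntegral_comp_comm (μ := volume) (ContinuousMap.evalCLM ℝ ξ)
    ((continuous_bandFactor ν k N).intervalIntegrable 0 t)).symm

theorem exp_mul_integral_exp (ν : ℝ) (k : ℤ) (ξ t : ℝ) :
    Real.exp (-(ν * decay k ξ t)) * ∫ s in (0 : ℝ)..t, Real.exp (ν * decay k ξ s) =
      forceMul ν k t ξ := by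
  rw [forceMul, ← intervalIntegral.integral_const_mul]
  refine intervalIntegral.integral_congr fun s _ => ?_
  simp only [← Real.exp_add]
  congr 1; ring

variable {ν : ℝ} {F u : ℝ → L2}

theorem continuous_symb (k : ℤ) (N : ℝ) : Continuous (symb k N) := by
  unfold symb; fun_prop

/-- Solution by an integrating factor of a linear equation in integrated form, cut off by the
projection `B 1`. -/
theorem integrating_factor {A X : Type*} [NormedRing A] [NormedAlgebra ℝ A] [CompleteSpace A]
    [NormedAddCommGroup X] [NormedSpace ℝ X] [CompleteSpace X] (B : A →L[ℝ] X →L[ℝ] X)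
    (hB : ∀ a c x, B a (B c x) = B (a * c) x) {E S : ℝ → A} (cS : Continuous S)
    (hE : ∀ t, HasDerivAt E (E t * S t) t) {W : ℝ → X} (cW : ContinuousOn W (Ici 0)) {b : X}
    (e : ∀ t, 0 ≤ t → B 1 (W t) - B 1 (W 0) = ∫ r in (0 : ℝ)..t, (-B (S r) (W r) + B 1 b))
    {t : ℝ} (ht : 0 ≤ t) : B (E t) (W t) = B (E 0) (W 0) + B (∫ s in (0 : ℝ)..t, E s) b := by
  have cE : Continuous E := continuous_iff_continuousAt.2 fun t => (hE t).continuousAt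
  -- Freezing the curve at its initial value for negative times gives a continuous integrand on the
  -- whole line, so the integral equation has two-sided derivatives at `0` as well.
  let w : ℝ → X := fun r => W (max r 0)
  have cw : Continuous w := cW.comp_continuous
    (continuous_id.max continuous_const) fun r => mem_Ici.2 (le_max_right _ _)
  have ew : ∀ r, 0 ≤ r → w r = W r := fun r hr => by simp only [w, max_eq_left hr]
  let g : ℝ → X := fun r => -B (S r) (w r) + B 1 b
  have cg : Continuous g := ((B.continuous.comp cS).clm_apply cw).neg.add continuous_const
  let V : ℝ → X := fun r => B 1 (W 0) + ∫ s in (0 : ℝ)..r, g s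
  have hV : ∀ r, HasDerivAt V (g r) r := fun r =>
    (cg.integral_hasStrictDerivAt 0 r).hasDerivAt.const_add _
  have eV : ∀ r, 0 ≤ r → V r = B 1 (W r) := fun r hr => by
    have e' := e r hr
    rw [sub_eq_iff_eq_add'] at e'
    rw [e']
    refine congrArg (B 1 (W 0) + ·) (intervalIntegral.integral_congr fun s hs => ?_)
    rw [uIcc_of_le hr] at hs
    simp only [g, ew s hs.1]
  let M : ℝ → A := fun r => ∫ s in (0 : ℝ)..r, E s
  have hM : ∀ r, HasDerivAt M (E r) r := fun r => (cE.integral_hasStrictDerivAt 0 r).hasDerivAt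
  -- The usual conserved quantity of an integrating factor. The projection `B 1` stands for the
  -- identity and is absorbed by multiplicativity.
  let Y : ℝ → X := fun r => B (E r) (V r) - B (M r) b
  have hY : ∀ r, 0 ≤ r → HasDerivAt Y 0 r := fun r hr => by
    have h1 := (B.hasFDerivAt.comp_hasDerivAt r (hE r)).clm_apply (hV r)
    have h2 := (B.hasFDerivAt.comp_hasDerivAt r (hM r)).clm_apply (hasDerivAt_const r b)
    convert! h1.sub h2 using 1
    simp only [Function.comp_apply, eV r hr, g, ew r hr, map_add, map_neg, hB, mul_one, map_zero,
      add_zero]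
    abel
  have key := constant_of_has_deriv_right_zero (f := Y) (a := 0) (b := t)
    (fun r hr => (hY r hr.1).continuousAt.continuousWithinAt)
    (fun r hr => (hY r hr.1).hasDerivWithinAt) t ⟨ht, le_rfl⟩
  simp only [Y, eV t ht, eV 0 le_rfl, hB, mul_one, M,
    intervalIntegral.integral_same, map_zero, _root_.zero_apply, sub_zero] at key
  exact sub_eq_iff_eq_add.1 key

theorem IsWeakSolution.band_duhamel (h : IsWeakSolution ν F u) (k : ℤ) {b : LineL2}
    (hb : ∀ t, 0 ≤ t → movingHat F k t = b) (N : ℝ) {t : ℝ} (ht : 0 ≤ t) :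
    bandMul N (bandFactor ν k N t) (movingHat u k t) =
      bandMul N 1 (movingHat u k 0) + bandMul N (∫ s in (0 : ℝ)..t, bandFactor ν k N s) b := by
  have e0 : bandFactor ν k N 0 = 1 := by
    ext ξ; rw [bandFactor_apply]; simp [decay]
  have := integrating_factor (bandMul N) bandMul_bandMul ((continuous_symb k N).const_smul ν)
    (hasDerivAt_bandFactor ν k N) (h.continuousOn_movingHat k) (b := b) (fun r hr => by
      rw [h.band_equation k N hr]
      refine intervalIntegral.integral_congr fun s hs => ?_
      rw [uIcc_of_le hr] at hs
      simp only [hb s hs.1, Pi.smul_apply, map_smul, _root_.smul_apply]) ht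
  rwa [e0] at this

/-- Duhamel's formula for a force which is constant in the moving frame. -/
theorem IsWeakSolution.duhamel (h : IsWeakSolution ν F u) (k : ℤ) {b : LineL2}
    (hb : ∀ t, 0 ≤ t → movingHat F k t = b) {t : ℝ} (ht : 0 ≤ t) :
    ∀ᵐ ξ : ℝ, movingHat u k t ξ =
      Real.exp (-(ν * decay k ξ t)) * movingHat u k 0 ξ + forceMul ν k t ξ * b ξ := by
  -- Countably many bands share one null set; at a given `ξ` any band containing it gives the
  -- formula after division by the positive factor.
  have key : ∀ᵐ ξ : ℝ, ∀ N : ℕ,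
      bandExt (bandFactor ν k N t) ξ * movingHat u k t ξ = bandExt (1 : Band N) ξ * movingHat u k 0 ξ
        + bandExt (∫ s in (0 : ℝ)..t, bandFactor ν k N s) ξ * b ξ := by
    refine ae_all_iff.2 fun N => ?_
    have e := h.band_duhamel k hb N ht
    filter_upwards [bandMul_ae (bandFactor ν k N t) (movingHat u k t),
      bandMul_ae (1 : Band N) (movingHat u k 0),
      bandMul_ae (∫ s in (0 : ℝ)..t, bandFactor ν k N s) b,
      Lp.coeFn_add (bandMul N 1 (movingHat u k 0))
        (bandMul N (∫ s in (0 : ℝ)..t, bandFactor ν k N s) b)] with ξ h1 h2 h3 h4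
    rw [← h1, ← h2, ← h3, e, h4, Pi.add_apply]
  filter_upwards [key] with ξ hξ
  obtain ⟨N, hN⟩ := exists_nat_ge |ξ|
  have hm : ξ ∈ Icc (-(N : ℝ)) N := abs_le.1 hN
  have e := hξ N
  rw [bandExt_of_mem _ hm, bandExt_of_mem _ hm, bandExt_of_mem _ hm, bandFactor_apply,
    integral_bandFactor_apply, ContinuousMap.one_apply, Complex.ofReal_one, one_mul] at e
  rw [← exp_mul_integral_exp, Complex.ofReal_mul, mul_assoc, ← mul_add, ← e, ← mul_assoc,
    ← Complex.ofReal_mul, ← Real.exp_add, neg_add_cancel, Real.exp_zero, Complex.ofReal_one,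
    one_mul]

end

section

/-! ### Bounds for the multipliers -/

/-- The average of `(η - kr)²` over `[s, t]` is its value at the midpoint plus the variance `k²(t -
s)²/12`. -/
theorem decay_sub (k : ℤ) (ξ t s : ℝ) : decay k ξ t - decay k ξ s = (t - s) *
    ((k : ℝ) ^ 2 + (2 * π * ξ - k * ((t + s) / 2)) ^ 2 + (k : ℝ) ^ 2 * (t - s) ^ 2 / 12) := by
  unfold decay; ring

theorem one_le_sq_of_ne_zero {k : ℤ} (hk : k ≠ 0) : (1 : ℝ) ≤ (k : ℝ) ^ 2 := by
  have h := Int.one_le_abs hk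
  have : (1 : ℝ) ≤ |(k : ℝ)| := by exact_mod_cast h
  rw [← sq_abs]; nlinarith

/-- Discard the midpoint square and use `k² ≥ 1`. The discarded square vanishes at `η = kt/2`, which
is why the cubic constant is `1/12` rather than `1/3`. -/
theorem le_decay {k : ℤ} (hk : k ≠ 0) (ξ : ℝ) {t : ℝ} (ht : 0 ≤ t) :
    t + t ^ 3 / 12 ≤ decay k ξ t := by
  have h := decay_sub k ξ t 0
  have h0 : decay k ξ 0 = 0 := by simp [decay]
  rw [h0, sub_zero, sub_zero] at h
  rw [h]
  have hk' := one_le_sq_of_ne_zero hk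
  have h1 : 0 ≤ t * (2 * π * ξ - k * ((t + 0) / 2)) ^ 2 := by positivity
  nlinarith [pow_nonneg ht 3, mul_nonneg ht (sub_nonneg.2 hk'),
    mul_nonneg (pow_nonneg ht 3) (sub_nonneg.2 hk')]

theorem continuous_forceMul (ν : ℝ) (k : ℤ) (t : ℝ) : Continuous (forceMul ν k t) := by
  refine intervalIntegral.continuous_parametric_intervalIntegral_of_continuous'
    (f := fun ξ s => Real.exp (-(ν * (decay k ξ t - decay k ξ s)))) ?_ 0 t
  unfold decay Function.uncurry
  fun_prop

theorem forceMul_neg (ν : ℝ) (k : ℤ) (t ξ : ℝ) : forceMul ν (-k) t (-ξ) = forceMul ν k t ξ := by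
  have h : ∀ s, decay (-k) (-ξ) s = decay k ξ s := fun s => by
    unfold decay; push_cast; ring
  simp only [forceMul, h]

theorem intervalIntegrable_forceMul (ν : ℝ) (k : ℤ) (ξ t a b : ℝ) : IntervalIntegrable
    (fun s => Real.exp (-(ν * (decay k ξ t - decay k ξ s)))) volume a b :=
  (Real.continuous_exp.comp (continuous_const.mul
    (continuous_const.sub (continuous_decay k ξ))).neg).intervalIntegrable _ _

theorem forceMul_nonneg (ν : ℝ) (k : ℤ) {t : ℝ} (ht : 0 ≤ t) (ξ : ℝ) : 0 ≤ forceMul ν k t ξ :=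
  intervalIntegral.integral_nonneg ht fun _ _ => (Real.exp_pos _).le

/-- A damping rate of at least `ν a` bounds the integrand by `e^{-νa(t-s)}`, whose integral is below
`(νa)⁻¹`. -/
theorem forceMul_le {ν a : ℝ} (hν : 0 < ν) (ha : 0 < a) (k : ℤ) {t : ℝ} (ht : 0 ≤ t) (ξ : ℝ)
    (h : ∀ s ∈ Icc 0 t, a * (t - s) ≤ decay k ξ t - decay k ξ s) :
    forceMul ν k t ξ ≤ (ν * a)⁻¹ := by
  have hd : ∀ s, HasDerivAt (fun s => (ν * a)⁻¹ * Real.exp (-(ν * (a * (t - s)))))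
      (Real.exp (-(ν * (a * (t - s))))) s := fun s => by
    have h1 : HasDerivAt (fun s => -(ν * (a * (t - s)))) (-(ν * (a * (-1)))) s :=
      (((hasDerivAt_id s).const_sub t).const_mul a).const_mul ν |>.neg
    convert! h1.exp.const_mul (ν * a)⁻¹ using 1
    field_simp
  have hi : IntervalIntegrable (fun s => Real.exp (-(ν * (a * (t - s))))) volume 0 t :=
    (by fun_prop : Continuous fun s => Real.exp (-(ν * (a * (t - s))))).intervalIntegrable _ _
  calc forceMul ν k t ξ ≤ ∫ s in (0 : ℝ)..t, Real.exp (-(ν * (a * (t - s)))) := by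
        refine intervalIntegral.integral_mono_on ht (intervalIntegrable_forceMul ν k ξ t 0 t) hi
          fun s hs => ?_
        have := h s hs
        gcongr
    _ = (ν * a)⁻¹ * Real.exp (-(ν * (a * (t - t)))) - (ν * a)⁻¹ * Real.exp (-(ν * (a * (t - 0)))) :=
        intervalIntegral.integral_eq_sub_of_hasDerivAt (fun s _ => hd s) hi
    _ ≤ (ν * a)⁻¹ := by
        have : 0 ≤ (ν * a)⁻¹ * Real.exp (-(ν * (a * (t - 0)))) := by positivity
        simp only [sub_self, mul_zero, neg_zero, Real.exp_zero, mul_one]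
        linarith

theorem forceMul_le_inv {ν : ℝ} (hν : 0 < ν) {k : ℤ} (hk : k ≠ 0) {t : ℝ} (ht : 0 ≤ t) (ξ : ℝ) :
    forceMul ν k t ξ ≤ ν⁻¹ := by
  have := forceMul_le hν one_pos k ht ξ fun s hs => by
    rw [decay_sub, mul_comm]
    refine mul_le_mul_of_nonneg_left ?_ (sub_nonneg.2 hs.2)
    have := one_le_sq_of_ne_zero hk
    have h1 : 0 ≤ (2 * π * ξ - k * ((t + s) / 2)) ^ 2 := by positivity
    have h2 : 0 ≤ (k : ℝ) ^ 2 * (t - s) ^ 2 / 12 := by positivity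
    linarith
  rwa [mul_one] at this

/-- If `|η| ≤ |k|t/4` the damping rate on every interval ending at `t` is of order `1 + t²`;
otherwise `1 + k² + η²` already exceeds a multiple of `(1 + t)²` and the uniform bound suffices. -/
theorem forceMul_le_weight {ν : ℝ} (hν : 0 < ν) {k : ℤ} (hk : k ≠ 0) {t : ℝ} (ht : 0 ≤ t)
    (ξ : ℝ) :
    forceMul ν k t ξ ≤ 32 / ν * ((1 + (k : ℝ) ^ 2 + (2 * π * ξ) ^ 2) / (1 + t) ^ 2) := by
  set η := 2 * π * ξ with hη
  have hk1 := one_le_sq_of_ne_zero hk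
  -- Source of the constant `32`: `(1 + t)² ≤ 2 + 2t² ≤ 32 (1 + t²/16)`.
  have ht2 : (1 + t) ^ 2 ≤ 32 * (1 + t ^ 2 / 16) := by nlinarith [sq_nonneg (1 - t)]
  have hX : ∀ b : ℝ, 0 < b → (1 + t) ^ 2 ≤ 32 * b → ν⁻¹ ≤ 32 / ν * (b / (1 + t) ^ 2) := by
    intro b hb h
    rw [div_mul_div_comm, inv_eq_one_div, div_le_div_iff₀ hν (by positivity)]
    nlinarith
  by_cases hc : |η| ≤ |(k : ℝ)| * t / 4
  · have ha : 0 < 1 + t ^ 2 / 16 := by positivity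
    have h1 := forceMul_le hν ha k ht ξ fun s hs => by
      rw [decay_sub, mul_comm, ← hη]
      refine mul_le_mul_of_nonneg_left ?_ (sub_nonneg.2 hs.2)
      have h2 : 0 ≤ (k : ℝ) ^ 2 * (t - s) ^ 2 / 12 := by positivity
      -- The midpoint is at least `t/2`, so `|k|(t+s)/2 ≥ |k|t/2`, of which `η` can cancel at most
      -- half.
      have h3 : |(k : ℝ)| * t / 4 ≤ |η - k * ((t + s) / 2)| := by
        have h4 : |(k : ℝ) * ((t + s) / 2)| - |η| ≤ |η - k * ((t + s) / 2)| := by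
          rw [abs_sub_comm]; exact abs_sub_abs_le_abs_sub _ _
        rw [abs_mul, abs_of_nonneg (by linarith [hs.1] : 0 ≤ (t + s) / 2)] at h4
        nlinarith [mul_nonneg (abs_nonneg (k : ℝ)) hs.1]
      have h5 := pow_le_pow_left₀ (by positivity) h3 2
      rw [sq_abs, div_pow, mul_pow, sq_abs] at h5
      nlinarith [mul_nonneg (sq_nonneg t) (sub_nonneg.2 hk1)]
    have h6 : (ν * (1 + t ^ 2 / 16))⁻¹ ≤ 32 / ν * (1 / (1 + t) ^ 2) := by
      rw [div_mul_div_comm, mul_one, inv_eq_one_div, div_le_div_iff₀ (by positivity) (by positivity)]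
      nlinarith
    refine h1.trans (h6.trans ?_)
    gcongr
    nlinarith [sq_nonneg η]
  · refine (forceMul_le_inv hν hk ht ξ).trans (hX _ (by positivity) (ht2.trans ?_))
    push Not at hc
    have h3 : t / 4 ≤ |η| := by
      have : (1 : ℝ) ≤ |(k : ℝ)| := by exact_mod_cast Int.one_le_abs hk
      nlinarith
    have h5 := pow_le_pow_left₀ (by positivity) h3 2
    rw [sq_abs] at h5
    nlinarith

/-- Interpolation between the uniform bound and the quadratic decay. -/
theorem forceMul_le_rpow {ν : ℝ} (hν : 0 < ν) {k : ℤ} (hk : k ≠ 0) {t : ℝ} (ht : 0 ≤ t) (ξ : ℝ)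
    {s : ℝ} (hs : 0 ≤ s) : forceMul ν k t ξ ≤ 32 / ν * ((1 + t) ^ (-(min s 2)) *
      (1 + (k : ℝ) ^ 2 + (2 * π * ξ) ^ 2) ^ (s / 2)) := by
  set b := 1 + (k : ℝ) ^ 2 + (2 * π * ξ) ^ 2 with hb
  have hb1 : 1 ≤ b := by rw [hb]; nlinarith [sq_nonneg (k : ℝ), sq_nonneg (2 * π * ξ)]
  set σ := min s 2 with hσ
  have hσ0 : 0 ≤ σ := le_min hs zero_le_two
  have hσ2 : σ ≤ 2 := min_le_right _ _
  have ht1 : 0 < 1 + t := by linarith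
  set X := b / (1 + t) ^ 2 with hX
  have hX0 : 0 < X := by positivity
  have h1 : X ^ (σ / 2) ≤ (1 + t) ^ (-σ) * b ^ (s / 2) := by
    rw [hX, Real.div_rpow (by positivity) (by positivity), div_eq_inv_mul, ← Real.rpow_natCast,
      ← Real.rpow_mul ht1.le, Real.rpow_neg ht1.le]
    have e : ((2 : ℕ) : ℝ) * (σ / 2) = σ := by push_cast; ring
    rw [e]
    gcongr
    exact min_le_left _ _
  refine le_trans ?_ (mul_le_mul_of_nonneg_left h1 (by positivity))
  -- For `X ≤ 1` use the quadratic bound and `X ≤ X^{σ/2}`, valid because `σ ≤ 2`; for `X > 1` use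
  -- the uniform bound and `1 ≤ X^{σ/2}`.
  by_cases hX1 : X ≤ 1
  · refine (forceMul_le_weight hν hk ht ξ).trans ?_
    gcongr
    conv_lhs => rw [← hb, ← hX, ← Real.rpow_one X]
    exact Real.rpow_le_rpow_of_exponent_ge hX0 hX1 (by linarith)
  · refine (forceMul_le_inv hν hk ht ξ).trans ?_
    have h2 : 1 ≤ X ^ (σ / 2) := Real.one_le_rpow (not_le.1 hX1).le (by positivity)
    rw [div_mul_eq_mul_div, inv_eq_one_div]
    gcongr
    linarith

/-- Only the window `[t - t⁻², t]` is kept. The damping rate is of order `t²` on bounded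
frequencies, so the exponent stays bounded there and the integral is comparable to the length of the
window. -/
theorem le_forceMul {ν : ℝ} (hν : 0 < ν) (k : ℤ) {N t ξ : ℝ} (ht : 1 ≤ t) (hξ : |ξ| ≤ N) :
    Real.exp (-(ν * (2 * (k : ℝ) ^ 2 + (2 * π * N + |(k : ℝ)|) ^ 2))) / t ^ 2 ≤
      forceMul ν k t ξ := by
  set K := 2 * (k : ℝ) ^ 2 + (2 * π * N + |(k : ℝ)|) ^ 2 with hK
  have ht0 : 0 < t := by linarith
  have ha1 : 1 / t ^ 2 ≤ 1 := by rw [div_le_one (by positivity)]; nlinarith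
  have ha : 0 ≤ t - 1 / t ^ 2 := by linarith
  have hat : t - 1 / t ^ 2 ≤ t := by have : 0 ≤ 1 / t ^ 2 := by positivity
                                     linarith
  have h1 : (∫ s in (t - 1 / t ^ 2)..t, Real.exp (-(ν * K))) ≤
      ∫ s in (t - 1 / t ^ 2)..t, Real.exp (-(ν * (decay k ξ t - decay k ξ s))) := by
    refine intervalIntegral.integral_mono_on hat intervalIntegrable_const
      (intervalIntegrable_forceMul ν k ξ t _ t) fun s hs => ?_
    have hτ0 : 0 ≤ t - s := sub_nonneg.2 hs.2
    have hτ1 : t - s ≤ 1 / t ^ 2 := by linarith [hs.1]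
    have hτt : (t - s) * t ^ 2 ≤ 1 := by
      rwa [le_div_iff₀ (by positivity)] at hτ1
    have hτ2 : t - s ≤ 1 := hτ1.trans ha1
    have hs0 : 0 ≤ s := ha.trans hs.1
    have hw : |2 * π * ξ - k * ((t + s) / 2)| ≤ (2 * π * N + |(k : ℝ)|) * t := by
      refine (abs_sub _ _).trans ?_
      rw [abs_mul, abs_mul (k : ℝ), abs_of_pos Real.two_pi_pos,
        abs_of_nonneg (by linarith : 0 ≤ (t + s) / 2)]
      have h2 : 2 * π * |ξ| ≤ 2 * π * N * t := by
        have hN : 0 ≤ N := (abs_nonneg _).trans hξ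
        calc 2 * π * |ξ| ≤ 2 * π * N := by gcongr
          _ ≤ 2 * π * N * t := le_mul_of_one_le_right (by positivity) ht
      have h3 : |(k : ℝ)| * ((t + s) / 2) ≤ |(k : ℝ)| * t :=
        mul_le_mul_of_nonneg_left (by linarith [hs.2]) (abs_nonneg _)
      linarith
    have hw2 := pow_le_pow_left₀ (abs_nonneg _) hw 2
    rw [sq_abs, mul_pow] at hw2
    have hle : decay k ξ t - decay k ξ s ≤ K := by
      rw [decay_sub, hK]
      -- The length `t - s ≤ t⁻²` compensates the growth `t²` of the midpoint square.
      have q1 : (t - s) * (2 * π * ξ - k * ((t + s) / 2)) ^ 2 ≤ (2 * π * N + |(k : ℝ)|) ^ 2 := by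
        calc _ ≤ (t - s) * ((2 * π * N + |(k : ℝ)|) ^ 2 * t ^ 2) := by gcongr
          _ = ((t - s) * t ^ 2) * (2 * π * N + |(k : ℝ)|) ^ 2 := by ring
          _ ≤ 1 * (2 * π * N + |(k : ℝ)|) ^ 2 := by gcongr
          _ = _ := one_mul _
      have q2 : (t - s) * (k : ℝ) ^ 2 ≤ (k : ℝ) ^ 2 := mul_le_of_le_one_left (sq_nonneg _) hτ2
      have q3 : (t - s) * ((k : ℝ) ^ 2 * (t - s) ^ 2 / 12) ≤ (k : ℝ) ^ 2 := by
        have : (t - s) ^ 3 ≤ 1 := pow_le_one₀ hτ0 hτ2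
        nlinarith [mul_nonneg (sq_nonneg (k : ℝ)) (sub_nonneg.2 this), sq_nonneg (k : ℝ)]
      nlinarith
    gcongr
  have h2 : ∫ s in (t - 1 / t ^ 2)..t, Real.exp (-(ν * K)) = Real.exp (-(ν * K)) / t ^ 2 := by
    rw [intervalIntegral.integral_const, smul_eq_mul]; ring
  rw [← h2]
  refine h1.trans ?_
  rw [forceMul, ← intervalIntegral.integral_add_adjacent_intervals
    (intervalIntegrable_forceMul ν k ξ t 0 (t - 1 / t ^ 2))
    (intervalIntegrable_forceMul ν k ξ t (t - 1 / t ^ 2) t)]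
  have : 0 ≤ ∫ s in (0 : ℝ)..(t - 1 / t ^ 2), Real.exp (-(ν * (decay k ξ t - decay k ξ s))) :=
    intervalIntegral.integral_nonneg ha fun _ _ => (Real.exp_pos _).le
  linarith

end

section

/-! ### Comparison of norms on the Fourier side -/

theorem norm_le_of_hat {f g : L2} {C : ℝ} (hC : 0 ≤ C)
    (h : ∀ k, ∀ᵐ ξ : ℝ, ‖hat g k ξ‖ ≤ C * ‖hat f k ξ‖) : ‖g‖ ≤ C * ‖f‖ := by
  refine (pow_le_pow_iff_left₀ (norm_nonneg _) (by positivity) two_ne_zero).1 ?_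
  rw [mul_pow]
  refine hasSum_le (fun k => ?_) (hasSum_norm_sq_hat g) ((hasSum_norm_sq_hat f).mul_left (C ^ 2))
  have h1 : ‖hat g k‖ ≤ C * ‖hat f k‖ := Lp.norm_le_mul_norm_of_ae_le_mul (h k)
  have h2 := pow_le_pow_left₀ (norm_nonneg _) h1 2
  rw [mul_pow] at h2
  nlinarith [Real.pi_pos]

theorem enorm_sq_eq_tsum_hat (f : L2) :
    ‖f‖ₑ ^ 2 = ENNReal.ofReal (2 * π) * ∑' k : ℤ, ∫⁻ ξ : ℝ, ‖hat f k ξ‖ₑ ^ 2 := by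
  rw [enorm_sq_eq_tsum_mode]
  congr 1
  refine tsum_congr fun k => ?_
  rw [← enorm_sq_eq_lintegral, ← ofReal_norm, ← ofReal_norm, norm_hat]

/-- The pointwise weight has exponent `s / 2` because the norms compared are square roots of sums of
squares. -/
theorem norm_le_sobolev {f g : L2} {C s : ℝ} (hC : 0 ≤ C) (hf : MemHs s f)
    (h : ∀ k : ℤ, ∀ᵐ ξ : ℝ, ‖hat g k ξ‖ ≤
      C * (1 + (k : ℝ) ^ 2 + (2 * π * ξ) ^ 2) ^ (s / 2) * ‖hat f k ξ‖) :
    ‖g‖ ≤ C * (sobolevENorm s f).toReal := by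
  have hpos : ∀ (k : ℤ) (ξ : ℝ), (0 : ℝ) ≤ 1 + (k : ℝ) ^ 2 + (2 * π * ξ) ^ 2 := fun k ξ => by
    positivity
  have h1 : ‖g‖ₑ ^ 2 ≤ ENNReal.ofReal C ^ 2 * sobolevENorm s f ^ 2 := by
    have e : sobolevENorm s f ^ 2 = ENNReal.ofReal (2 * π) * ∑' k : ℤ, ∫⁻ ξ : ℝ,
        ENNReal.ofReal ((1 + (k : ℝ) ^ 2 + (2 * π * ξ) ^ 2) ^ s) * ‖hat f k ξ‖ₑ ^ 2 := by
      rw [sobolevENorm, ← ENNReal.rpow_natCast, ← ENNReal.rpow_mul]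
      norm_num
      rfl
    rw [e, enorm_sq_eq_tsum_hat, mul_left_comm,
      ← ENNReal.tsum_mul_left (a := ENNReal.ofReal C ^ 2)]
    refine mul_le_mul_right (ENNReal.tsum_le_tsum fun k => ?_) _
    rw [← lintegral_const_mul' _ _ (by finiteness)]
    refine lintegral_mono_ae ?_
    filter_upwards [h k] with ξ hξ
    have h2 := ENNReal.ofReal_le_ofReal hξ
    rw [ENNReal.ofReal_mul (by have := hpos k ξ; positivity), ENNReal.ofReal_mul hC, ofReal_norm,
      ofReal_norm] at h2
    refine (pow_le_pow_left₀ (by positivity) h2 2).trans (le_of_eq ?_)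
    rw [mul_pow, mul_pow, mul_assoc, ← ENNReal.ofReal_pow (Real.rpow_nonneg (hpos k ξ) _),
      ← Real.rpow_natCast, ← Real.rpow_mul (hpos k ξ)]
    norm_num
  rw [← mul_pow] at h1
  have h2 := (ENNReal.pow_le_pow_left_iff two_ne_zero).1 h1
  have h3 := ENNReal.toReal_mono (ENNReal.mul_ne_top ENNReal.ofReal_ne_top hf.ne) h2
  rwa [ENNReal.toReal_mul, ENNReal.toReal_ofReal hC, toReal_enorm] at h3

theorem norm_sq_eq_integral (a : LineL2) : ‖a‖ ^ 2 = ∫ ξ, ‖a ξ‖ ^ 2 := by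
  simp_rw [← real_inner_self_eq_norm_sq]
  rw [L2.inner_def]

/-- Dominated convergence twice, in `ξ` within a mode and in `k` across modes. No regularity of `f`,
hence no rate. -/
theorem tendsto_norm_of_hat_eq_mul {f : L2} {g : ℝ → L2} {m : ℝ → ℤ → ℝ → ℝ} {C : ℝ}
    (hg : ∀ t, 0 ≤ t → ∀ k, ∀ᵐ ξ : ℝ, hat (g t) k ξ = m t k ξ * hat f k ξ)
    (hm : ∀ t k, Measurable (m t k)) (hC : ∀ t, 0 ≤ t → ∀ k, hat f k ≠ 0 → ∀ ξ, |m t k ξ| ≤ C)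
    (hl : ∀ k, hat f k ≠ 0 → ∀ ξ, Tendsto (fun t => m t k ξ) atTop (𝓝 0)) :
    Tendsto (fun t => ‖g t‖) atTop (𝓝 0) := by
  have hz : ∀ k t, 0 ≤ t → hat f k = 0 → hat (g t) k = 0 := fun k t ht h0 => by
    refine Lp.ext ?_
    have h1 : hat f k =ᵐ[volume] 0 := by rw [h0]; exact Lp.coeFn_zero _ _ _
    filter_upwards [hg t ht k, h1, Lp.coeFn_zero ℂ 2 (volume : Measure ℝ)] with ξ a b c
    rw [a, b, c]; simp
  have hn : ∀ t, 0 ≤ t → ∀ k, ‖hat (g t) k‖ ^ 2 = ∫ ξ, (m t k ξ) ^ 2 * ‖hat f k ξ‖ ^ 2 := by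
    intro t ht k
    rw [norm_sq_eq_integral]
    refine integral_congr_ae ((hg t ht k).mono fun ξ hξ => ?_)
    simp only [hξ, norm_mul, Complex.norm_real, mul_pow, Real.norm_eq_abs, sq_abs]
  have hk : ∀ k, Tendsto (fun t => 2 * π * ‖hat (g t) k‖ ^ 2) atTop (𝓝 0) := fun k => by
    by_cases h0 : hat f k = 0
    · refine tendsto_const_nhds.congr' ?_
      filter_upwards [eventually_ge_atTop 0] with t ht
      rw [hz k t ht h0]; simp
    · have h1 : Tendsto (fun t => ∫ ξ, (m t k ξ) ^ 2 * ‖hat f k ξ‖ ^ 2) atTop (𝓝 0) := by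
        rw [← integral_zero ℝ ℝ]
        refine tendsto_integral_filter_of_dominated_convergence (fun ξ => C ^ 2 * ‖hat f k ξ‖ ^ 2)
          (Eventually.of_forall fun t => ((hm t k).pow_const 2).aestronglyMeasurable.mul
            ((Lp.aestronglyMeasurable _).norm.pow 2)) ?_
          (((Lp.memLp _).integrable_norm_pow two_ne_zero).const_mul _) ?_
        · filter_upwards [eventually_ge_atTop 0] with t ht
          refine Eventually.of_forall fun ξ => ?_
          rw [norm_mul, norm_pow, norm_pow, norm_norm, Real.norm_eq_abs]
          gcongr
          exact hC t ht k h0 ξ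
        · refine Eventually.of_forall fun ξ => ?_
          simpa using ((hl k h0 ξ).pow 2).mul_const (‖hat f k ξ‖ ^ 2)
      have h2 := h1.const_mul (2 * π)
      rw [mul_zero] at h2
      refine h2.congr' ?_
      filter_upwards [eventually_ge_atTop 0] with t ht
      rw [hn t ht k]
  have hs : Tendsto (fun t => ‖g t‖ ^ 2) atTop (𝓝 0) := by
    have h1 : Tendsto (fun t => ∑' k, 2 * π * ‖hat (g t) k‖ ^ 2) atTop (𝓝 (∑' _ : ℤ, (0 : ℝ))) := by
      refine tendsto_tsum_of_dominated_convergence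
        (bound := fun k => |C| ^ 2 * (2 * π * ‖hat f k‖ ^ 2))
        ((hasSum_norm_sq_hat f).summable.mul_left _) hk ?_
      filter_upwards [eventually_ge_atTop 0] with t ht k
      have hb : ‖hat (g t) k‖ ≤ |C| * ‖hat f k‖ := by
        by_cases h0 : hat f k = 0
        · rw [hz k t ht h0, norm_zero]; positivity
        · refine Lp.norm_le_mul_norm_of_ae_le_mul ((hg t ht k).mono fun ξ hξ => ?_)
          rw [hξ, norm_mul, Complex.norm_real]
          gcongr
          exact (hC t ht k h0 ξ).trans (le_abs_self C)
      have h2 := pow_le_pow_left₀ (norm_nonneg _) hb 2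
      rw [mul_pow] at h2
      rw [Real.norm_eq_abs, abs_of_nonneg (by positivity)]
      nlinarith [Real.pi_pos]
    rw [tsum_zero] at h1
    exact h1.congr fun t => (hasSum_norm_sq_hat (g t)).tsum_eq
  have h2 := hs.sqrt
  simpa only [Real.sqrt_sq (norm_nonneg _), Real.sqrt_zero] using h2

theorem norm_hat_le (f : L2) (k : ℤ) : ‖hat f k‖ ≤ ‖f‖ := by
  have h := le_hasSum (hasSum_norm_sq_hat f) k fun j _ => by positivity
  have h1 : (1 : ℝ) ≤ 2 * π := by linarith [Real.pi_gt_three]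
  refine (pow_le_pow_iff_left₀ (norm_nonneg _) (norm_nonneg _) two_ne_zero).1 (le_trans ?_ h)
  exact le_mul_of_one_le_left (by positivity) h1

/-! ### The linearized problem with resonant forcing -/

variable {ν : ℝ}

theorem IsLinearSolution.isWeakSolution {f : ℝ → Channel → ℝ} {ω₀ : L2} {u F : ℝ → L2}
    (h : IsLinearSolution ν f ω₀ u) (hF : ∀ t, F t =ᵐ[volume] f t)
    (hi : ∀ T : ℝ, 0 ≤ T → IntervalIntegrable F volume 0 T) : IsWeakSolution ν F u where
  continuousOn := h.continuousOn
  integrable := hi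
  weak t ht ψ hψ := by
    rw [h.initial, h.weak t ht ψ hψ]
    refine intervalIntegral.integral_congr fun s _ => ?_
    congr 1
    exact integral_congr_ae ((hF s).mono fun p hp => by simp only [hp])

theorem continuous_shearL (f : L2) : Continuous fun t : ℝ => shearL t f :=
  continuousOn_univ.1 (continuousOn_shearL continuousOn_const continuous_id)

theorem movingHat_zero (u : ℝ → L2) (k : ℤ) : movingHat u k 0 = hat (u 0) k := by
  rw [movingHat, movingMode, neg_zero, shearL_zero]; rfl

theorem hat_eq_zero_of_forall {f g : L2} {k : ℤ} {m : ℝ → ℂ} (h0 : hat f k = 0)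
    (h : ∀ᵐ ξ : ℝ, hat g k ξ = m ξ * hat f k ξ) : hat g k = 0 := by
  refine Lp.ext ?_
  filter_upwards [h, Lp.coeFn_zero ℂ 2 (volume : Measure ℝ)] with ξ a b
  rw [a, h0, b]; simp

/-- The part of the solution driven by the force, in the moving frame. -/
theorem exists_forced_part (hν : 0 < ν) {f : L2} (hf : ZeroXMean f) {t : ℝ} (ht : 0 ≤ t) :
    ∃ g : L2, ∀ k, ∀ᵐ ξ : ℝ, hat g k ξ = forceMul ν k t ξ * hat f k ξ := by
  refine exists_hat_eq_mul f (fun k => (continuous_forceMul ν k t).measurable) (C := ν⁻¹)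
    (fun k ξ => ?_) fun k ξ => forceMul_neg ν k t ξ
  by_cases hk : k = 0
  · exact Or.inl (by rw [hk]; exact (zeroXMean_iff_hat f).1 hf)
  · right
    rw [abs_of_nonneg (forceMul_nonneg ν k ht ξ)]
    exact forceMul_le_inv hν hk ht ξ

/-- The zero mode is never damped uniformly, but mean-zero data do not have one; every other mode
satisfies `le_decay`. -/
theorem norm_le_exp_of_hat (hν : 0 < ν) {w w₀ : L2} (h0 : ZeroXMean w₀) {t : ℝ} (ht : 0 ≤ t)
    (h : ∀ k, ∀ᵐ ξ : ℝ, hat w k ξ = Real.exp (-(ν * decay k ξ t)) * hat w₀ k ξ) :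
    ‖w‖ ≤ Real.exp (-ν * (t + t ^ 3 / 12)) * ‖w₀‖ := by
  refine norm_le_of_hat (Real.exp_pos _).le fun k => ?_
  by_cases hk : k = 0
  · have e := (zeroXMean_iff_hat w₀).1 h0
    have e' := hat_eq_zero_of_forall (by rw [hk, e]) (h k)
    rw [e', hk, e]
    filter_upwards [Lp.coeFn_zero ℂ 2 (volume : Measure ℝ)] with ξ hξ
    rw [hξ]; simp
  · filter_upwards [h k] with ξ hξ
    rw [hξ, norm_mul, Complex.norm_real, Real.norm_eq_abs, Real.abs_exp, neg_mul]
    gcongr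
    exact le_decay hk ξ ht

/-- The part `u₂` is the Duhamel multiplier applied to the force and `u₁` the remainder, which
Duhamel's formula shows to be the freely damped data. One constant dominates `1`, `1/ν` and `32/ν`.
-/
theorem IsLinearSolution.exists_decomposition {C : ℝ} (hν : 0 < ν) (hC : C = 1 + 32 / ν)
    {ω₀ f : L2} (h0 : ZeroXMean ω₀) (hf : ZeroXMean f) {u : ℝ → L2}
    (h : IsLinearSolution ν (fun t => shear t f) ω₀ u) :
    ∃ u₁ u₂ : ℝ → L2,
      (∀ t : ℝ, 0 ≤ t → u t =ᵐ[volume] fun p => shear t (u₁ t) p + shear t (u₂ t) p) ∧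
      (∀ t : ℝ, 0 ≤ t → Real.exp (ν * t ^ 3 / 12) * ‖u₁ t‖ + ‖u₂ t‖ ≤ C * (‖ω₀‖ + ‖f‖)) ∧
      Tendsto (fun t => ‖u₂ t‖) atTop (𝓝 0) ∧
      (∀ s : ℝ, 0 ≤ s → MemHs s f → ∀ t : ℝ, 0 ≤ t →
        ‖u₂ t‖ ≤ C * (1 + t) ^ (-(min s 2)) * (sobolevENorm s f).toReal) ∧
      (f ≠ 0 → ∃ c : ℝ, 0 < c ∧ ∀ t : ℝ, 1 ≤ t → c / t ^ 2 ≤ ‖u₂ t‖) := by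
  have hf0 := (zeroXMean_iff_hat f).1 hf
  have hne : ∀ {k}, hat f k ≠ 0 → k ≠ 0 := fun hk h => hk (by rw [h, hf0])
  have hw : IsWeakSolution ν (fun t => shearL t f) u :=
    h.isWeakSolution (fun t => shearL_ae t f) fun T _ => (continuous_shearL f).intervalIntegrable _ _
  have hF : ∀ k t, 0 ≤ t → movingHat (fun t => shearL t f) k t = hat f k := fun k t _ => by
    rw [movingHat, movingMode, shearL_neg_shearL]; rfl
  -- Negative times carry no condition and receive the value `0`, so that a function on the whole
  -- line can be chosen.
  have hex : ∀ t, ∃ g : L2, 0 ≤ t → ∀ k, ∀ᵐ ξ : ℝ, hat g k ξ = forceMul ν k t ξ * hat f k ξ :=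
    fun t => by
      by_cases ht : 0 ≤ t
      · obtain ⟨g, hg⟩ := exists_forced_part hν hf ht
        exact ⟨g, fun _ => hg⟩
      · exact ⟨0, fun h => absurd h ht⟩
  choose u₂ hu₂ using hex
  let u₁ : ℝ → L2 := fun t => shearL (-t) (u t) - u₂ t
  have hu₁ : ∀ t, 0 ≤ t → ∀ k, ∀ᵐ ξ : ℝ,
      hat (u₁ t) k ξ = Real.exp (-(ν * decay k ξ t)) * hat ω₀ k ξ := fun t ht k => by
    have e : hat (u₁ t) k = movingHat u k t - hat (u₂ t) k := hat_sub _ _ _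
    rw [e]
    filter_upwards [hw.duhamel k (hF k) ht, hu₂ t ht k,
      Lp.coeFn_sub (movingHat u k t) (hat (u₂ t) k)] with ξ a b c
    rw [c, Pi.sub_apply, a, b, movingHat_zero, h.initial]
    ring
  have hb₂ : ∀ t, 0 ≤ t → ‖u₂ t‖ ≤ ν⁻¹ * ‖f‖ := fun t ht =>
    norm_le_of_hat (inv_pos.2 hν).le fun k => by
      by_cases hk : hat f k = 0
      · rw [hat_eq_zero_of_forall hk (hu₂ t ht k)]
        filter_upwards [Lp.coeFn_zero ℂ 2 (volume : Measure ℝ)] with ξ hξ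
        rw [hξ, Pi.zero_apply, norm_zero]
        have := inv_pos.2 hν
        positivity
      · filter_upwards [hu₂ t ht k] with ξ hξ
        rw [hξ, norm_mul, Complex.norm_real, Real.norm_eq_abs,
          abs_of_nonneg (forceMul_nonneg ν k ht ξ)]
        gcongr
        exact forceMul_le_inv hν (hne hk) ht ξ
  have hν1 : ν⁻¹ ≤ C := by
    rw [hC, div_eq_mul_inv]; have := inv_pos.2 hν; linarith
  have hC1 : 1 ≤ C := by
    rw [hC]; have : 0 < 32 / ν := by positivity
    linarith
  have hC2 : 32 / ν ≤ C := by rw [hC]; linarith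
  refine ⟨u₁, u₂, fun t ht => ?_, fun t ht => ?_, ?_, fun s hs hms t ht => ?_, fun hfne => ?_⟩
  · have e : u t = shearL t (u₁ t) + shearL t (u₂ t) := by
      rw [← map_add, sub_add_cancel, shearL_shearL_neg]
    filter_upwards [shearL_ae t (u₁ t), shearL_ae t (u₂ t),
      Lp.coeFn_add (shearL t (u₁ t)) (shearL t (u₂ t))] with p a b c
    rw [e, c, Pi.add_apply, a, b]
  · have h1 := norm_le_exp_of_hat hν h0 ht (hu₁ t ht)
    -- The cubic exponents cancel; the leftover factor `e^{-νt}` is at most `1`.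
    have h2 : Real.exp (ν * t ^ 3 / 12) * ‖u₁ t‖ ≤ ‖ω₀‖ := by
      calc _ ≤ Real.exp (ν * t ^ 3 / 12) * (Real.exp (-ν * (t + t ^ 3 / 12)) * ‖ω₀‖) := by gcongr
        _ = Real.exp (-(ν * t)) * ‖ω₀‖ := by
          rw [← mul_assoc, ← Real.exp_add]; congr 2; ring
        _ ≤ 1 * ‖ω₀‖ := by
          gcongr
          rw [Real.exp_le_one_iff]
          have := mul_nonneg hν.le ht
          linarith
        _ = _ := one_mul _
    nlinarith [hb₂ t ht, norm_nonneg ω₀, norm_nonneg f]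
  · refine tendsto_norm_of_hat_eq_mul (f := f) (m := fun t k ξ => forceMul ν k t ξ) (C := ν⁻¹)
      hu₂ (fun t k => (continuous_forceMul ν k t).measurable) (fun t ht k hk ξ => ?_)
      fun k hk ξ => ?_
    · rw [abs_of_nonneg (forceMul_nonneg ν k ht ξ)]
      exact forceMul_le_inv hν (hne hk) ht ξ
    · have hd : Tendsto (fun t : ℝ => 32 / ν * ((1 + (k : ℝ) ^ 2 + (2 * π * ξ) ^ 2) / (1 + t) ^ 2))
          atTop (𝓝 (32 / ν * 0)) := by
        refine Tendsto.const_mul _ (Tendsto.const_div_atTop ?_ _)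
        exact (tendsto_pow_atTop two_ne_zero).comp (tendsto_atTop_add_const_left _ _ tendsto_id)
      rw [mul_zero] at hd
      refine tendsto_of_tendsto_of_tendsto_of_le_of_le' tendsto_const_nhds hd ?_ ?_
      · filter_upwards [eventually_ge_atTop 0] with t ht using forceMul_nonneg ν k ht ξ
      · filter_upwards [eventually_ge_atTop 0] with t ht
        exact forceMul_le_weight hν (hne hk) ht ξ
  · refine norm_le_sobolev (by positivity) hms fun k => ?_
    by_cases hk : hat f k = 0
    · rw [hat_eq_zero_of_forall hk (hu₂ t ht k), hk]
      filter_upwards [Lp.coeFn_zero ℂ 2 (volume : Measure ℝ)] with ξ hξ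
      rw [hξ, Pi.zero_apply, norm_zero, mul_zero]
    · filter_upwards [hu₂ t ht k] with ξ hξ
      rw [hξ, norm_mul, Complex.norm_real, Real.norm_eq_abs,
        abs_of_nonneg (forceMul_nonneg ν k ht ξ)]
      gcongr
      refine (forceMul_le_rpow hν (hne hk) ht ξ hs).trans ?_
      rw [← mul_assoc]
      gcongr
  · obtain ⟨k, hk⟩ : ∃ k, hat f k ≠ 0 := by
      by_contra! hall
      exact hfne (ext_hat fun k => by rw [hall k]; exact ((hatL k).map_zero).symm)
    -- The lower bound for the multiplier is uniform only on bounded frequencies, so a band on which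
    -- this mode of the force survives is fixed.
    obtain ⟨N, hN⟩ : ∃ N : ℕ, bandMul N 1 (hat f k) ≠ 0 := by
      by_contra! hall
      refine hk (tendsto_nhds_unique (tendsto_bandMul_one (hat f k)) ?_)
      simp only [hall, tendsto_const_nhds]
    set K := Real.exp (-(ν * (2 * (k : ℝ) ^ 2 + (2 * π * N + |(k : ℝ)|) ^ 2)))
    have hK : 0 < K := Real.exp_pos _
    refine ⟨K * ‖bandMul N 1 (hat f k)‖, mul_pos hK (norm_pos_iff.2 hN), fun t ht => ?_⟩
    have ht0 : 0 ≤ t := by linarith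
    refine le_trans ?_ (norm_hat_le (u₂ t) k)
    have h1 : ‖bandMul N 1 (hat f k)‖ ≤ (K / t ^ 2)⁻¹ * ‖hat (u₂ t) k‖ := by
      refine Lp.norm_le_mul_norm_of_ae_le_mul ?_
      filter_upwards [hu₂ t ht0 k, bandMul_ae (1 : Band N) (hat f k)] with ξ a b
      rw [a, b, norm_mul, norm_mul, Complex.norm_real, Complex.norm_real, ← mul_assoc]
      gcongr
      by_cases hξ : ξ ∈ Icc (-(N : ℝ)) N
      · rw [bandExt_of_mem _ hξ, ContinuousMap.one_apply, norm_one, Real.norm_eq_abs,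
          abs_of_nonneg (forceMul_nonneg ν k ht0 ξ), inv_mul_eq_div,
          one_le_div (by positivity)]
        exact le_forceMul hν k ht (abs_le.2 hξ)
      · rw [bandExt_of_notMem _ hξ, norm_zero]
        positivity
    have ht2 : 0 < t ^ 2 := by positivity
    rw [inv_div, div_mul_eq_mul_div, le_div_iff₀ hK] at h1
    rw [div_le_iff₀ ht2]
    linarith

end

section

/-! ### The stationary problem -/

/-- Lions' projection theorem, with a solution operator. -/
theorem exists_solution_operator {D H : Type*} [AddCommGroup D] [Module ℝ D]
    [NormedAddCommGroup H] [InnerProductSpace ℝ H] [CompleteSpace H] (j K : D →ₗ[ℝ] H) {c : ℝ}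
    (hc : 0 < c) (h : ∀ d, c * ‖j d‖ ^ 2 ≤ ⟪j d, K d⟫_ℝ) :
    ∃ S : H →L[ℝ] H, (∀ l, ‖S l‖ ≤ c⁻¹ * ‖l‖) ∧ ∀ l d, ⟪S l, K d⟫_ℝ = ⟪l, j d⟫_ℝ := by
  have hb : ∀ d, ‖j d‖ ≤ c⁻¹ * ‖K d‖ := fun d => by
    have h1 := (h d).trans (real_inner_le_norm _ _)
    rw [inv_mul_eq_div, le_div_iff₀ hc]
    by_cases h0 : ‖j d‖ = 0
    · rw [h0, zero_mul]; exact norm_nonneg _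
    · have hp : 0 < ‖j d‖ := lt_of_le_of_ne (norm_nonneg _) (Ne.symm h0)
      refine le_of_mul_le_mul_left ?_ hp
      calc ‖j d‖ * (‖j d‖ * c) = c * ‖j d‖ ^ 2 := by ring
        _ ≤ _ := h1
  let M : Submodule ℝ H := (LinearMap.range K).topologicalClosure
  have hM : IsClosed (M : Set H) := Submodule.isClosed_topologicalClosure _
  have : CompleteSpace M := hM.completeSpace_coe
  have hKM : ∀ d, K d ∈ M := fun d =>
    Submodule.le_topologicalClosure _ (LinearMap.mem_range_self K d)
  let e : D →ₗ[ℝ] M := K.codRestrict M hKM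
  have hd : DenseRange e := by
    refine Subtype.dense_iff.2 fun x hx => ?_
    refine closure_mono (s := (LinearMap.range K : Set H)) ?_ hx
    rintro _ ⟨d, rfl⟩
    exact ⟨e d, ⟨d, rfl⟩, rfl⟩
  have hbe : ∀ d, ‖j d‖ ≤ c⁻¹ * ‖e d‖ := hb
  -- Coercivity and Cauchy–Schwarz make `K d ↦ j d` well defined and bounded by `c⁻¹`; extend it by
  -- density and by zero on the orthogonal complement. The adjoint of `T` is the solution operator.
  let T : H →L[ℝ] H := (j.extendOfNorm e).comp M.orthogonalProjectionOnto
  have hT : ∀ d, T (K d) = j d := fun d => by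
    have h1 : M.orthogonalProjectionOnto (K d) = e d :=
      Submodule.orthogonalProjectionOnto_mem_subspace_eq_self (K := M) (e d)
    change j.extendOfNorm e (M.orthogonalProjectionOnto (K d)) = _
    rw [h1]
    exact LinearMap.extendOfNorm_eq hd ⟨_, hbe⟩ d
  have hTn : ‖T‖ ≤ c⁻¹ := by
    refine ContinuousLinearMap.opNorm_le_bound _ (inv_pos.2 hc).le fun x => ?_
    refine (LinearMap.norm_extendOfNorm_apply_le hd _ hbe _).trans ?_
    exact mul_le_mul_of_nonneg_left (M.norm_orthogonalProjectionOnto_apply_le x) (inv_pos.2 hc).le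
  refine ⟨T.adjoint, fun l => ?_, fun l d => ?_⟩
  · refine (T.adjoint.le_opNorm l).trans ?_
    rw [LinearIsometryEquiv.norm_map]
    gcongr
  · rw [ContinuousLinearMap.adjoint_inner_left, hT]

/-- Triples of `L²` functions. -/
abbrev Triple : Type := PiLp 2 (fun _ : Fin 3 => L2)

/-- The triple `(a, b, c)`. -/
def triple (a b c : L2) : Triple := WithLp.toLp 2 ![a, b, c]

@[simp] theorem triple_zero (a b c : L2) : triple a b c 0 = a := rfl
@[simp] theorem triple_one (a b c : L2) : triple a b c 1 = b := rfl
@[simp] theorem triple_two (a b c : L2) : triple a b c 2 = c := rfl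

theorem triple_ext {w z : Triple} (h0 : w 0 = z 0) (h1 : w 1 = z 1) (h2 : w 2 = z 2) : w = z := by
  ext1 i; fin_cases i <;> assumption

theorem inner_triple (w z : Triple) :
    ⟪w, z⟫_ℝ = ⟪w 0, z 0⟫_ℝ + ⟪w 1, z 1⟫_ℝ + ⟪w 2, z 2⟫_ℝ := by
  rw [PiLp.inner_apply, Fin.sum_univ_three]

theorem norm_sq_triple (w : Triple) : ‖w‖ ^ 2 = ‖w 0‖ ^ 2 + ‖w 1‖ ^ 2 + ‖w 2‖ ^ 2 := by
  simp only [← real_inner_self_eq_norm_sq]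
  exact inner_triple w w

theorem hasWeakGrad_iff_inner {u ux uy : L2} : HasWeakGrad u ux uy ↔
    ∀ (ψ : Channel → ℝ) (hψ : IsTest ψ), ⟪u, hψ.dx.toL2⟫_ℝ = -⟪ux, hψ.toL2⟫_ℝ ∧
      ⟪u, hψ.dy.toL2⟫_ℝ = -⟪uy, hψ.toL2⟫_ℝ := by
  simp only [inner_toL2]
  exact ⟨fun h ψ hψ => ⟨h.weak_dx ψ hψ, h.weak_dy ψ hψ⟩,
    fun h => ⟨fun ψ hψ => (h ψ hψ).1, fun ψ hψ => (h ψ hψ).2⟩⟩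

theorem zeroXMean_add {u w : L2} (h : ZeroXMean u) (h' : ZeroXMean w) : ZeroXMean (u + w) := by
  rw [zeroXMean_iff_hat] at *
  rw [hat_add, h, h', add_zero]

theorem zeroXMean_smul {u : L2} (c : ℝ) (h : ZeroXMean u) : ZeroXMean (c • u) := by
  rw [zeroXMean_iff_hat] at *
  rw [← hatL_apply, map_smul, hatL_apply, h, smul_zero]

theorem zeroXMean_zero : ZeroXMean 0 := (zeroXMean_iff_hat _).2 (hatL 0).map_zero

theorem zeroXMean_sub {u w : L2} (h : ZeroXMean u) (h' : ZeroXMean w) : ZeroXMean (u - w) := by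
  simpa [sub_eq_add_neg] using zeroXMean_add h (zeroXMean_smul (-1) h')

theorem hasWeakGrad_zero : HasWeakGrad 0 0 0 :=
  hasWeakGrad_iff_inner.2 fun ψ hψ => by simp

/-- `H¹` functions with vanishing `x`-average, together with their gradients. -/
def gradSpace : Submodule ℝ Triple where
  carrier := {w | HasWeakGrad (w 0) (w 1) (w 2) ∧ ZeroXMean (w 0)}
  add_mem' h h' := ⟨h.1.add h'.1, zeroXMean_add h.2 h'.2⟩
  zero_mem' := ⟨hasWeakGrad_zero, zeroXMean_zero⟩
  smul_mem' c _ h := ⟨h.1.smul c, zeroXMean_smul c h.2⟩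

theorem isClosed_gradSpace : IsClosed (gradSpace : Set Triple) := by
  have c : ∀ i : Fin 3, Continuous fun w : Triple => w i := fun i => by fun_prop
  have e : (gradSpace : Set Triple) = {w | (∀ (ψ : Channel → ℝ) (hψ : IsTest ψ),
      ⟪w 0, hψ.dx.toL2⟫_ℝ = -⟪w 1, hψ.toL2⟫_ℝ ∧ ⟪w 0, hψ.dy.toL2⟫_ℝ = -⟪w 2, hψ.toL2⟫_ℝ) ∧
      hatL 0 (w 0) = 0} := by
    ext w
    change HasWeakGrad _ _ _ ∧ ZeroXMean _ ↔ _
    rw [hasWeakGrad_iff_inner, zeroXMean_iff_hat]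
    rfl
  rw [e]
  simp only [ofPred_and, ofPred_forall]
  refine IsClosed.inter (isClosed_iInter fun ψ => isClosed_iInter fun hψ => IsClosed.inter ?_ ?_) ?_
  · exact isClosed_eq ((c 0).inner continuous_const) ((c 1).inner continuous_const).neg
  · exact isClosed_eq ((c 0).inner continuous_const) ((c 2).inner continuous_const).neg
  · exact isClosed_eq ((hatL 0).continuous.comp (c 0)) continuous_const

instance instCompleteSpaceGradSpace : CompleteSpace gradSpace := isClosed_gradSpace.completeSpace_coe

/-- The orthogonal projection onto `gradSpace`. -/
def gradProj : Triple →L[ℝ] gradSpace := gradSpace.orthogonalProjectionOnto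

theorem inner_gradProj (w : gradSpace) (z : Triple) : ⟪w, gradProj z⟫_ℝ = ⟪(w : Triple), z⟫_ℝ :=
  (Submodule.inner_orthogonalProjectionOnto_eq_of_mem_left w z)

theorem norm_gradProj_le (z : Triple) : ‖gradProj z‖ ≤ ‖z‖ :=
  gradSpace.norm_orthogonalProjectionOnto_apply_le z

/-- Test functions as a vector space. -/
def testSpace : Submodule ℝ (Channel → ℝ) where
  carrier := {ψ | IsTest ψ}
  add_mem' h h' := h.add h'
  zero_mem' := isTest_zero
  smul_mem' c _ h := h.smul c

theorem toL2_congr {ψ φ : Channel → ℝ} (h : IsTest ψ) (h' : IsTest φ) (e : ψ = φ) :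
    h.toL2 = h'.toL2 := by subst e; rfl

theorem toL2_add {ψ φ : Channel → ℝ} (h : IsTest ψ) (h' : IsTest φ) :
    (h.add h').toL2 = h.toL2 + h'.toL2 := MemLp.toLp_add _ _

theorem toL2_smul {ψ : Channel → ℝ} (c : ℝ) (h : IsTest ψ) : (h.smul c).toL2 = c • h.toL2 :=
  MemLp.toLp_const_smul _ _

/-- A linear map on test functions, given by a linear operation. -/
def testMap (Q : (Channel → ℝ) → Channel → ℝ) (hQ : ∀ ψ, IsTest ψ → IsTest (Q ψ))
    (ha : ∀ ψ φ, IsTest ψ → IsTest φ → Q (ψ + φ) = Q ψ + Q φ)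
    (hs : ∀ (c : ℝ) ψ, IsTest ψ → Q (c • ψ) = c • Q ψ) : testSpace →ₗ[ℝ] L2 where
  toFun ψ := (hQ ψ ψ.2).toL2
  map_add' ψ φ := by
    rw [← toL2_add]
    exact toL2_congr _ _ (ha ψ φ ψ.2 φ.2)
  map_smul' c ψ := by
    rw [RingHom.id_apply, ← toL2_smul]
    exact toL2_congr _ _ (hs c ψ ψ.2)

def testId : testSpace →ₗ[ℝ] L2 :=
  testMap id (fun _ h => h) (fun _ _ _ _ => rfl) fun _ _ _ => rfl

def testDx : testSpace →ₗ[ℝ] L2 :=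
  testMap dx (fun _ h => h.dx) (fun _ _ h h' => dx_add h h') fun c _ h => dx_smul c h

def testDy : testSpace →ₗ[ℝ] L2 :=
  testMap dy (fun _ h => h.dy) (fun _ _ h h' => dy_add h h') fun c _ h => dy_smul c h

def testSnd : testSpace →ₗ[ℝ] L2 :=
  testMap (fun ψ p => p.2 * ψ p) (fun _ h => h.snd_mul)
    (fun _ _ _ _ => by funext p; simp only [Pi.add_apply]; ring)
    fun _ _ _ => by funext p; simp only [Pi.smul_apply, smul_eq_mul]; ring

/-- `triple` of linear maps. -/
def tripleMap {D : Type*} [AddCommGroup D] [Module ℝ D] (a b c : D →ₗ[ℝ] L2) : D →ₗ[ℝ] Triple where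
  toFun d := triple (a d) (b d) (c d)
  map_add' d d' := triple_ext (a.map_add d d') (b.map_add d d') (c.map_add d d')
  map_smul' r d := triple_ext (a.map_smul r d) (b.map_smul r d) (c.map_smul r d)

/-- The projection of test functions to vanishing `x`-average, in `gradSpace`. -/
def testGrad : testSpace →ₗ[ℝ] gradSpace :=
  (tripleMap (projL.toLinearMap ∘ₗ testId) (projL.toLinearMap ∘ₗ testDx)
    (projL.toLinearMap ∘ₗ testDy)).codRestrict gradSpace fun ψ =>
      ⟨(ψ.2.hasWeakGrad).projL, zeroXMean_projL _⟩

/-- The dual of the stationary operator. -/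
def testDual (ν : ℝ) : testSpace →ₗ[ℝ] gradSpace :=
  gradProj.toLinearMap ∘ₗ tripleMap 0 (testSnd + ν • testDx) (ν • testDy)

theorem projL_testDx (ψ : testSpace) : projL (testDx ψ) = testDx ψ := by
  refine projL_eq_self ((zeroXMean_iff_hat _).2 ?_)
  refine hat_eq_zero_of_forall (f := 0) (m := 0) (hatL 0).map_zero ?_
  have := IsTest.hasWeakGrad ψ.2
  filter_upwards [this.hat_dx 0] with ξ hξ
  simpa [testDx, testMap] using hξ

/-- The weight `y` does not depend on `x`, so `y ∂ₓ` is skew: the transport term carries no energy.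
-/
theorem inner_testDx_testSnd (ψ : testSpace) : ⟪testDx ψ, testSnd ψ⟫_ℝ = 0 := by
  have h : IsTest (ψ : Channel → ℝ) := ψ.2
  change ⟪h.dx.toL2, h.snd_mul.toL2⟫_ℝ = 0
  rw [inner_toL2]
  have e : ∫ p, h.dx.toL2 p * (p.2 * (ψ : Channel → ℝ) p) =
      ∫ p, dx ψ p * (p.2 * (ψ : Channel → ℝ) p) :=
    integral_congr_ae (h.dx.toL2_ae.mono fun p hp => by simp only [hp])
  rw [e]
  have h1 := integral_mul_dx h h.snd_mul
  simp only [dx_snd_mul h] at h1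
  have h2 : ∫ p, (ψ : Channel → ℝ) p * (p.2 * dx ψ p) =
      ∫ p, dx ψ p * (p.2 * (ψ : Channel → ℝ) p) := by congr 1; funext p; ring
  linarith

/-- The transport term vanishes and `ν` times the squared gradient remains. By Poincaré half of it
controls the function itself, hence the constant `ν / 2` for the full `H¹` norm. -/
theorem coercive_testDual {ν : ℝ} (hν : 0 < ν) (ψ : testSpace) :
    ν / 2 * ‖testGrad ψ‖ ^ 2 ≤ ⟪testGrad ψ, testDual ν ψ⟫_ℝ := by
  have hw : HasWeakGrad (projL (testId ψ)) (projL (testDx ψ)) (projL (testDy ψ)) :=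
    (IsTest.hasWeakGrad ψ.2).projL
  have hp := hw.norm_le (zeroXMean_projL _)
  have e1 : ⟪testGrad ψ, testDual ν ψ⟫_ℝ =
      ν * (‖projL (testDx ψ)‖ ^ 2 + ‖projL (testDy ψ)‖ ^ 2) := by
    change ⟪testGrad ψ, gradProj _⟫_ℝ = _
    rw [inner_gradProj, inner_triple]
    change ⟪projL (testId ψ), 0⟫_ℝ + ⟪projL (testDx ψ), testSnd ψ + ν • testDx ψ⟫_ℝ +
      ⟪projL (testDy ψ), ν • testDy ψ⟫_ℝ = _
    have e2 : ⟪projL (testDy ψ), testDy ψ⟫_ℝ = ‖projL (testDy ψ)‖ ^ 2 := by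
      rw [← real_inner_self_eq_norm_sq, inner_projL (testDy ψ) (projL _),
        projL_eq_self (zeroXMean_projL _), ← inner_projL]
    rw [inner_add_right, real_inner_smul_right, real_inner_smul_right, projL_testDx,
      inner_testDx_testSnd, e2, inner_zero_right, real_inner_self_eq_norm_sq]
    ring
  have e2 : ‖testGrad ψ‖ ^ 2 = ‖projL (testId ψ)‖ ^ 2 + ‖projL (testDx ψ)‖ ^ 2
      + ‖projL (testDy ψ)‖ ^ 2 := norm_sq_triple _
  rw [e1, e2]
  have := pow_le_pow_left₀ (norm_nonneg _) hp 2
  nlinarith [sq_nonneg ‖projL (testDy ψ)‖]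

/-- `g` (with its gradient) solves `y ∂ₓg - νΔg = G` weakly. -/
def IsStationary (ν : ℝ) (G : L2) (g : Triple) : Prop :=
  ∀ ψ : testSpace, ⟪g 1, testSnd ψ⟫_ℝ + ν * (⟪g 1, testDx ψ⟫_ℝ + ⟪g 2, testDy ψ⟫_ℝ) =
    ⟪G, testId ψ⟫_ℝ

/-- The solution operator of the stationary linear problem. -/
theorem exists_stationary_operator {ν : ℝ} (hν : 0 < ν) :
    ∃ S : L2 →L[ℝ] gradSpace, (∀ G, ‖S G‖ ≤ 2 / ν * ‖G‖) ∧
      ∀ G, ZeroXMean G → IsStationary ν G (S G : Triple) := by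
  obtain ⟨S, hS, h⟩ := exists_solution_operator testGrad (testDual ν) (half_pos hν)
    (coercive_testDual hν)
  -- The functional `ψ ↦ ∫ G ψ` on `H¹` sees only the function and not its gradient, hence the
  -- triple `(G, 0, 0)`.
  let ι : L2 →L[ℝ] Triple := LinearMap.mkContinuous (tripleMap LinearMap.id 0 0) 1 fun G => by
    rw [one_mul]
    refine (pow_le_pow_iff_left₀ (norm_nonneg _) (norm_nonneg _) two_ne_zero).1 ?_
    rw [norm_sq_triple]
    simp [tripleMap]
  have hι : ∀ G, ‖ι G‖ ≤ ‖G‖ := fun G => by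
    have := ι.le_of_opNorm_le (LinearMap.mkContinuous_norm_le _ zero_le_one _) G
    rwa [one_mul] at this
  refine ⟨S.comp (gradProj.comp ι), fun G => ?_, fun G hG ψ => ?_⟩
  · have h1 := hS (gradProj (ι G))
    rw [inv_div] at h1
    exact h1.trans (mul_le_mul_of_nonneg_left ((norm_gradProj_le _).trans (hι G)) (by positivity))
  · have h1 := h (gradProj (ι G)) ψ
    set g := S (gradProj (ι G))
    change ⟪(g : Triple) 1, _⟫_ℝ + ν * (⟪(g : Triple) 1, _⟫_ℝ + ⟪(g : Triple) 2, _⟫_ℝ) = _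
    change ⟪g, gradProj _⟫_ℝ = _ at h1
    rw [inner_gradProj, real_inner_comm (testGrad ψ), inner_gradProj, inner_triple, inner_triple] at h1
    change ⟪(g : Triple) 0, 0⟫_ℝ + ⟪(g : Triple) 1, testSnd ψ + ν • testDx ψ⟫_ℝ +
      ⟪(g : Triple) 2, ν • testDy ψ⟫_ℝ = ⟪projL (testId ψ), G⟫_ℝ + ⟪projL (testDx ψ), 0⟫_ℝ +
      ⟪projL (testDy ψ), 0⟫_ℝ at h1
    rw [inner_add_right, real_inner_smul_right, real_inner_smul_right, inner_zero_right,
      inner_zero_right, inner_zero_right, inner_projL_of_zeroXMean _ hG,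
      real_inner_comm G] at h1
    linarith

theorem inner_testId (f : L2) (ψ : testSpace) : ⟪f, testId ψ⟫_ℝ = ∫ p, f p * (ψ : Channel → ℝ) p :=
  inner_toL2 f ψ.2

theorem integrable_mul_test (f : L2) {ψ : Channel → ℝ} (h : IsTest ψ) :
    Integrable (fun p => f p * ψ p) :=
  (Lp.memLp f).integrable_mul (h.memLp 2)

/-- The transport term is paired as `∂ₓg` against `yψ`, so the unbounded weight always sits on a
test function. -/
theorem inner_testSnd {u ux uy : L2} (h : HasWeakGrad u ux uy) (ψ : testSpace) :
    ⟪ux, testSnd ψ⟫_ℝ = -∫ p, u p * (p.2 * dx ψ p) := by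
  have hψ : IsTest (ψ : Channel → ℝ) := ψ.2
  have e : ⟪ux, testSnd ψ⟫_ℝ = ∫ p, ux p * (p.2 * (ψ : Channel → ℝ) p) := inner_toL2 ux hψ.snd_mul
  have := h.weak_dx _ hψ.snd_mul
  simp only [dx_snd_mul hψ] at this
  rw [e, this, neg_neg]

theorem integral_stationary_form (ν : ℝ) (g : Triple) {ψ : Channel → ℝ} (hψ : IsTest ψ) :
    ∫ p, (-(g 0 p * (p.2 * dx ψ p)) + ν * (g 1 p * dx ψ p + g 2 p * dy ψ p)) =
      -(∫ p, g 0 p * (p.2 * dx ψ p)) + ν * ((∫ p, g 1 p * dx ψ p) + ∫ p, g 2 p * dy ψ p) := by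
  have i0 : Integrable (fun p => -(g 0 p * (p.2 * dx ψ p))) :=
    (integrable_mul_test (g 0) hψ.dx.snd_mul).neg
  have i1 := integrable_mul_test (g 1) hψ.dx
  have i2 := integrable_mul_test (g 2) hψ.dy
  have i3 : Integrable (fun p => ν * (g 1 p * dx ψ p + g 2 p * dy ψ p)) := (i1.add i2).const_mul ν
  rw [integral_add i0 i3, integral_const_mul, integral_add i1 i2, integral_neg]

theorem IsStationary.weak {ν : ℝ} {G : L2} {g : Triple} (h : IsStationary ν G g)
    (hg : HasWeakGrad (g 0) (g 1) (g 2)) {ψ : Channel → ℝ} (hψ : IsTest ψ) :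
    ∫ p, (-(g 0 p * (p.2 * dx ψ p)) + ν * (g 1 p * dx ψ p + g 2 p * dy ψ p)) = ∫ p, G p * ψ p := by
  have e := h ⟨ψ, hψ⟩
  have e1 : ⟪g 1, testDx ⟨ψ, hψ⟩⟫_ℝ = ∫ p, g 1 p * dx ψ p := inner_toL2 _ hψ.dx
  have e2 : ⟪g 2, testDy ⟨ψ, hψ⟩⟫_ℝ = ∫ p, g 2 p * dy ψ p := inner_toL2 _ hψ.dy
  rw [inner_testSnd hg, inner_testId, e1, e2] at e
  rwa [integral_stationary_form ν g hψ]

/-- The evolution is tested with all derivatives on the test function; this form lets a stationary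
solution be subtracted from it. -/
theorem IsStationary.weak_lap {ν : ℝ} {G : L2} {g : Triple} (h : IsStationary ν G g)
    (hg : HasWeakGrad (g 0) (g 1) (g 2)) {ψ : Channel → ℝ} (hψ : IsTest ψ) :
    (∫ p, g 0 p * (p.2 * dx ψ p + ν * lap ψ p)) + ∫ p, G p * ψ p = 0 := by
  have e := h.weak hg hψ
  have i0 := integrable_mul_test (g 0) hψ.dx.snd_mul
  have i3 := integrable_mul_test (g 0) hψ.dx.dx
  have i4 := integrable_mul_test (g 0) hψ.dy.dy
  rw [integral_stationary_form ν g hψ] at e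
  have e1 : ∫ p, g 0 p * (p.2 * dx ψ p + ν * lap ψ p) = (∫ p, g 0 p * (p.2 * dx ψ p)) +
      ν * ((∫ p, g 0 p * dx (dx ψ) p) + ∫ p, g 0 p * dy (dy ψ) p) := by
    have i5 : Integrable (fun p => ν * (g 0 p * dx (dx ψ) p + g 0 p * dy (dy ψ) p)) :=
      (i3.add i4).const_mul ν
    rw [← integral_add i3 i4, ← integral_const_mul, ← integral_add i0 i5]
    congr 1
    funext p
    simp only [lap]
    ring
  rw [e1, hg.weak_dx _ hψ.dx, hg.weak_dy _ hψ.dy]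
  linarith

/-- Subtracting a stationary solution from the evolution. -/
theorem IsWeakSolution.sub_stationary {ν : ℝ} {F u : ℝ → L2} (h : IsWeakSolution ν F u) {G : L2}
    {g : Triple} (hg : HasWeakGrad (g 0) (g 1) (g 2)) (hs : IsStationary ν G g) :
    IsWeakSolution ν (fun t => F t - G) (fun t => u t - g 0) where
  continuousOn := h.continuousOn.sub continuousOn_const
  integrable T hT := (h.integrable T hT).sub intervalIntegrable_const
  weak t ht ψ hψ := by
    have e : ∀ (a b : L2) {φ : Channel → ℝ}, IsTest φ →
        ∫ p, (a - b : L2) p * φ p = (∫ p, a p * φ p) - ∫ p, b p * φ p := fun a b φ hφ => by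
      rw [← inner_toL2 _ hφ, ← inner_toL2 _ hφ, ← inner_toL2 _ hφ, inner_sub_left]
    have hφ : IsTest (fun p => p.2 * dx ψ p + ν * lap ψ p) := hψ.dx.snd_mul.add (hψ.lap.smul ν)
    have e1 := h.weak t ht ψ hψ
    rw [e _ _ hψ, e _ _ hψ]
    have e2 := hs.weak_lap hg hψ
    have e3 : (∫ p, u t p * ψ p) - (∫ p, g 0 p * ψ p) -
        ((∫ p, u 0 p * ψ p) - ∫ p, g 0 p * ψ p) = (∫ p, u t p * ψ p) - ∫ p, u 0 p * ψ p := by ring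
    rw [e3, e1]
    refine intervalIntegral.integral_congr fun s _ => ?_
    simp only [e _ _ hφ, e _ _ hψ]
    linear_combination e2

/-! ### The linearized problem with stationary forcing -/

/-- The shear is an isometry, so the decay can be measured in the moving frame, where Duhamel's
formula has no force term. -/
theorem IsWeakSolution.norm_le_of_unforced {ν : ℝ} (hν : 0 < ν) {F u : ℝ → L2}
    (h : IsWeakSolution ν F u) (hF : ∀ t, F t = 0) (h0 : ZeroXMean (u 0)) {t : ℝ} (ht : 0 ≤ t) :
    ‖u t‖ ≤ Real.exp (-ν * (t + t ^ 3 / 12)) * ‖u 0‖ := by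
  rw [← (shearL (-t)).norm_map (u t)]
  refine norm_le_exp_of_hat hν h0 ht fun k => ?_
  have hb : ∀ t, 0 ≤ t → movingHat F k t = 0 := fun t _ => by
    change hatL k (shearL (-t) (F t)) = 0
    rw [hF, map_zero, map_zero]
  filter_upwards [h.duhamel k hb ht, Lp.coeFn_zero ℂ 2 (volume : Measure ℝ)] with ξ a b
  change movingHat u k t ξ = _
  rw [a, b, movingHat_zero]
  simp

theorem exists_linear_stationary {ν : ℝ} (hν : 0 < ν) {f : L2} (hf : ZeroXMean f) :
    ∃ g : L2, IsLinearStationary ν f g ∧ ∀ ω₀ : L2, ZeroXMean ω₀ → ∀ u : ℝ → L2,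
      IsLinearSolution ν (fun _ => f) ω₀ u → ∀ t : ℝ, 0 ≤ t →
        ‖u t - g‖ ≤ Real.exp (-ν * (t + t ^ 3 / 12)) * ‖ω₀ - g‖ := by
  obtain ⟨S, -, hS⟩ := exists_stationary_operator hν
  have hs := hS f hf
  obtain ⟨hg, hg0⟩ := (S f).2
  refine ⟨(S f : Triple) 0, ⟨_, _, hg, fun ψ hψ => hs.weak hg hψ⟩, fun ω₀ h0 u hu t ht => ?_⟩
  have hw := (hu.isWeakSolution (F := fun _ => f) (fun _ => ae_eq_refl _)
    fun T _ => intervalIntegrable_const).sub_stationary hg hs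
  have := hw.norm_le_of_unforced hν (fun t => sub_self f)
    (by rw [hu.initial]; exact zeroXMean_sub h0 hg0) ht
  rwa [hu.initial] at this

end

section

/-! ### The energy identity -/

/-- The square norm of an absolutely continuous curve in a Hilbert space. -/
theorem norm_sq_sub_norm_sq_of_integral {X : Type*} [NormedAddCommGroup X] [InnerProductSpace ℝ X]
    [CompleteSpace X] {v h : ℝ → X} {T : ℝ} (hT : 0 ≤ T) (hh : IntervalIntegrable h volume 0 T)
    (cv : ContinuousOn v (Icc 0 T))
    (e : ∀ t ∈ Icc 0 T, v t - v 0 = ∫ r in (0 : ℝ)..t, h r) :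
    ‖v T‖ ^ 2 - ‖v 0‖ ^ 2 = ∫ r in (0 : ℝ)..T, 2 * ⟪v r, h r⟫_ℝ := by
  have hsub : ∀ s ∈ Icc 0 T, ∀ t ∈ Icc 0 T, IntervalIntegrable h volume s t := fun s hs t ht =>
    hh.mono_set (by rw [uIcc_of_le hT]; exact uIcc_subset_Icc hs ht)
  have h0 : (0 : ℝ) ∈ Icc 0 T := ⟨le_rfl, hT⟩
  have hT' : T ∈ Icc 0 T := ⟨hT, le_rfl⟩
  replace e : ∀ s ∈ Icc 0 T, ∀ t ∈ Icc 0 T, v t - v s = ∫ r in s..t, h r := fun s hs t ht => by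
    rw [← intervalIntegral.integral_interval_sub_left (hsub 0 h0 t ht) (hsub 0 h0 s hs), ← e t ht,
      ← e s hs]
    abel
  have i1 : ∀ x : X, ∀ s ∈ Icc 0 T, ∀ t ∈ Icc 0 T,
      IntervalIntegrable (fun r => ⟪x, h r⟫_ℝ) volume s t := fun x s hs t ht =>
    IntervalIntegrable.clm_comp (innerSL ℝ x) (hsub s hs t ht)
  have e1 : ∀ x : X, ∀ s ∈ Icc 0 T, ∀ t ∈ Icc 0 T,
      ⟪x, v t⟫_ℝ - ⟪x, v s⟫_ℝ = ∫ r in s..t, ⟪x, h r⟫_ℝ := fun x s hs t ht => by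
    rw [← inner_sub_right, e s hs t ht]
    exact (ContinuousLinearMap.intervalIntegral_comp_comm (innerSL ℝ x) (hsub s hs t ht)).symm
  have hd : IntervalIntegrable (fun r => ⟪v r, h r⟫_ℝ) volume 0 T := by
    obtain ⟨C, hC0, hC⟩ := exists_norm_le_of_continuousOn cv
    rw [intervalIntegrable_iff_integrableOn_Ioc_of_le hT] at *
    refine Integrable.mono' (hh.norm.const_mul C) ?_ ?_
    · exact ((cv.mono Ioc_subset_Icc_self).aestronglyMeasurable measurableSet_Ioc).inner hh.1
    · filter_upwards [ae_restrict_mem measurableSet_Ioc] with r hr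
      refine (norm_inner_le_norm _ _).trans ?_
      gcongr
      exact hC r (Ioc_subset_Icc_self hr)
  have ofr : ∀ {g : ℝ → ℝ} {s t : ℝ}, IntervalIntegrable g volume s t →
      IntervalIntegrable (fun r => (g r : ℂ)) volume s t := fun hg =>
    IntervalIntegrable.clm_comp Complex.ofRealCLM hg
  -- The squared norm is the diagonal of `⟪v s, v t⟫`, which is absolutely continuous in each time
  -- separately.
  have key := diagonal_sub_eq_integral (Φ := fun s t => ((⟪v s, v t⟫_ℝ : ℝ) : ℂ))
    (G₁ := fun r t => ((⟪v t, h r⟫_ℝ : ℝ) : ℂ)) (G₂ := fun s r => ((⟪v s, h r⟫_ℝ : ℝ) : ℂ))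
    (M := fun r => ‖h r‖) hT hh.norm (fun t _ => ofr (i1 (v t) 0 h0 T hT'))
    (fun s _ => ofr (i1 (v s) 0 h0 T hT')) ((ofr hd).add (ofr hd)) ?_ ?_ ?_ ?_
  · have e2 : ∫ r in (0 : ℝ)..T, (((⟪v r, h r⟫_ℝ : ℝ) : ℂ) + ((⟪v r, h r⟫_ℝ : ℝ) : ℂ)) =
        ((∫ r in (0 : ℝ)..T, 2 * ⟪v r, h r⟫_ℝ : ℝ) : ℂ) := by
      rw [← intervalIntegral.integral_ofReal]
      refine intervalIntegral.integral_congr fun r _ => ?_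
      push_cast; ring
    simp only [real_inner_self_eq_norm_sq] at key
    rw [e2] at key
    exact_mod_cast key
  · intro s hs s' hs' t ht _
    rw [intervalIntegral.integral_ofReal, ← e1 _ s hs s' hs', real_inner_comm, real_inner_comm (v t)]
    push_cast; rfl
  · intro s hs t ht t' ht' _
    rw [intervalIntegral.integral_ofReal, ← e1 _ t ht t' ht']
    push_cast; rfl
  · intro ε hε
    obtain ⟨δ, hδ, H⟩ := exists_delta_of_continuousOn cv hε
    refine ⟨δ, hδ, fun r hr t ht t' ht' htt => ?_⟩
    rw [← Complex.ofReal_sub, ← inner_sub_left, Complex.norm_real]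
    refine (norm_inner_le_norm _ _).trans ?_
    gcongr
    exact (H t ht t' ht' htt).le
  · intro ε hε
    obtain ⟨δ, hδ, H⟩ := exists_delta_of_continuousOn cv hε
    refine ⟨δ, hδ, fun r hr t ht t' ht' htt => ?_⟩
    rw [← Complex.ofReal_sub, ← inner_sub_left, Complex.norm_real]
    refine (norm_inner_le_norm _ _).trans ?_
    gcongr
    exact (H t ht t' ht' htt).le

theorem HasWeakGrad.mode_weak_dx {u ux uy : L2} (h : HasWeakGrad u ux uy) (k : ℤ) {ρ : ℝ → ℂ}
    (hρ : ContDiff ℝ ∞ ρ) (hc : HasCompactSupport ρ) :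
    ∫ y, mode ux k y * ρ y = k * Complex.I * ∫ y, mode u k y * ρ y := by
  have e := weak_identity_of_re (A₀ := mode ux k + (-(k * Complex.I)) • mode u k)
    (A₁ := 0) (A₂ := 0) (fun ρ hρ hc => by
      have m := memLp_of_smooth hρ hc
      have h1 := h.weak_dx _ (isTest_wave k hρ hc)
      rw [dx_wave, integral_mul_wave u k (m.const_mul _), integral_mul_wave ux k m] at h1
      rw [zero_mul_integral, zero_mul_integral, add_zero, add_zero, integral_add_smul_mul _ _ _ m,
        mul_add, Complex.add_re]
      simp_rw [mul_left_comm (mode u k _) _, integral_const_mul] at h1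
      rw [h1]; ring) ρ hρ hc
  rw [zero_mul_integral, zero_mul_integral, add_zero, add_zero,
    integral_add_smul_mul _ _ _ (memLp_of_smooth hρ hc)] at e
  linear_combination e

theorem HasWeakGrad.mode_weak_dy {u ux uy : L2} (h : HasWeakGrad u ux uy) (k : ℤ) {ρ : ℝ → ℂ}
    (hρ : ContDiff ℝ ∞ ρ) (hc : HasCompactSupport ρ) :
    (∫ y, mode uy k y * ρ y) + ∫ y, mode u k y * deriv ρ y = 0 := by
  have e := weak_identity_of_re (A₀ := mode uy k) (A₁ := mode u k) (A₂ := 0) (fun ρ hρ hc => by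
      have m := memLp_of_smooth hρ hc
      have m' := memLp_of_smooth (contDiff_infty_iff_deriv.1 hρ).2 hc.deriv
      have h1 := h.weak_dy _ (isTest_wave k hρ hc)
      rw [dy_wave k (hρ.differentiable (by simp)), integral_mul_wave u k m',
        integral_mul_wave uy k m] at h1
      rw [zero_mul_integral, add_zero, mul_add, Complex.add_re, h1]
      ring) ρ hρ hc
  rwa [zero_mul_integral, add_zero] at e

theorem integral_mode_shearL_mul (f : L2) (k : ℤ) (t : ℝ) {q : ℝ → ℂ} (hq : MemLp q 2) :
    ∫ y, mode (shearL (-t) f) k y * q y = ∫ y, mode f k y * (osc k t y * q y) := by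
  rw [← linePair_oscLp_mode f k hq t, linePair_oscLp]

theorem HasWeakGrad.hat_shearL_dx {u ux uy : L2} (h : HasWeakGrad u ux uy) (k : ℤ) (t : ℝ) :
    ∀ᵐ ξ : ℝ, hat (shearL (-t) ux) k ξ = Complex.I * k * hat (shearL (-t) u) k ξ := by
  have key := fourier_of_weak_identity
    (A₀ := mode (shearL (-t) ux) k + (-(k * Complex.I)) • mode (shearL (-t) u) k)
    (A₁ := 0) (A₂ := 0) fun ρ hρ hc => by
      have m := memLp_of_smooth hρ hc
      rw [zero_mul_integral, zero_mul_integral, add_zero, add_zero, integral_add_smul_mul _ _ _ m,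
        integral_mode_shearL_mul _ _ _ m, integral_mode_shearL_mul _ _ _ m,
        h.mode_weak_dx k ((contDiff_osc k t).mul hρ) hc.mul_left]
      ring
  filter_upwards [key, fourier_add_smul (mode (shearL (-t) ux) k) (mode (shearL (-t) u) k)
    (-(k * Complex.I)), fourier_zero_ae] with ξ h1 h2 h3
  rw [h2, h3] at h1
  change hat (shearL (-t) ux) k ξ + -(k * Complex.I) * hat (shearL (-t) u) k ξ - _ + _ = 0 at h1
  linear_combination h1

/-- The shear shifts frequencies, so in the moving frame `∂_y` has symbol `i(η - kt)`. -/
theorem HasWeakGrad.hat_shearL_dy {u ux uy : L2} (h : HasWeakGrad u ux uy) (k : ℤ) (t : ℝ) :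
    ∀ᵐ ξ : ℝ, hat (shearL (-t) uy) k ξ =
      Complex.I * ((2 * π * ξ - k * t : ℝ) : ℂ) * hat (shearL (-t) u) k ξ := by
  have key := fourier_of_weak_identity
    (A₀ := mode (shearL (-t) uy) k + (k * t * Complex.I) • mode (shearL (-t) u) k)
    (A₁ := mode (shearL (-t) u) k) (A₂ := 0) fun ρ hρ hc => by
      have m := memLp_of_smooth hρ hc
      have m' := memLp_of_smooth (contDiff_infty_iff_deriv.1 hρ).2 hc.deriv
      have so := contDiff_osc k t
      have e := h.mode_weak_dy k (so.mul hρ) hc.mul_left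
      have d : ∀ y, deriv (fun y => osc k t y * ρ y) y =
          k * t * Complex.I * (osc k t y * ρ y) + osc k t y * deriv ρ y := fun y => by
        rw [deriv_fun_mul (so.differentiable (by simp) y) (hρ.differentiable (by simp) y), deriv_osc]
        ring
      have mo : ∀ {q : ℝ → ℂ}, MemLp q 2 → Integrable (fun y => mode u k y * (osc k t y * q y)) :=
        fun {q} hq => integrable_lineL2_mul _ (hq.of_le
          (so.continuous.aestronglyMeasurable.mul hq.1)
          (Eventually.of_forall fun y => by rw [norm_mul, norm_osc, one_mul]))
      simp only [d, mul_add, mul_left_comm _ (k * t * Complex.I)] at e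
      rw [integral_add ((mo m).const_mul _) (mo m'), integral_const_mul] at e
      rw [zero_mul_integral, add_zero, integral_add_smul_mul _ _ _ m,
        integral_mode_shearL_mul _ _ _ m, integral_mode_shearL_mul _ _ _ m,
        integral_mode_shearL_mul _ _ _ m']
      linear_combination e
  filter_upwards [key, fourier_add_smul (mode (shearL (-t) uy) k) (mode (shearL (-t) u) k)
    (k * t * Complex.I), fourier_zero_ae] with ξ h1 h2 h3
  rw [h2, h3] at h1
  change hat (shearL (-t) uy) k ξ + k * t * Complex.I * hat (shearL (-t) u) k ξ -
    2 * π * Complex.I * ξ * hat (shearL (-t) u) k ξ + _ = 0 at h1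
  push_cast
  linear_combination h1

/-- The symbol is `|ik|² + |i(η - kt)|²`, so the damping in the moving frame is the squared norm of
the weak gradient in the original one. -/
theorem inner_bandMul_symb {u ux uy : L2} (h : HasWeakGrad u ux uy) (k : ℤ) (N t : ℝ) :
    ⟪hat (shearL (-t) u) k, bandMul N (symb k N t) (hat (shearL (-t) u) k)⟫_ℝ =
      ⟪hat (shearL (-t) ux) k, bandMul N 1 (hat (shearL (-t) ux) k)⟫_ℝ +
      ⟪hat (shearL (-t) uy) k, bandMul N 1 (hat (shearL (-t) uy) k)⟫_ℝ := by
  rw [L2.inner_def, L2.inner_def, L2.inner_def, ← integral_add (L2.integrable_inner _ _)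
    (L2.integrable_inner _ _)]
  refine integral_congr_ae ?_
  filter_upwards [h.hat_shearL_dx k t, h.hat_shearL_dy k t,
    bandMul_ae (symb k N t) (hat (shearL (-t) u) k), bandMul_ae (1 : Band N) (hat (shearL (-t) ux) k),
    bandMul_ae (1 : Band N) (hat (shearL (-t) uy) k)] with ξ a b c d e
  rw [c, d, e, a, b]
  by_cases hξ : ξ ∈ Icc (-N) N
  · rw [bandExt_of_mem _ hξ, bandExt_of_mem _ hξ, symb_apply, ContinuousMap.one_apply]
    simp only [Complex.inner, Complex.mul_re, Complex.mul_im, Complex.conj_re, Complex.conj_im,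
      Complex.I_re, Complex.I_im, Complex.ofReal_re, Complex.ofReal_im, Complex.intCast_re,
      Complex.intCast_im]
    ring
  · rw [bandExt_of_notMem _ hξ, bandExt_of_notMem _ hξ]
    simp

variable {ν : ℝ} {F u ux uy : ℝ → L2}

theorem movingHat_apply (u : ℝ → L2) (k : ℤ) (t : ℝ) : movingHat u k t = hat (shearL (-t) (u t)) k :=
  rfl

theorem aestronglyMeasurable_comp_uncurry {E G : Type*} [NormedAddCommGroup E]
    [NormedAddCommGroup G] {μ : Measure ℝ} {S : ℝ → E → G}
    (hS : Continuous (fun q : ℝ × E => S q.1 q.2)) {v : ℝ → E} (hv : AEStronglyMeasurable v μ) :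
    AEStronglyMeasurable (fun r => S r (v r)) μ := by
  have hm : AEStronglyMeasurable (fun r => ((r, v r) : ℝ × E)) μ :=
    aestronglyMeasurable_id.prodMk hv
  exact hS.comp_aestronglyMeasurable hm

theorem aestronglyMeasurable_movingHat {μ : Measure ℝ} (hx : AEStronglyMeasurable ux μ) (k : ℤ) :
    AEStronglyMeasurable (movingHat ux k) μ :=
  aestronglyMeasurable_comp_uncurry (S := fun r f => hatL k (shearL (-r) f))
    ((hatL k).continuous.comp (continuous_shearL_uncurry (τ := fun r => -r) continuous_neg)) hx

theorem norm_movingHat_le (u : ℝ → L2) (k : ℤ) (t : ℝ) : ‖movingHat u k t‖ ≤ ‖u t‖ := by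
  rw [movingHat_apply]
  exact (norm_hat_le _ _).trans ((shearL (-t)).norm_map _).le

theorem intervalIntegrable_operator_family {A X : Type*} [NormedRing A] [NormedAlgebra ℝ A]
    [NormedAddCommGroup X] [NormedSpace ℝ X] (B : A →L[ℝ] X →L[ℝ] X) {S : ℝ → A}
    (cS : Continuous S) {W G : ℝ → X} (cW : ContinuousOn W (Ici 0)) {T : ℝ} (hT : 0 ≤ T)
    (hG : IntervalIntegrable G volume 0 T) (c : ℝ) :
    IntervalIntegrable (fun r => -(c • B (S r) (W r)) + B 1 (G r)) volume 0 T := by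
  have h1 : ContinuousOn (fun r => B (S r) (W r)) (Ici 0) :=
    ContinuousOn.clm_apply (B.continuous.comp cS).continuousOn cW
  exact (intervalIntegrable_of_continuousOn_Ici (h1.const_smul c).neg le_rfl hT).add
    (IntervalIntegrable.clm_comp (B 1) hG)

theorem IsWeakSolution.intervalIntegrable_band (h : IsWeakSolution ν F u) (k : ℤ) (N : ℝ)
    {T : ℝ} (hT : 0 ≤ T) : IntervalIntegrable (fun r =>
      -(ν • bandMul N (symb k N r) (movingHat u k r)) + bandMul N 1 (movingHat F k r))
      volume 0 T :=
  intervalIntegrable_operator_family (bandMul N) (continuous_symb k N)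
    (h.continuousOn_movingHat k) hT (h.intervalIntegrable_movingHat k hT) ν

theorem inner_band_rhs {u ux uy : L2} (h : HasWeakGrad u ux uy) (k : ℤ) (N t ν : ℝ) (b : LineL2) :
    2 * ⟪bandMul N 1 (hat (shearL (-t) u) k),
      -(ν • bandMul N (symb k N t) (hat (shearL (-t) u) k)) + bandMul N 1 b⟫_ℝ =
      -(2 * ν) * (⟪hat (shearL (-t) ux) k, bandMul N 1 (hat (shearL (-t) ux) k)⟫_ℝ +
        ⟪hat (shearL (-t) uy) k, bandMul N 1 (hat (shearL (-t) uy) k)⟫_ℝ) +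
        2 * ⟪hat (shearL (-t) u) k, bandMul N 1 b⟫_ℝ := by
  rw [inner_add_right, inner_neg_right, real_inner_smul_right, inner_bandMul, inner_bandMul,
    bandMul_bandMul, bandMul_bandMul, one_mul, one_mul, inner_bandMul_symb h]
  ring

/-- The energy identity for a single mode, on a band of frequencies. -/
theorem IsWeakSolution.band_energy (h : IsWeakSolution ν F u)
    (hg : ∀ᵐ t ∂(volume.restrict (Ici (0 : ℝ))), HasWeakGrad (u t) (ux t) (uy t)) (k : ℤ) (N : ℝ)
    {T : ℝ} (hT : 0 ≤ T) :
    ‖bandMul N 1 (movingHat u k T)‖ ^ 2 - ‖bandMul N 1 (movingHat u k 0)‖ ^ 2 =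
      ∫ r in (0 : ℝ)..T, (-(2 * ν) * (⟪movingHat ux k r, bandMul N 1 (movingHat ux k r)⟫_ℝ +
        ⟪movingHat uy k r, bandMul N 1 (movingHat uy k r)⟫_ℝ) +
        2 * ⟪movingHat u k r, bandMul N 1 (movingHat F k r)⟫_ℝ) := by
  have cv : ContinuousOn (fun t => bandMul N 1 (movingHat u k t)) (Icc 0 T) :=
    ((bandMul N 1).continuous.comp_continuousOn (h.continuousOn_movingHat k)).mono
      (Icc_subset_Ici_zero T)
  rw [norm_sq_sub_norm_sq_of_integral hT (h.intervalIntegrable_band k N hT) cv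
    fun t ht => h.band_equation k N ht.1]
  refine intervalIntegral.integral_congr_ae ?_
  rw [uIoc_of_le hT]
  filter_upwards [(ae_restrict_iff' measurableSet_Ici).1 hg] with r hr hrT
  exact inner_band_rhs (hr hrT.1.le) k N r ν _

end

/-! ### The full energy identity and exponential decay -/

section

variable {ν : ℝ} {F u ux uy : ℝ → L2}

theorem hasSum_norm_sq_movingHat (u : ℝ → L2) (t : ℝ) :
    HasSum (fun k : ℤ => 2 * π * ‖movingHat u k t‖ ^ 2) (‖u t‖ ^ 2) := by
  have := hasSum_norm_sq_hat (shearL (-t) (u t))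
  rwa [(shearL (-t)).norm_map] at this

theorem hasSum_inner_movingHat (u w : ℝ → L2) (t : ℝ) :
    HasSum (fun k : ℤ => 2 * π * ⟪movingHat u k t, movingHat w k t⟫_ℝ) ⟪u t, w t⟫_ℝ := by
  have := hasSum_inner_hat (shearL (-t) (u t)) (shearL (-t) (w t))
  rwa [(shearL (-t)).inner_map_map] at this

theorem MemLp.intervalIntegrable_norm_sq {f : ℝ → L2} {T : ℝ} (hT : 0 ≤ T)
    (hf : MemLp f 2 (volume.restrict (Icc 0 T))) :
    IntervalIntegrable (fun r => ‖f r‖ ^ 2) volume 0 T := by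
  rw [intervalIntegrable_iff_integrableOn_Icc_of_le hT]
  exact hf.integrable_norm_pow two_ne_zero

theorem IsWeakSolution.intervalIntegrable_norm_mul_norm (h : IsWeakSolution ν F u) {T : ℝ}
    (hT : 0 ≤ T) : IntervalIntegrable (fun r => ‖u r‖ * ‖F r‖) volume 0 T := by
  have h1 := (h.integrable T hT).norm
  have h2 : ContinuousOn (fun r => ‖u r‖) (uIcc 0 T) :=
    (h.continuousOn.mono (by rw [uIcc_of_le hT]; exact Icc_subset_Ici_zero T)).norm
  exact h1.continuousOn_mul h2

/-- The density in the energy identity of a mode. -/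
def modePower (ν : ℝ) (F u ux uy : ℝ → L2) (k : ℤ) (r : ℝ) : ℝ :=
  -(2 * ν) * (‖movingHat ux k r‖ ^ 2 + ‖movingHat uy k r‖ ^ 2) +
    2 * ⟪movingHat u k r, movingHat F k r⟫_ℝ

/-- The band is widened to all frequencies. Multipliers by a cutoff do not increase norms, so the
gradient norms squared and `‖u‖‖F‖` form an integrable majorant. -/
theorem IsWeakSolution.mode_energy (h : IsWeakSolution ν F u)
    (hx : ∀ T : ℝ, MemLp ux 2 (volume.restrict (Icc 0 T)))
    (hy : ∀ T : ℝ, MemLp uy 2 (volume.restrict (Icc 0 T)))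
    (hg : ∀ᵐ t ∂(volume.restrict (Ici (0 : ℝ))), HasWeakGrad (u t) (ux t) (uy t)) (k : ℤ)
    {T : ℝ} (hT : 0 ≤ T) :
    ‖movingHat u k T‖ ^ 2 - ‖movingHat u k 0‖ ^ 2 =
      ∫ r in (0 : ℝ)..T, modePower ν F u ux uy k r := by
  have hm : ∀ {w : ℝ → L2}, (∀ T : ℝ, MemLp w 2 (volume.restrict (Icc 0 T))) →
      AEStronglyMeasurable (movingHat w k) (volume.restrict (Ioc 0 T)) := fun hw =>
    aestronglyMeasurable_movingHat ((hw T).1.mono_set Ioc_subset_Icc_self) k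
  have hmF : AEStronglyMeasurable (movingHat F k) (volume.restrict (Ioc 0 T)) :=
    aestronglyMeasurable_movingHat (h.integrable T hT).1.1 k
  have hmu : AEStronglyMeasurable (movingHat u k) (volume.restrict (Ioc 0 T)) :=
    ((h.continuousOn_movingHat k).mono fun r hr => hr.1.le).aestronglyMeasurable measurableSet_Ioc
  have hB : ∀ (N : ℕ) {a : ℝ → LineL2}, AEStronglyMeasurable a (volume.restrict (Ioc 0 T)) →
      AEStronglyMeasurable (fun r => bandMul N 1 (a r)) (volume.restrict (Ioc 0 T)) :=
    fun N a ha => (bandMul N 1).continuous.comp_aestronglyMeasurable ha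
  have hL : Tendsto (fun N : ℕ => ‖bandMul N 1 (movingHat u k T)‖ ^ 2 -
      ‖bandMul N 1 (movingHat u k 0)‖ ^ 2) atTop
      (𝓝 (‖movingHat u k T‖ ^ 2 - ‖movingHat u k 0‖ ^ 2)) :=
    ((tendsto_bandMul_one _).norm.pow 2).sub ((tendsto_bandMul_one _).norm.pow 2)
  simp_rw [fun N : ℕ => h.band_energy hg k N hT] at hL
  refine tendsto_nhds_unique hL ?_
  refine intervalIntegral.tendsto_integral_filter_of_dominated_convergence
    (fun r => 2 * |ν| * (‖ux r‖ ^ 2 + ‖uy r‖ ^ 2) + 2 * (‖u r‖ * ‖F r‖))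
    (Eventually.of_forall fun N => ?_) (Eventually.of_forall fun N => ?_) ?_ ?_
  · rw [uIoc_of_le hT]
    exact ((((hm hx).inner (hB N (hm hx))).add ((hm hy).inner (hB N (hm hy)))).const_mul _).add
      ((hmu.inner (hB N hmF)).const_mul _)
  · refine Eventually.of_forall fun r _ => ?_
    have ib : ∀ a b : LineL2, |⟪a, bandMul N 1 b⟫_ℝ| ≤ ‖a‖ * ‖b‖ := fun a b =>
      (abs_real_inner_le_norm _ _).trans
        (mul_le_mul_of_nonneg_left (norm_bandMul_one_le N b) (norm_nonneg _))
    have i1 := (ib (movingHat ux k r) (movingHat ux k r)).trans (mul_le_mul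
      (norm_movingHat_le ux k r) (norm_movingHat_le ux k r) (norm_nonneg _) (norm_nonneg _))
    have i2 := (ib (movingHat uy k r) (movingHat uy k r)).trans (mul_le_mul
      (norm_movingHat_le uy k r) (norm_movingHat_le uy k r) (norm_nonneg _) (norm_nonneg _))
    have i3 := (ib (movingHat u k r) (movingHat F k r)).trans (mul_le_mul
      (norm_movingHat_le u k r) (norm_movingHat_le F k r) (norm_nonneg _) (norm_nonneg _))
    rw [Real.norm_eq_abs]
    refine (abs_add_le _ _).trans (add_le_add ?_ ?_)
    · rw [abs_mul, abs_neg, abs_mul, abs_two]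
      refine mul_le_mul_of_nonneg_left ((abs_add_le _ _).trans ?_) (by positivity)
      rw [pow_two, pow_two]
      exact add_le_add i1 i2
    · rw [abs_mul, abs_two]
      linarith
  · exact (((MemLp.intervalIntegrable_norm_sq hT (hx T)).add
      (MemLp.intervalIntegrable_norm_sq hT (hy T))).const_mul _).add
      ((h.intervalIntegrable_norm_mul_norm hT).const_mul _)
  · refine Eventually.of_forall fun r _ => ?_
    have t1 : ∀ a b : LineL2, Tendsto (fun N : ℕ => ⟪a, bandMul N 1 b⟫_ℝ) atTop (𝓝 ⟪a, b⟫_ℝ) :=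
      fun a b => tendsto_const_nhds.inner (tendsto_bandMul_one b)
    have t2 := (((t1 (movingHat ux k r) (movingHat ux k r)).add
      (t1 (movingHat uy k r) (movingHat uy k r))).const_mul (-(2 * ν))).add
      ((t1 (movingHat u k r) (movingHat F k r)).const_mul 2)
    rw [real_inner_self_eq_norm_sq, real_inner_self_eq_norm_sq] at t2
    exact t2

theorem hasSum_modePower (ν : ℝ) (F u ux uy : ℝ → L2) (r : ℝ) :
    HasSum (fun k => 2 * π * modePower ν F u ux uy k r)
      (-(2 * ν) * (‖ux r‖ ^ 2 + ‖uy r‖ ^ 2) + 2 * ⟪u r, F r⟫_ℝ) := by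
  convert! (((hasSum_norm_sq_movingHat ux r).add (hasSum_norm_sq_movingHat uy r)).mul_left
    (-(2 * ν))).add ((hasSum_inner_movingHat u F r).mul_left 2) using 2 with k
  rw [modePower]; ring

/-- Young's inequality with weight `c`. For `c = 0` also `b = 0`, and the convention `0⁻¹ = 0` keeps
the statement true. -/
theorem two_mul_mul_le (a b c : ℝ) (hb : 0 ≤ b) (hbc : b ≤ c) :
    2 * (a * b) ≤ c * a ^ 2 + c⁻¹ * b ^ 2 := by
  rcases hb.eq_or_lt with rfl | hb'
  · have : 0 ≤ c := hbc
    simp only [mul_zero]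
    positivity
  · have hc : 0 < c := hb'.trans_le hbc
    have h1 : c * a ^ 2 + c⁻¹ * b ^ 2 - 2 * (a * b) = c⁻¹ * (c * a - b) ^ 2 := by
      field_simp; ring
    have : 0 ≤ c⁻¹ * (c * a - b) ^ 2 := by positivity
    linarith

/-- The energy identity. -/
theorem IsWeakSolution.energy (h : IsWeakSolution ν F u)
    (hx : ∀ T : ℝ, MemLp ux 2 (volume.restrict (Icc 0 T)))
    (hy : ∀ T : ℝ, MemLp uy 2 (volume.restrict (Icc 0 T)))
    (hg : ∀ᵐ t ∂(volume.restrict (Ici (0 : ℝ))), HasWeakGrad (u t) (ux t) (uy t))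
    {T : ℝ} (hT : 0 ≤ T) :
    ‖u T‖ ^ 2 - ‖u 0‖ ^ 2 = ∫ r in (0 : ℝ)..T,
      (-(2 * ν) * (‖ux r‖ ^ 2 + ‖uy r‖ ^ 2) + 2 * ⟪u r, F r⟫_ℝ) := by
  have hL := (hasSum_norm_sq_movingHat u T).sub (hasSum_norm_sq_movingHat u 0)
  have e : ∀ k, 2 * π * ‖movingHat u k T‖ ^ 2 - 2 * π * ‖movingHat u k 0‖ ^ 2 =
      ∫ r in (0 : ℝ)..T, 2 * π * modePower ν F u ux uy k r := fun k => by
    rw [intervalIntegral.integral_const_mul, ← h.mode_energy hx hy hg k hT]; ring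
  simp_rw [e] at hL
  refine hL.unique ?_
  -- The force is only integrable in time, so the cross term is split with the time-dependent weight
  -- `‖F r‖`: the majorants then sum to `‖F‖ ‖u‖² + ‖F‖` plus the gradient terms, which is
  -- integrable.
  have hb : ∀ r, HasSum (fun k => |2 * ν| * (2 * π * ‖movingHat ux k r‖ ^ 2 +
      2 * π * ‖movingHat uy k r‖ ^ 2) + (‖F r‖ * (2 * π * ‖movingHat u k r‖ ^ 2) +
        ‖F r‖⁻¹ * (2 * π * ‖movingHat F k r‖ ^ 2)))
      (|2 * ν| * (‖ux r‖ ^ 2 + ‖uy r‖ ^ 2) + (‖F r‖ * ‖u r‖ ^ 2 + ‖F r‖⁻¹ * ‖F r‖ ^ 2)) := fun r =>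
    (((hasSum_norm_sq_movingHat ux r).add (hasSum_norm_sq_movingHat uy r)).mul_left _).add
      (((hasSum_norm_sq_movingHat u r).mul_left _).add
        ((hasSum_norm_sq_movingHat F r).mul_left _))
  refine intervalIntegral.hasSum_integral_of_dominated_convergence (fun k r => |2 * ν| *
      (2 * π * ‖movingHat ux k r‖ ^ 2 + 2 * π * ‖movingHat uy k r‖ ^ 2) +
      (‖F r‖ * (2 * π * ‖movingHat u k r‖ ^ 2) + ‖F r‖⁻¹ * (2 * π * ‖movingHat F k r‖ ^ 2)))
    (fun k => ?_) (fun k => ?_) (Eventually.of_forall fun r _ => (hb r).summable) ?_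
    (Eventually.of_forall fun r _ => hasSum_modePower ν F u ux uy r)
  · rw [uIoc_of_le hT]
    have hm : ∀ {w : ℝ → L2}, (∀ T : ℝ, MemLp w 2 (volume.restrict (Icc 0 T))) →
        AEStronglyMeasurable (movingHat w k) (volume.restrict (Ioc 0 T)) := fun hw =>
      aestronglyMeasurable_movingHat ((hw T).1.mono_set Ioc_subset_Icc_self) k
    have hmF : AEStronglyMeasurable (movingHat F k) (volume.restrict (Ioc 0 T)) :=
      aestronglyMeasurable_movingHat (h.integrable T hT).1.1 k
    have hmu : AEStronglyMeasurable (movingHat u k) (volume.restrict (Ioc 0 T)) :=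
      ((h.continuousOn_movingHat k).mono fun r hr => hr.1.le).aestronglyMeasurable measurableSet_Ioc
    exact (((((hm hx).norm.pow 2).add ((hm hy).norm.pow 2)).const_mul _).add
      ((hmu.inner hmF).const_mul _)).const_mul _
  · refine Eventually.of_forall fun r _ => ?_
    have i1 := abs_real_inner_le_norm (movingHat u k r) (movingHat F k r)
    have i2 := two_mul_mul_le ‖movingHat u k r‖ ‖movingHat F k r‖ ‖F r‖ (norm_nonneg _)
      (norm_movingHat_le F k r)
    have i3 : |modePower ν F u ux uy k r| ≤ |2 * ν| * (‖movingHat ux k r‖ ^ 2 +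
        ‖movingHat uy k r‖ ^ 2) + (‖F r‖ * ‖movingHat u k r‖ ^ 2 +
          ‖F r‖⁻¹ * ‖movingHat F k r‖ ^ 2) := by
      rw [modePower]
      refine (abs_add_le _ _).trans (add_le_add ?_ ?_)
      · rw [abs_mul, abs_neg, abs_of_nonneg (by positivity :
          0 ≤ ‖movingHat ux k r‖ ^ 2 + ‖movingHat uy k r‖ ^ 2)]
      · rw [abs_mul, abs_two]; linarith
    rw [Real.norm_eq_abs, abs_mul, abs_of_pos Real.two_pi_pos]
    refine (mul_le_mul_of_nonneg_left i3 Real.two_pi_pos.le).trans (le_of_eq ?_)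
    ring
  · simp_rw [fun r => (hb r).tsum_eq]
    have hu2 : ContinuousOn (fun r => ‖u r‖ ^ 2) (uIcc 0 T) :=
      (h.continuousOn.mono (by rw [uIcc_of_le hT]; exact Icc_subset_Ici_zero T)).norm.pow 2
    have e2 : ∀ r, ‖F r‖⁻¹ * ‖F r‖ ^ 2 = ‖F r‖ := fun r => by
      by_cases h0 : ‖F r‖ = 0
      · rw [h0]; simp
      · field_simp
    simp_rw [e2]
    exact (((MemLp.intervalIntegrable_norm_sq hT (hx T)).add
      (MemLp.intervalIntegrable_norm_sq hT (hy T))).const_mul _).add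
      (((h.integrable T hT).norm.mul_continuousOn hu2).add (h.integrable T hT).norm)

/-- Exponential decay from an energy inequality in integrated form. -/
theorem le_exp_of_integral_le {φ p : ℝ → ℝ} {c : ℝ} (hφ : ContinuousOn φ (Ici 0))
    (hp : ∀ T : ℝ, 0 ≤ T → IntervalIntegrable p volume 0 T)
    (e : ∀ T : ℝ, 0 ≤ T → φ T - φ 0 = ∫ r in (0 : ℝ)..T, p r)
    (hle : ∀ᵐ t ∂(volume.restrict (Ici (0 : ℝ))), p t ≤ -c * φ t) {T : ℝ} (hT : 0 ≤ T) :
    φ T ≤ φ 0 * Real.exp (-c * T) := by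
  -- The inequality for `p` holds only almost everywhere, so `φ` need not be differentiable; the
  -- version of Gronwall for right difference quotients applies.
  have key := le_gronwallBound_of_liminf_deriv_right_le (f := φ) (f' := fun t => -c * φ t)
    (δ := φ 0) (K := -c) (ε := 0) (a := 0) (b := T) (hφ.mono (Icc_subset_Ici_zero T)) ?_ le_rfl
    (fun t _ => by rw [add_zero]) T ⟨hT, le_rfl⟩
  · rwa [gronwallBound_ε0, sub_zero] at key
  intro t ht r hr
  refine Eventually.frequently ?_
  let w : ℝ → ℝ := fun s => φ (max s 0)
  have cw : Continuous w := hφ.comp_continuous (continuous_id.max continuous_const)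
    fun r => mem_Ici.2 (le_max_right _ _)
  -- The quotient of `φ` is at most that of `∫ -c φ`, whose integrand is continuous after freezing
  -- `φ` at negative times; the limit of the latter quotient is `-c φ t`.
  have hd : HasDerivAt (fun z => ∫ s in t..z, -c * w s) (-c * w t) t :=
    ((continuous_const.mul cw).integral_hasStrictDerivAt t t).hasDerivAt
  have ew : w t = φ t := by simp only [w, max_eq_left ht.1]
  rw [ew] at hd
  have hs := (hasDerivAt_iff_tendsto_slope.1 hd).mono_left
    (nhdsWithin_mono t fun z (hz : z ∈ Ioi t) => ne_of_gt hz)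
  filter_upwards [hs.eventually_lt_const hr, self_mem_nhdsWithin] with z hz htz
  refine lt_of_le_of_lt ?_ hz
  have htz' : t < z := htz
  have hz0 : 0 ≤ z := ht.1.trans htz'.le
  rw [slope_def_field, intervalIntegral.integral_same, sub_zero, inv_mul_eq_div]
  refine div_le_div_of_nonneg_right ?_ (sub_pos.2 htz').le
  have e1 : φ z - φ t = ∫ s in t..z, p s := by
    rw [← intervalIntegral.integral_interval_sub_left (hp z hz0) (hp t ht.1), ← e z hz0, ← e t ht.1]
    ring
  rw [e1]
  refine intervalIntegral.integral_mono_ae_restrict htz'.le ?_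
    ((continuous_const.mul cw).intervalIntegrable _ _) ?_
  · refine (hp z hz0).mono_set ?_
    rw [uIcc_of_le htz'.le, uIcc_of_le hz0]
    exact Icc_subset_Icc_left ht.1
  · have h1 : Icc t z ⊆ Ici 0 := fun s hs => ht.1.trans hs.1
    filter_upwards [ae_restrict_of_ae_restrict_of_subset h1 hle,
      ae_restrict_mem measurableSet_Icc] with s hs hsz
    have ews : w s = φ s := by simp only [w, max_eq_left (mem_Ici.1 (h1 hsz))]
    rw [ews]
    exact hs

end

section

/-! ### The inverse Laplacian -/

/-- The symbol of a distributional Poisson equation. -/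
theorem hat_of_weak_lap {r q : L2}
    (h : ∀ ψ : Channel → ℝ, IsTest ψ → ∫ p, r p * lap ψ p = ∫ p, q p * ψ p) (k : ℤ) :
    ∀ᵐ ξ : ℝ, hat q k ξ = (-((k : ℝ) ^ 2 + (2 * π * ξ) ^ 2) : ℝ) * hat r k ξ := by
  have key := fourier_of_weak_identity_re (A₀ := mode q k + ((k : ℂ) ^ 2) • mode r k)
    (A₁ := 0) (A₂ := (0 : LineL2) + (-1 : ℂ) • mode r k) fun ρ hρ hc => by
      have m := memLp_of_smooth hρ hc
      have m2 := memLp_of_smooth (contDiff_infty_iff_deriv.1 (contDiff_infty_iff_deriv.1 hρ).2).2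
        hc.deriv.deriv
      have h1 := h _ (isTest_wave k hρ hc)
      have m3 : MemLp (fun y => deriv (deriv ρ) y - (k : ℂ) ^ 2 * ρ y) 2 :=
        m2.sub (m.const_mul _)
      rw [lap_wave k hρ, integral_mul_wave r k m3, integral_mul_wave q k m] at h1
      have e : ∫ y, mode r k y * (deriv (deriv ρ) y - (k : ℂ) ^ 2 * ρ y) =
          (∫ y, mode r k y * deriv (deriv ρ) y) - (k : ℂ) ^ 2 * ∫ y, mode r k y * ρ y := by
        rw [← integral_const_mul, ← integral_sub (integrable_lineL2_mul _ m2)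
          ((integrable_lineL2_mul _ m).const_mul _)]
        refine integral_congr_ae (Eventually.of_forall fun y => ?_)
        simp only; ring
      rw [e] at h1
      rw [integral_add_smul_mul _ _ _ m, integral_add_smul_mul _ _ _ m2, zero_mul_integral,
        zero_mul_integral]
      have h2 := sub_eq_zero.2 h1.symm
      rw [← Complex.sub_re] at h2
      rw [← h2]; congr 1; ring
  filter_upwards [key, fourier_add_smul (mode q k) (mode r k) ((k : ℂ) ^ 2),
    fourier_add_smul 0 (mode r k) (-1), fourier_zero_ae] with ξ h1 h2 h3 h4
  rw [h2, h3, h4] at h1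
  change hat q k ξ + (k : ℂ) ^ 2 * hat r k ξ - _ + _ * (0 + (-1) * hat r k ξ) = 0 at h1
  push_cast
  linear_combination h1 + 4 * π ^ 2 * ξ ^ 2 * hat r k ξ * Complex.I_sq

/-! ### Absolutely convergent Fourier expansions -/

/-- An absolutely convergent Fourier series has a continuous sum, which must agree almost everywhere
with `F` because both have the same `L²` expansion. -/
theorem ae_norm_le_tsum_fourierCoeff {F : Torus → ℂ}
    (hF : MemLp F 2 (AddCircle.haarAddCircle : Measure Torus)) {b : ℤ → ℝ} (hb : Summable b)
    (h : ∀ k, ‖fourierCoeff F k‖ ≤ b k) :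
    ∀ᵐ x ∂(AddCircle.haarAddCircle : Measure Torus), ‖F x‖ ≤ ∑' k, b k := by
  have hc : ∀ k, ‖fourierCoeff F k • (fourier k : C(Torus, ℂ))‖ ≤ b k := fun k => by
    rw [norm_smul, fourier_norm, mul_one]; exact h k
  have hs : Summable fun k => fourierCoeff F k • (fourier k : C(Torus, ℂ)) :=
    Summable.of_norm_bounded hb hc
  have h1 := (ContinuousMap.toLp 2 (AddCircle.haarAddCircle : Measure Torus) ℂ).hasSum hs.hasSum
  have h2 := hasSum_fourier_series_L2 hF.toLp
  have h3 : ContinuousMap.toLp 2 (AddCircle.haarAddCircle : Measure Torus) ℂ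
      (∑' k, fourierCoeff F k • (fourier k : C(Torus, ℂ))) = hF.toLp := by
    refine h1.unique (h2.congr_fun fun k => ?_)
    rw [map_smul, fourierCoeff_congr_ae hF.coeFn_toLp]
  have h4 := ContinuousMap.coeFn_toLp (p := 2) (𝕜 := ℂ) (AddCircle.haarAddCircle : Measure Torus)
    (∑' k, fourierCoeff F k • (fourier k : C(Torus, ℂ)))
  rw [h3] at h4
  filter_upwards [h4, hF.coeFn_toLp] with x hx hx'
  rw [← hx', hx]
  exact (ContinuousMap.norm_coe_le_norm _ x).trans (tsum_of_norm_bounded hb.hasSum hc)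

/-- The converse of slicing; unlike `ae_ae_slice` it needs measurability of the property. -/
theorem ae_of_ae_ae_slice {P : Channel → Prop} (hP : MeasurableSet {p | P p})
    (h : ∀ᵐ y : ℝ, ∀ᵐ x : Torus, P (x, y)) : ∀ᵐ p : Channel, P p := by
  have h1 : ∀ᵐ q : ℝ × Torus ∂(volume.prod volume), P (q.2, q.1) :=
    (Measure.ae_prod_iff_ae_ae (measurable_swap hP)).2 h
  exact (Measure.measurePreserving_swap (μ := (volume : Measure Torus))
      (ν := (volume : Measure ℝ))).quasiMeasurePreserving.ae h1

/-- The supremum is bounded by the sum of the `L¹` norms of the Fourier modes. -/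
theorem ae_norm_le_of_hat (f : L2) {b : ℤ → ℝ} (hb : Summable b)
    (hi : ∀ k, Integrable (hat f k)) (h : ∀ k, ∫ ξ, ‖hat f k ξ‖ ≤ b k) :
    ∀ᵐ p : Channel, ‖f p‖ ≤ ∑' k, b k := by
  have key : ∀ᵐ y : ℝ, ∀ᵐ x : Torus, ‖f (x, y)‖ ≤ ∑' k, b k := by
    have h1 : ∀ᵐ y : ℝ, ∀ k, ‖mode f k y‖ ≤ b k := ae_all_iff.2 fun k =>
      (ae_norm_le_integral_fourier (mode f k) (hi k)).mono fun y hy => hy.trans (h k)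
    filter_upwards [h1, ae_all_iff.2 (mode_ae f), ae_memLp_slice (Lp.memLp f)] with y hy h2 h3
    have := ae_norm_le_tsum_fourierCoeff (memLp_haar_of_memLp h3) hb
      (fun k => by rw [← h2 k]; exact hy k)
    filter_upwards [ae_haar_iff.1 this] with x hx
    simpa using hx
  exact ae_of_ae_ae_slice
    (measurableSet_le (Lp.stronglyMeasurable f).measurable.norm measurable_const) key


/-! ### Inverting the Laplacian -/

/-- The symbol of `Δ⁻¹` on functions with vanishing `x`-average. -/
def invLapSymbol (k : ℤ) (ξ : ℝ) : ℝ := if k = 0 then 0 else -((k : ℝ) ^ 2 + (2 * π * ξ) ^ 2)⁻¹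

theorem one_le_int_sq {k : ℤ} (hk : k ≠ 0) : (1 : ℝ) ≤ (k : ℝ) ^ 2 := by
  rw [← sq_abs]
  have : (1 : ℝ) ≤ |(k : ℝ)| := by exact_mod_cast Int.one_le_abs hk
  nlinarith

theorem abs_invLapSymbol_le_one (k : ℤ) (ξ : ℝ) : |invLapSymbol k ξ| ≤ 1 := by
  unfold invLapSymbol
  split_ifs with hk
  · simp
  · have := one_le_int_sq hk
    rw [abs_neg, abs_of_nonneg (by positivity)]
    exact inv_le_one_of_one_le₀ (by nlinarith [sq_nonneg (2 * π * ξ)])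

/-- Bound one factor `k² + η²` below by `k²` and the other by `1 + η²`; the result is summable in
`k` and integrable in `ξ`. At `k = 0` both sides vanish, since `1 / 0 = 0`. -/
theorem invLapSymbol_sq_le (k : ℤ) (ξ : ℝ) :
    invLapSymbol k ξ ^ 2 ≤ 1 / (k : ℝ) ^ 2 * (1 + (2 * π * ξ) ^ 2)⁻¹ := by
  unfold invLapSymbol
  split_ifs with hk
  · rw [zero_pow two_ne_zero]; positivity
  · have := one_le_int_sq hk
    rw [neg_sq, one_div, ← mul_inv, inv_pow]
    have h2 := sq_nonneg (2 * π * ξ)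
    gcongr
    nlinarith

theorem measurable_invLapSymbol (k : ℤ) : Measurable (invLapSymbol k) := by
  unfold invLapSymbol
  split_ifs <;> fun_prop

theorem exists_invLap (w : L2) :
    ∃ f : L2, ∀ k, ∀ᵐ ξ : ℝ, hat f k ξ = invLapSymbol k ξ * hat w k ξ :=
  exists_hat_eq_mul w measurable_invLapSymbol (fun k ξ => Or.inr (abs_invLapSymbol_le_one k ξ))
    fun k ξ => by simp [invLapSymbol]

/-- The inverse of the Laplacian on functions with vanishing `x`-average. -/
def invLap (w : L2) : L2 := (exists_invLap w).choose

theorem hat_invLap (w : L2) (k : ℤ) : ∀ᵐ ξ : ℝ, hat (invLap w) k ξ = invLapSymbol k ξ * hat w k ξ :=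
  (exists_invLap w).choose_spec k

theorem eq_invLap {f w : L2} (h : ∀ k, ∀ᵐ ξ : ℝ, hat f k ξ = invLapSymbol k ξ * hat w k ξ) :
    f = invLap w :=
  ext_hat fun k => Lp.ext (by filter_upwards [h k, hat_invLap w k] with ξ h1 h2; rw [h1, h2])

theorem invLap_add (w w' : L2) : invLap (w + w') = invLap w + invLap w' := by
  refine (eq_invLap fun k => ?_).symm
  rw [hat_add, hat_add]
  filter_upwards [hat_invLap w k, hat_invLap w' k, Lp.coeFn_add (hat w k) (hat w' k),
    Lp.coeFn_add (hat (invLap w) k) (hat (invLap w') k)] with ξ h1 h2 h3 h4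
  rw [h3, h4, Pi.add_apply, Pi.add_apply, h1, h2]; ring

theorem hat_smul (c : ℝ) (w : L2) (k : ℤ) : hat (c • w) k = c • hat w k := (hatL k).map_smul c w

theorem invLap_smul (c : ℝ) (w : L2) : invLap (c • w) = c • invLap w := by
  refine (eq_invLap fun k => ?_).symm
  rw [hat_smul, hat_smul]
  filter_upwards [hat_invLap w k, Lp.coeFn_smul c (hat w k),
    Lp.coeFn_smul c (hat (invLap w) k)] with ξ h1 h3 h4
  rw [h3, h4, Pi.smul_apply, Pi.smul_apply, h1, Complex.real_smul, Complex.real_smul]; ring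

theorem zeroXMean_invLap (w : L2) : ZeroXMean (invLap w) := by
  rw [zeroXMean_iff_hat]
  refine Lp.ext ?_
  filter_upwards [hat_invLap w 0, Lp.coeFn_zero ℂ 2 (volume : Measure ℝ)] with ξ h1 h2
  rw [h1, h2]; simp [invLapSymbol]

theorem HasWeakGrad.invLap {u ux uy : L2} (h : HasWeakGrad u ux uy) :
    HasWeakGrad (invLap u) (invLap ux) (invLap uy) := by
  refine hasWeakGrad_of_hat (fun k => ?_) fun k => ?_
  · filter_upwards [h.hat_dx k, hat_invLap u k, hat_invLap ux k] with ξ h1 h2 h3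
    rw [h3, h1, h2]; ring
  · filter_upwards [h.hat_dy k, hat_invLap u k, hat_invLap uy k] with ξ h1 h2 h3
    rw [h3, h1, h2]; ring

theorem integral_inv_one_add_sq :
    Integrable (fun ξ : ℝ => (1 + (2 * π * ξ) ^ 2)⁻¹) ∧
      ∫ ξ : ℝ, (1 + (2 * π * ξ) ^ 2)⁻¹ = 1 / 2 := by
  constructor
  · exact integrable_inv_one_add_sq.comp_mul_left' Real.two_pi_pos.ne'
  · rw [Measure.integral_comp_mul_left (fun x : ℝ => (1 + x ^ 2)⁻¹), integral_univ_inv_one_add_sq,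
      abs_of_pos (by positivity), smul_eq_mul]
    field_simp

theorem hasSum_one_div_int_sq : HasSum (fun k : ℤ => 1 / (k : ℝ) ^ 2) (π ^ 2 / 3) := by
  have h := hasSum_zeta_two
  -- The two half-line sums share the index `0`; its term is `0` by the convention `1 / 0 = 0`.
  have h1 : HasSum (fun k : ℤ => 1 / (k : ℝ) ^ 2) (π ^ 2 / 6 + π ^ 2 / 6 - 1 / ((0 : ℤ) : ℝ) ^ 2) := by
    refine HasSum.of_nat_of_neg (f := fun k : ℤ => 1 / (k : ℝ) ^ 2) ?_ ?_
    · simpa using h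
    · simpa using h
  convert! h1 using 1
  simp; ring

/-- The inverse Laplacian is bounded from `L²` to `L^∞`. -/
theorem ae_norm_invLap_le (w : L2) : ∀ᵐ p : Channel, ‖invLap w p‖ ≤ ‖w‖ := by
  rcases eq_or_ne w 0 with rfl | hw
  · have : invLap 0 = 0 := by simpa using invLap_smul 0 0
    rw [this]
    filter_upwards [Lp.coeFn_zero ℝ 2 (volume : Measure Channel)] with p hp
    rw [hp]; simp
  have hs : 0 < ‖w‖ := norm_pos_iff.2 hw
  -- Cauchy–Schwarz in the form of Young's inequality with weight `‖w‖`, which makes both terms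
  -- scale linearly in `‖w‖` after summation.
  have hle : ∀ k : ℤ, ∀ᵐ ξ : ℝ, ‖hat (invLap w) k ξ‖ ≤
      (‖w‖ * (1 / (k : ℝ) ^ 2 * (1 + (2 * π * ξ) ^ 2)⁻¹) + ‖hat w k ξ‖ ^ 2 / ‖w‖) / 2 := by
    intro k
    filter_upwards [hat_invLap w k] with ξ h1
    rw [h1, norm_mul, Complex.norm_real, Real.norm_eq_abs]
    have h2 := invLapSymbol_sq_le k ξ
    have h3 : |invLapSymbol k ξ| * ‖hat w k ξ‖ ≤
        (‖w‖ * |invLapSymbol k ξ| ^ 2 + ‖hat w k ξ‖ ^ 2 / ‖w‖) / 2 := by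
      have h4 : (‖w‖ * |invLapSymbol k ξ| ^ 2 + ‖hat w k ξ‖ ^ 2 / ‖w‖) / 2 -
          |invLapSymbol k ξ| * ‖hat w k ξ‖ =
          (‖w‖ * |invLapSymbol k ξ| - ‖hat w k ξ‖) ^ 2 / (2 * ‖w‖) := by
        field_simp; ring
      have h5 : 0 ≤ (‖w‖ * |invLapSymbol k ξ| - ‖hat w k ξ‖) ^ 2 / (2 * ‖w‖) := by positivity
      linarith
    rw [sq_abs] at h3
    refine h3.trans ?_
    gcongr
  have hi2 : ∀ k : ℤ, Integrable fun ξ => ‖hat w k ξ‖ ^ 2 := fun k =>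
    (Lp.memLp (hat w k)).integrable_norm_pow two_ne_zero
  have hi1 : ∀ k : ℤ, Integrable fun ξ : ℝ =>
      ‖w‖ * (1 / (k : ℝ) ^ 2 * (1 + (2 * π * ξ) ^ 2)⁻¹) := fun k =>
    (integral_inv_one_add_sq.1.const_mul _).const_mul _
  have hi : ∀ k : ℤ, Integrable fun ξ : ℝ =>
      (‖w‖ * (1 / (k : ℝ) ^ 2 * (1 + (2 * π * ξ) ^ 2)⁻¹) + ‖hat w k ξ‖ ^ 2 / ‖w‖) / 2 :=
    fun k => ((hi1 k).add ((hi2 k).div_const _)).div_const _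
  have hsum : HasSum (fun k : ℤ => (‖w‖ * (1 / (k : ℝ) ^ 2 * (1 / 2)) + ‖hat w k‖ ^ 2 / ‖w‖) / 2)
      ((‖w‖ * (π ^ 2 / 3 * (1 / 2)) + ‖w‖ ^ 2 / (2 * π) / ‖w‖) / 2) := by
    refine HasSum.div_const (HasSum.add ((hasSum_one_div_int_sq.mul_right _).mul_left _)
      (HasSum.div_const ?_ _)) _
    convert! (hasSum_norm_sq_hat w).div_const (2 * π) using 2 with k
    field_simp
  have hfi : ∀ k, Integrable (hat (invLap w) k) := fun k =>
    (hi k).mono' (Lp.aestronglyMeasurable _) (hle k)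
  have key := ae_norm_le_of_hat (invLap w) hsum.summable hfi fun k => by
    refine (integral_mono_ae (hfi k).norm (hi k) (hle k)).trans (le_of_eq ?_)
    rw [integral_div, integral_add (hi1 k) ((hi2 k).div_const _), integral_const_mul,
      integral_const_mul, integral_inv_one_add_sq.2, integral_div, norm_sq_eq_integral]
  filter_upwards [key] with p hp
  refine hp.trans ?_
  rw [hsum.tsum_eq]
  -- The constant is `(π²/6 + 1/(2π))/2 ≤ (10/6 + 1/6)/2 = 11/12`, hence below `1`.
  have h1 : ‖w‖ ^ 2 / (2 * π) / ‖w‖ = ‖w‖ * (1 / (2 * π)) := by field_simp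
  have h2 : 1 / (2 * π) ≤ 1 / 6 := by
    apply one_div_le_one_div_of_le <;> linarith [Real.pi_gt_three]
  have h3 : π ^ 2 ≤ 10 := by nlinarith [Real.pi_lt_d2, Real.pi_pos]
  rw [h1]
  nlinarith

theorem memLp_top_invLap (w : L2) : MemLp (invLap w) ⊤ :=
  memLp_top_of_bound (Lp.aestronglyMeasurable _) _ (ae_norm_invLap_le w)

/-- `Δ⁻¹` as an operator from `L²` to `L^∞`. -/
def invLapTop : L2 →L[ℝ] Lp ℝ ⊤ (volume : Measure Channel) :=
  LinearMap.mkContinuous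
    { toFun := fun w => (memLp_top_invLap w).toLp
      map_add' := fun w w' => by
        rw [← MemLp.toLp_add]
        refine MemLp.toLp_congr _ _ ?_
        rw [invLap_add]
        exact Lp.coeFn_add _ _
      map_smul' := fun c w => by
        rw [RingHom.id_apply, ← MemLp.toLp_const_smul]
        refine MemLp.toLp_congr _ _ ?_
        rw [invLap_smul]
        exact Lp.coeFn_smul _ _ } 1 fun w => by
    rw [one_mul]
    change ‖(memLp_top_invLap w).toLp‖ ≤ _
    rw [Lp.norm_toLp, eLpNorm_exponent_top]
    exact ENNReal.toReal_le_of_le_ofReal (norm_nonneg _)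
      (eLpNormEssSup_le_of_ae_bound (ae_norm_invLap_le w))

theorem invLapTop_ae (w : L2) : invLapTop w =ᵐ[volume] invLap w :=
  (memLp_top_invLap w).coeFn_toLp

theorem norm_invLapTop_le (w : L2) : ‖invLapTop w‖ ≤ ‖w‖ := by
  have h := (invLapTop.le_of_opNorm_le (LinearMap.mkContinuous_norm_le _ zero_le_one _) w)
  rwa [one_mul] at h

/-! ### The velocity field -/

theorem ext_of_hasWeakGrad {u ux uy ux' uy' : L2} (h : HasWeakGrad u ux uy)
    (h' : HasWeakGrad u ux' uy') : ux = ux' ∧ uy = uy' :=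
  ⟨ext_hat fun k => Lp.ext (by
      filter_upwards [h.hat_dx k, h'.hat_dx k] with ξ h1 h2; rw [h1, h2]),
    ext_hat fun k => Lp.ext (by
      filter_upwards [h.hat_dy k, h'.hat_dy k] with ξ h1 h2; rw [h1, h2])⟩

/-- Green's identity on the Fourier side: `(iκ)` and `(iη)` paired with themselves give `κ² + η²`.
-/
theorem inner_add_inner_eq_neg {a b a₁ a₂ b₁ b₂ c : LineL2} {κ η : ℝ → ℝ}
    (h1 : ∀ᵐ ξ : ℝ, a₁ ξ = Complex.I * (κ ξ : ℂ) * a ξ)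
    (h2 : ∀ᵐ ξ : ℝ, a₂ ξ = Complex.I * (η ξ : ℂ) * a ξ)
    (h3 : ∀ᵐ ξ : ℝ, b₁ ξ = Complex.I * (κ ξ : ℂ) * b ξ)
    (h4 : ∀ᵐ ξ : ℝ, b₂ ξ = Complex.I * (η ξ : ℂ) * b ξ)
    (hc : ∀ᵐ ξ : ℝ, c ξ = (-(κ ξ ^ 2 + η ξ ^ 2) : ℝ) * a ξ) :
    ⟪a₁, b₁⟫_ℝ + ⟪a₂, b₂⟫_ℝ = -⟪c, b⟫_ℝ := by
  rw [L2.inner_def, L2.inner_def, L2.inner_def, ← integral_neg,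
    ← integral_add (L2.integrable_inner _ _) (L2.integrable_inner _ _)]
  refine integral_congr_ae ?_
  filter_upwards [h1, h2, h3, h4, hc] with ξ e1 e2 e3 e4 e5
  rw [e1, e2, e3, e4, e5]
  simp only [Complex.inner, map_mul, Complex.conj_I, Complex.conj_ofReal, Complex.mul_re,
    Complex.mul_im, Complex.I_re, Complex.I_im, Complex.ofReal_re, Complex.ofReal_im,
    Complex.conj_re, Complex.conj_im, Complex.neg_re, Complex.neg_im]
  ring

/-- Since `Δ⁻¹` commutes with derivatives, the velocity is `Δ⁻¹` applied to the rotated gradient of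
`u`; this form is the one for which the `L^∞` bound applies. -/
theorem isVelocity_invLap {u ux uy : L2} (h : HasWeakGrad u ux uy) (h0 : ZeroXMean u) :
    IsVelocity u (-invLap uy) (invLap ux) := by
  refine ⟨invLap u, invLap ux, invLap uy, h.invLap, zeroXMean_invLap u, fun ψ hψ => ?_, rfl, rfl⟩
  have e : ∫ p, (invLap ux p * dx ψ p + invLap uy p * dy ψ p) =
      ⟪invLap ux, hψ.dx.toL2⟫_ℝ + ⟪invLap uy, hψ.dy.toL2⟫_ℝ := by
    rw [inner_toL2, inner_toL2, integral_add (integrable_mul_test _ hψ.dx)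
      (integrable_mul_test _ hψ.dy)]
  rw [e, ← inner_toL2 u hψ]
  refine ((hasSum_inner_hat _ _).add (hasSum_inner_hat _ _)).unique
    ((hasSum_inner_hat u hψ.toL2).neg.congr_fun fun k => ?_)
  rw [← mul_add, ← mul_neg]
  congr 1
  refine (inner_add_inner_eq_neg (κ := fun _ => k) (η := fun ξ => 2 * π * ξ)
    ?_ (h.invLap.hat_dy k) ?_ (hψ.hasWeakGrad.hat_dy k) ?_)
  · exact_mod_cast h.invLap.hat_dx k
  · exact_mod_cast hψ.hasWeakGrad.hat_dx k
  · by_cases hk : k = 0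
    · subst hk
      have h1 := (zeroXMean_iff_hat u).1 h0
      have h2 := (zeroXMean_iff_hat _).1 (zeroXMean_invLap u)
      rw [h1, h2]
      filter_upwards [Lp.coeFn_zero ℂ 2 (volume : Measure ℝ)] with ξ hξ
      rw [hξ]; simp
    · filter_upwards [hat_invLap u k] with ξ hξ
      have h1 := one_le_int_sq hk
      have h2 : (k : ℝ) ^ 2 + (2 * π * ξ) ^ 2 ≠ 0 := by positivity
      rw [hξ, ← mul_assoc, ← Complex.ofReal_mul, invLapSymbol, if_neg hk, neg_mul_neg,
        mul_inv_cancel₀ h2, Complex.ofReal_one, one_mul]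

/-- The Poisson equation fixes the stream function on every mode except `k = 0`, where the vanishing
`x`-average does. -/
theorem IsVelocity.eq_invLap {u ux uy v₁ v₂ : L2} (hv : IsVelocity u v₁ v₂)
    (h : HasWeakGrad u ux uy) : v₁ = -invLap uy ∧ v₂ = Couette.invLap ux := by
  obtain ⟨φ, φx, φy, hφ, h0, hw, rfl, rfl⟩ := hv
  have h1 : ∀ k, ∀ᵐ ξ : ℝ, hat u k ξ = (-((k : ℝ) ^ 2 + (2 * π * ξ) ^ 2) : ℝ) * hat φ k ξ := by
    refine hat_of_weak_lap fun ψ hψ => ?_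
    have e1 := hφ.weak_dx _ hψ.dx
    have e2 := hφ.weak_dy _ hψ.dy
    have e3 := hw ψ hψ
    rw [integral_add (integrable_mul_test _ hψ.dx) (integrable_mul_test _ hψ.dy)] at e3
    simp only [lap, mul_add]
    rw [integral_add (integrable_mul_test _ hψ.dx.dx) (integrable_mul_test _ hψ.dy.dy)]
    linarith
  have h2 : φ = Couette.invLap u := by
    refine Couette.eq_invLap fun k => ?_
    by_cases hk : k = 0
    · subst hk
      rw [(zeroXMean_iff_hat φ).1 h0]
      filter_upwards [Lp.coeFn_zero ℂ 2 (volume : Measure ℝ)] with ξ hξ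
      rw [hξ]; simp [invLapSymbol]
    · filter_upwards [h1 k] with ξ hξ
      have h1 := one_le_int_sq hk
      have h2 : (k : ℝ) ^ 2 + (2 * π * ξ) ^ 2 ≠ 0 := by positivity
      rw [hξ, ← mul_assoc, ← Complex.ofReal_mul, invLapSymbol, if_neg hk, neg_mul_neg,
        inv_mul_cancel₀ h2, Complex.ofReal_one, one_mul]
  subst h2
  obtain ⟨e1, e2⟩ := ext_of_hasWeakGrad hφ h.invLap
  exact ⟨by rw [e2], e1⟩

end

section

/-! ### The transport term -/

/-- Multiplication of a bounded and a square integrable function. -/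
def mulTop : Lp ℝ ⊤ (volume : Measure Channel) →L[ℝ] L2 →L[ℝ] L2 :=
  (ContinuousLinearMap.mul ℝ ℝ).holderL volume ⊤ 2 2

theorem mulTop_ae (a : Lp ℝ ⊤ (volume : Measure Channel)) (b : L2) :
    mulTop a b =ᵐ[volume] fun p => a p * b p :=
  (ContinuousLinearMap.mul ℝ ℝ).coeFn_holder a b

theorem norm_mulTop_le (a : Lp ℝ ⊤ (volume : Measure Channel)) (b : L2) :
    ‖mulTop a b‖ ≤ ‖a‖ * ‖b‖ := by
  have h := (ContinuousLinearMap.mul ℝ ℝ).norm_holder_apply_apply_le (r := 2) a b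
  have h1 : ‖ContinuousLinearMap.mul ℝ ℝ‖ ≤ 1 := ContinuousLinearMap.opNorm_mul_le ℝ ℝ
  refine h.trans ?_
  rw [mul_assoc]
  exact mul_le_of_le_one_left (by positivity) h1

/-- The transport term `v · ∇w`, `v = ∇^⊥Δ⁻¹z`, as a bilinear map in triples `(z, ∇z)`, `(w, ∇w)`. -/
def transport : Triple →L[ℝ] Triple →L[ℝ] L2 :=
  mulTop.bilinearComp (invLapTop ∘L PiLp.proj 2 (fun _ : Fin 3 => L2) 1)
      (PiLp.proj 2 (fun _ : Fin 3 => L2) 2) -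
    mulTop.bilinearComp (invLapTop ∘L PiLp.proj 2 (fun _ : Fin 3 => L2) 2)
      (PiLp.proj 2 (fun _ : Fin 3 => L2) 1)

theorem transport_apply (z w : Triple) : transport z w =
    mulTop (invLapTop (z 1)) (w 2) - mulTop (invLapTop (z 2)) (w 1) := rfl

theorem transport_ae (z w : Triple) : transport z w =ᵐ[volume] fun p =>
    (-invLap (z 2) : L2) p * w 1 p + invLap (z 1) p * w 2 p := by
  rw [transport_apply]
  filter_upwards [Lp.coeFn_sub (mulTop (invLapTop (z 1)) (w 2)) (mulTop (invLapTop (z 2)) (w 1)),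
    mulTop_ae (invLapTop (z 1)) (w 2), mulTop_ae (invLapTop (z 2)) (w 1), invLapTop_ae (z 1),
    invLapTop_ae (z 2), Lp.coeFn_neg (invLap (z 2))] with p h1 h2 h3 h4 h5 h6
  rw [h1, Pi.sub_apply, h2, h3, h4, h5, h6, Pi.neg_apply]
  ring

/-- Each velocity component is bounded in `L^∞` by one partial derivative of `z`; Cauchy–Schwarz on
the two products gives constant `1`. -/
theorem norm_transport_le (z w : Triple) : ‖transport z w‖ ≤ ‖z‖ * ‖w‖ := by
  have h1 : ‖transport z w‖ ≤ ‖z 1‖ * ‖w 2‖ + ‖z 2‖ * ‖w 1‖ := by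
    rw [transport_apply]
    refine (norm_sub_le _ _).trans (add_le_add ?_ ?_) <;>
    exact (norm_mulTop_le _ _).trans
      (mul_le_mul_of_nonneg_right (norm_invLapTop_le _) (norm_nonneg _))
  refine h1.trans (abs_le_of_sq_le_sq' ?_ (by positivity)).2
  rw [mul_pow, norm_sq_triple, norm_sq_triple]
  nlinarith [sq_nonneg (‖z 1‖ * ‖w 1‖ - ‖z 2‖ * ‖w 2‖), sq_nonneg (‖z 0‖ * ‖w 0‖),
    sq_nonneg (‖z 0‖ * ‖w 1‖), sq_nonneg (‖z 0‖ * ‖w 2‖), sq_nonneg (‖z 1‖ * ‖w 0‖),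
    sq_nonneg (‖z 2‖ * ‖w 0‖)]

/-! ### Density of test functions -/

theorem isClosed_hasWeakGrad : IsClosed {w : Triple | HasWeakGrad (w 0) (w 1) (w 2)} := by
  have c : ∀ i : Fin 3, Continuous fun w : Triple => w i := fun i => by fun_prop
  simp only [hasWeakGrad_iff_inner, ofPred_and, ofPred_forall]
  refine isClosed_iInter fun ψ => isClosed_iInter fun hψ => IsClosed.inter ?_ ?_
  · exact isClosed_eq ((c 0).inner continuous_const) ((c 1).inner continuous_const).neg
  · exact isClosed_eq ((c 0).inner continuous_const) ((c 2).inner continuous_const).neg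

/-- A test function together with its gradient. -/
def testTriple : testSpace →ₗ[ℝ] Triple := tripleMap testId testDx testDy

/-- Orthogonality in `H¹` to all test functions means `(1 - Δ) r = 0` weakly, and the symbol `1 + k²
+ η²` never vanishes. -/
theorem hasWeakGrad_eq_zero_of_inner {r : Triple} (hr : HasWeakGrad (r 0) (r 1) (r 2))
    (h : ∀ ψ : testSpace, ⟪r, testTriple ψ⟫_ℝ = 0) : r = 0 := by
  have h1 : ∀ ψ : Channel → ℝ, IsTest ψ → ∫ p, r 0 p * lap ψ p = ∫ p, r 0 p * ψ p := by
    intro ψ hψ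
    have e := h ⟨ψ, hψ⟩
    rw [inner_triple] at e
    change ⟪r 0, hψ.toL2⟫_ℝ + ⟪r 1, hψ.dx.toL2⟫_ℝ + ⟪r 2, hψ.dy.toL2⟫_ℝ = 0 at e
    rw [inner_toL2, inner_toL2, inner_toL2] at e
    have e1 := hr.weak_dx _ hψ.dx
    have e2 := hr.weak_dy _ hψ.dy
    simp only [lap, mul_add]
    rw [integral_add (integrable_mul_test _ hψ.dx.dx) (integrable_mul_test _ hψ.dy.dy)]
    linarith
  have h0 : r 0 = 0 := ext_hat fun k => Lp.ext <| by
    have hz : hat (0 : L2) k = 0 := (hatL k).map_zero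
    rw [hz]
    filter_upwards [hat_of_weak_lap h1 k, Lp.coeFn_zero ℂ 2 (volume : Measure ℝ)] with ξ e1 e2
    rw [e2, Pi.zero_apply]
    have e3 : ((1 + (k : ℝ) ^ 2 + (2 * π * ξ) ^ 2 : ℝ) : ℂ) * hat (r 0) k ξ = 0 := by
      push_cast at e1 ⊢
      linear_combination e1
    refine (mul_eq_zero.1 e3).resolve_left ?_
    rw [Complex.ofReal_eq_zero]
    have : (0 : ℝ) < 1 + (k : ℝ) ^ 2 + (2 * π * ξ) ^ 2 := by positivity
    exact this.ne'
  rw [h0] at hr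
  obtain ⟨e1, e2⟩ := ext_of_hasWeakGrad hr hasWeakGrad_zero
  exact triple_ext h0 e1 e2

/-- Density of test functions in `H¹`, without mollification: the component orthogonal to their
closure is zero by the previous lemma. -/
theorem mem_closure_testTriple {w : Triple} (hw : HasWeakGrad (w 0) (w 1) (w 2)) :
    w ∈ closure (range testTriple) := by
  let M : Submodule ℝ Triple := (LinearMap.range testTriple).topologicalClosure
  have : CompleteSpace M := (Submodule.isClosed_topologicalClosure _).completeSpace_coe
  have hM : ∀ z ∈ M, HasWeakGrad (z 0) (z 1) (z 2) := fun z hz => by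
    refine isClosed_hasWeakGrad.closure_subset_iff.2 ?_ hz
    rintro _ ⟨ψ, rfl⟩
    exact IsTest.hasWeakGrad ψ.2
  let z : M := M.orthogonalProjectionOnto w
  have h0 : w - z = 0 := by
    refine hasWeakGrad_eq_zero_of_inner (hw.sub (hM z z.2)) fun ψ => ?_
    exact M.starProjection_inner_eq_zero w _
      (Submodule.le_topologicalClosure _ (LinearMap.mem_range_self testTriple ψ))
  rw [sub_eq_zero.1 h0]
  exact z.2

/-- `ψ∇ψ = ½∇(ψ²)`, and a perpendicular gradient is orthogonal to gradients. -/
theorem inner_transport_testTriple {z : Triple} (hz : HasWeakGrad (z 0) (z 1) (z 2))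
    (ψ : testSpace) : ⟪transport z (testTriple ψ), testTriple ψ 0⟫_ℝ = 0 := by
  have h : IsTest (ψ : Channel → ℝ) := ψ.2
  have hh : IsTest (fun p => (ψ : Channel → ℝ) p * (ψ : Channel → ℝ) p) := h.mul h
  have hφ := hz.invLap
  change ⟪transport z (testTriple ψ), h.toL2⟫_ℝ = 0
  rw [inner_toL2]
  have e : ∫ p, transport z (testTriple ψ) p * (ψ : Channel → ℝ) p =
      ∫ p, (1 / 2) * (invLap (z 1) p * dy (fun p => (ψ : Channel → ℝ) p * (ψ : Channel → ℝ) p) p -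
        invLap (z 2) p * dx (fun p => (ψ : Channel → ℝ) p * (ψ : Channel → ℝ) p) p) := by
    refine integral_congr_ae ?_
    filter_upwards [transport_ae z (testTriple ψ), h.dx.toL2_ae, h.dy.toL2_ae,
      Lp.coeFn_neg (invLap (z 2))] with p h1 h2 h3 h4
    rw [h1, h4, dx_mul h h, dy_mul h h]
    change (_ * h.dx.toL2 p + _ * h.dy.toL2 p) * _ = _
    rw [h2, h3, Pi.neg_apply]
    ring
  -- Move both derivatives onto `ψ²`; the two mixed derivatives of `ψ²` coincide and cancel.
  have e1 := hφ.weak_dx _ hh.dy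
  have e2 := hφ.weak_dy _ hh.dx
  rw [dx_dy_comm hh] at e1
  rw [e, integral_const_mul, integral_sub (integrable_mul_test _ hh.dy)
    (integrable_mul_test _ hh.dx)]
  linarith

/-- The transport term is antisymmetric. -/
theorem inner_transport_self {z w : Triple} (hz : HasWeakGrad (z 0) (z 1) (z 2))
    (hw : HasWeakGrad (w 0) (w 1) (w 2)) : ⟪transport z w, w 0⟫_ℝ = 0 := by
  -- Both factors are continuous in the `H¹` norm because `v` is bounded, so the identity passes
  -- from test functions to the closure.
  have hc : IsClosed {w : Triple | ⟪transport z w, w 0⟫_ℝ = 0} :=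
    isClosed_eq ((transport z).continuous.inner (by fun_prop)) continuous_const
  refine hc.closure_subset_iff.2 ?_ (mem_closure_testTriple hw)
  rintro _ ⟨ψ, rfl⟩
  exact inner_transport_testTriple hz ψ

/-! ### The advection term -/

theorem projNonzero_congr {h h' : Channel → ℝ} (e : h =ᵐ[volume] h') :
    projNonzero h =ᵐ[volume] projNonzero h' := by
  have h1 : ∀ᵐ y : ℝ, ∫ x : Torus, h (x, y) = ∫ x : Torus, h' (x, y) :=
    (ae_ae_slice e).mono fun y hy => integral_congr_ae hy
  have h2 : ∀ᵐ p : Channel, ∫ x : Torus, h (x, p.2) = ∫ x : Torus, h' (x, p.2) :=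
    Measure.quasiMeasurePreserving_snd.ae h1
  filter_upwards [e, h2] with p h3 h4
  rw [projNonzero, projNonzero, h3, h4]

theorem projL_transport_ae (z w : Triple) : projL (transport z w) =ᵐ[volume]
    advection (-invLap (z 2)) (invLap (z 1)) (w 1) (w 2) :=
  (projL_ae _).trans (projNonzero_congr (transport_ae z w))

end

section

/-! ### The nonlinear problem -/

variable {ν : ℝ}

/-- Split so that the second term has the form `v · ∇` of the difference, the one killed by
antisymmetry against that difference. -/
theorem transport_sub_transport (z w : Triple) :
    transport z z - transport w w = transport (z - w) w + transport z (z - w) := by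
  rw [map_sub, map_sub, _root_.sub_apply]
  abel

theorem norm_transport_sub_le {z w : Triple} {r : ℝ} (hz : ‖z‖ ≤ r) (hw : ‖w‖ ≤ r) :
    ‖transport z z - transport w w‖ ≤ 2 * r * ‖z - w‖ := by
  rw [transport_sub_transport]
  refine (norm_add_le _ _).trans ?_
  have h1 := norm_transport_le (z - w) w
  have h2 := norm_transport_le z (z - w)
  have h3 := mul_le_mul_of_nonneg_left hw (norm_nonneg (z - w))
  have h4 := mul_le_mul_of_nonneg_right hz (norm_nonneg (z - w))
  linarith

/-- A small stationary solution, obtained as a fixed point. -/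
theorem exists_small_stationary (hν : 0 < ν) {f : L2} (hf : ZeroXMean f)
    (hs : ‖f‖ ≤ ν ^ 2 / 40) : ∃ g : gradSpace, ‖g‖ ≤ ν / 10 ∧
      IsStationary ν (f - projL (transport (g : Triple) (g : Triple))) (g : Triple) := by
  obtain ⟨S, hS, h⟩ := exists_stationary_operator hν
  let Φ : gradSpace → gradSpace := fun z => S (f - projL (transport (z : Triple) (z : Triple)))
  let B : Set gradSpace := Metric.closedBall 0 (ν / 10)
  have hB : ∀ {z : gradSpace}, z ∈ B ↔ ‖(z : Triple)‖ ≤ ν / 10 := mem_closedBall_zero_iff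
  have hm : MapsTo Φ B B := fun z hz => by
    have hz' := hB.1 hz
    refine mem_closedBall_zero_iff.2 ((hS _).trans ?_)
    have h1 : ‖f - projL (transport (z : Triple) (z : Triple))‖ ≤ ν ^ 2 / 40 + ν / 10 * (ν / 10) := by
      refine (norm_sub_le _ _).trans (add_le_add hs ((norm_projL_le _).trans ?_))
      refine (norm_transport_le _ _).trans ?_
      gcongr
    refine (mul_le_mul_of_nonneg_left h1 (by positivity)).trans ?_
    -- With `‖f‖ ≤ ν²/40` and radius `ν/10` the image has norm at most `7ν/100`, inside the ball.
    have e : 2 / ν * (ν ^ 2 / 40 + ν / 10 * (ν / 10)) = 7 / 100 * ν := by field_simp; norm_num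
    rw [e]
    linarith
  -- The factor is `2/ν` for the solution operator times `2 · ν/10` for the quadratic term.
  have hc : ContractingWith (2 / 5) (hm.restrict Φ B B) := by
    refine ⟨by rw [div_lt_one (by norm_num)]; norm_num, LipschitzWith.of_dist_le_mul fun z w => ?_⟩
    have e : Φ z - Φ w = S (-projL (transport (z : Triple) (z : Triple) -
        transport (w : Triple) (w : Triple))) := by
      rw [← map_sub, map_sub projL]; congr 1; abel
    change dist (Φ z) (Φ w) ≤ _
    rw [dist_eq_norm, e]
    refine (hS _).trans ?_
    rw [norm_neg]
    have h1 := (norm_projL_le _).trans (norm_transport_sub_le (hB.1 z.2) (hB.1 w.2))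
    refine (mul_le_mul_of_nonneg_left h1 (by positivity)).trans (le_of_eq ?_)
    have e1 : dist z w = ‖((z : gradSpace) : Triple) - ((w : gradSpace) : Triple)‖ := by
      rw [Subtype.dist_eq, Subtype.dist_eq, dist_eq_norm]
    rw [e1]
    push_cast
    field_simp
    ring
  obtain ⟨g, hg, hfix, -⟩ := hc.exists_fixedPoint' Metric.isClosed_closedBall.isComplete hm
    (x := 0) (Metric.mem_closedBall_self (by positivity)) (edist_ne_top _ _)
  refine ⟨g, hB.1 hg, ?_⟩
  have := h (f - projL (transport (g : Triple) (g : Triple)))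
    (zeroXMean_sub hf (zeroXMean_projL _))
  rwa [show S (f - projL (transport (g : Triple) (g : Triple))) = g from hfix] at this

theorem IsStationary.isNonlinearStationary {f : L2} {g : Triple} (hg : g ∈ gradSpace)
    (h : IsStationary ν (f - projL (transport g g)) g) : IsNonlinearStationary ν f (g 0) := by
  refine ⟨hg.2, g 1, g 2, _, _, hg.1, isVelocity_invLap hg.1 hg.2, fun ψ hψ => ?_⟩
  have e := h.weak hg.1 hψ
  have e1 : ∫ p, (f - projL (transport g g) : L2) p * ψ p =
      (∫ p, f p * ψ p) - ∫ p, projL (transport g g) p * ψ p := by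
    rw [← inner_toL2 _ hψ, ← inner_toL2 _ hψ, ← inner_toL2 _ hψ, inner_sub_left]
  have e2 : ∫ p, (-(g 0 p * (p.2 * dx ψ p)) + ν * (g 1 p * dx ψ p + g 2 p * dy ψ p)
        + advection (-invLap (g 2)) (invLap (g 1)) (g 1) (g 2) p * ψ p) =
      ∫ p, ((-(g 0 p * (p.2 * dx ψ p)) + ν * (g 1 p * dx ψ p + g 2 p * dy ψ p))
        + projL (transport g g) p * ψ p) := by
    refine integral_congr_ae ?_
    filter_upwards [projL_transport_ae g g] with p hp
    rw [hp]
  have i0 : Integrable (fun p => -(g 0 p * (p.2 * dx ψ p))) :=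
    (integrable_mul_test (g 0) hψ.dx.snd_mul).neg
  have i1 : Integrable (fun p => ν * (g 1 p * dx ψ p + g 2 p * dy ψ p)) :=
    ((integrable_mul_test (g 1) hψ.dx).add (integrable_mul_test (g 2) hψ.dy)).const_mul ν
  have i2 : Integrable (fun p => -(g 0 p * (p.2 * dx ψ p)) +
      ν * (g 1 p * dx ψ p + g 2 p * dy ψ p)) := i0.add i1
  rw [e2, integral_add i2 (integrable_mul_test _ hψ)]
  linarith

theorem IsWeakSolution.intervalIntegrable_inner {F u : ℝ → L2} (h : IsWeakSolution ν F u) {T : ℝ}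
    (hT : 0 ≤ T) : IntervalIntegrable (fun r => ⟪u r, F r⟫_ℝ) volume 0 T := by
  refine (h.intervalIntegrable_norm_mul_norm hT).mono_fun' ?_
    (Eventually.of_forall fun r => abs_real_inner_le_norm _ _)
  have mu : AEStronglyMeasurable u (volume.restrict (Ioc 0 T)) :=
    (h.continuousOn.mono fun r hr => hr.1.le).aestronglyMeasurable measurableSet_Ioc
  rw [uIoc_of_le hT]
  exact mu.inner (h.integrable T hT).1.1

theorem continuous_triple : Continuous fun q : L2 × L2 × L2 => triple q.1 q.2.1 q.2.2 := by
  refine (PiLp.continuous_toLp 2 _).comp (continuous_pi fun i => ?_)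
  fin_cases i
  · exact continuous_fst
  · exact continuous_fst.comp continuous_snd
  · exact continuous_snd.comp continuous_snd

theorem continuous_projL_transport_self : Continuous fun z : Triple => projL (transport z z) :=
  projL.continuous.comp (transport.continuous.clm_apply continuous_id)

theorem aestronglyMeasurable_comp_three {α E G : Type*} [MeasurableSpace α] {μ : Measure α}
    [TopologicalSpace E] [TopologicalSpace G] {Q : E × E × E → G} (hQ : Continuous Q)
    {a b c : α → E} (ha : AEStronglyMeasurable a μ) (hb : AEStronglyMeasurable b μ)
    (hc : AEStronglyMeasurable c μ) : AEStronglyMeasurable (fun s => Q (a s, b s, c s)) μ :=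
  hQ.comp_aestronglyMeasurable (ha.prodMk (hb.prodMk hc))

/-- The nonlinearity is bounded by the squared `H¹` norm, so it is only `L¹` in time; this is why
forces in `IsWeakSolution` are required to be no better. -/
theorem intervalIntegrable_projL_transport {T : ℝ} (hT : 0 ≤ T) {u ux uy : ℝ → L2}
    (hu : ContinuousOn u (Ici 0)) (hx : MemLp ux 2 (volume.restrict (Icc 0 T)))
    (hy : MemLp uy 2 (volume.restrict (Icc 0 T))) :
    IntervalIntegrable (fun s => projL (transport (triple (u s) (ux s) (uy s))
      (triple (u s) (ux s) (uy s)))) volume 0 T := by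
  have i0 : IntervalIntegrable (fun s => ‖u s‖ ^ 2) volume 0 T :=
    intervalIntegrable_of_continuousOn_Ici (hu.norm.pow 2) le_rfl hT
  have hi := (i0.add (MemLp.intervalIntegrable_norm_sq hT hx)).add
    (MemLp.intervalIntegrable_norm_sq hT hy)
  refine hi.mono_fun' ?_ (Eventually.of_forall fun s => ?_)
  · rw [uIoc_of_le hT]
    have mu : AEStronglyMeasurable u (volume.restrict (Ioc 0 T)) :=
      (hu.mono fun r hr => hr.1.le).aestronglyMeasurable measurableSet_Ioc
    have hQ : Continuous fun q : L2 × L2 × L2 =>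
        projL (transport (triple q.1 q.2.1 q.2.2) (triple q.1 q.2.1 q.2.2)) :=
      continuous_projL_transport_self.comp continuous_triple
    exact aestronglyMeasurable_comp_three hQ mu (hx.1.mono_set Ioc_subset_Icc_self)
      (hy.1.mono_set Ioc_subset_Icc_self)
  · refine (norm_projL_le _).trans ((norm_transport_le _ _).trans (le_of_eq ?_))
    rw [← sq, norm_sq_triple]
    rfl

/-- With `w = z - g`, antisymmetry leaves only the stretching of `g` by the velocity of `w`, at most
`(ν/10)‖w‖²`. Poincaré gives `‖w‖² ≤ 2‖∂ₓw‖² + ‖∂_y w‖²`, so dissipation absorbs it and still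
controls `ν‖w‖²` in `L²`. -/
theorem inner_perturbation_le {g z : Triple} (hν : 0 < ν) (hg : g ∈ gradSpace) (hz : z ∈ gradSpace)
    (hgn : ‖g‖ ≤ ν / 10) :
    -(2 * ν) * (‖(z - g) 1‖ ^ 2 + ‖(z - g) 2‖ ^ 2) +
      2 * ⟪(z - g) 0, projL (transport g g) - projL (transport z z)⟫_ℝ ≤ -ν * ‖(z - g) 0‖ ^ 2 := by
  have hw : z - g ∈ gradSpace := gradSpace.sub_mem hz hg
  set w := z - g with hwdef
  have hp := pow_le_pow_left₀ (norm_nonneg _) (hw.1.norm_le hw.2) 2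
  have e : ⟪w 0, projL (transport g g) - projL (transport z z)⟫_ℝ = -⟪transport w g, w 0⟫_ℝ := by
    rw [← neg_sub, ← map_sub, transport_sub_transport, ← hwdef, inner_neg_right, real_inner_comm,
      inner_projL_of_zeroXMean _ hw.2, inner_add_left, inner_transport_self hz.1 hw.1, add_zero]
  have h1 : -⟪transport w g, w 0⟫_ℝ ≤ ν / 10 * ‖w‖ ^ 2 := by
    have h2 := (abs_le.1 (abs_real_inner_le_norm (transport w g) (w 0))).1
    have h3 : ‖w 0‖ ≤ ‖w‖ := PiLp.norm_apply_le w 0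
    have h4 : ‖transport w g‖ * ‖w 0‖ ≤ (‖w‖ * (ν / 10)) * ‖w‖ := by
      gcongr
      exact (norm_transport_le w g).trans (by gcongr)
    nlinarith
  rw [e]
  rw [norm_sq_triple] at h1
  nlinarith [sq_nonneg ‖w 2‖, mul_nonneg hν.le (sq_nonneg ‖w 2‖),
    mul_le_mul_of_nonneg_left hp hν.le]

/-- The nonlinearity is treated as a force, the stationary equation is subtracted, and the energy
identity of the difference is closed by `inner_perturbation_le` and Gronwall. -/
theorem IsNonlinearSolution.norm_sub_le (hν : 0 < ν) {f ω₀ : L2} {u : ℝ → L2}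
    (h : IsNonlinearSolution ν f ω₀ u) {g : Triple} (hg : g ∈ gradSpace) (hgn : ‖g‖ ≤ ν / 10)
    (hs : IsStationary ν (f - projL (transport g g)) g) {t : ℝ} (ht : 0 ≤ t) :
    ‖u t - g 0‖ ≤ Real.exp (-(ν / 2) * t) * ‖ω₀ - g 0‖ := by
  obtain ⟨ux, uy, v₁, v₂, hm, hgrad, hv, hw⟩ := h.weak
  let z : ℝ → Triple := fun s => triple (u s) (ux s) (uy s)
  have hI : ∀ T : ℝ, 0 ≤ T → IntervalIntegrable (fun s => projL (transport (z s) (z s))) volume 0 T :=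
    fun T hT => intervalIntegrable_projL_transport hT h.continuousOn (hm T).1 (hm T).2
  have hsol : IsWeakSolution ν (fun s => f - projL (transport (z s) (z s))) u := by
    refine ⟨h.continuousOn, fun T hT => intervalIntegrable_const.sub (hI T hT),
      fun T hT ψ hψ => ?_⟩
    rw [h.initial, hw T hT ψ hψ]
    refine intervalIntegral.integral_congr_ae ?_
    rw [uIoc_of_le hT]
    filter_upwards [(ae_restrict_iff' measurableSet_Ici).1 hgrad] with s hs1 hs2
    have hs0 : (0 : ℝ) ≤ s := hs2.1.le
    -- The velocity is identified only at times when the weak gradient exists; the exceptional null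
    -- set does not affect the time integral.
    obtain ⟨e1, e2⟩ := (hv s hs0).eq_invLap (hs1 hs0)
    congr 1
    refine integral_congr_ae ?_
    filter_upwards [projL_transport_ae (z s) (z s),
      Lp.coeFn_sub f (projL (transport (z s) (z s)))] with p h1 h2
    rw [h2, Pi.sub_apply, h1, e1, e2]
    rfl
  have hd := hsol.sub_stationary hg.1 hs
  have hx : ∀ T : ℝ, MemLp (fun s => ux s - g 1) 2 (volume.restrict (Icc 0 T)) := fun T =>
    (hm T).1.sub (memLp_const _)
  have hy : ∀ T : ℝ, MemLp (fun s => uy s - g 2) 2 (volume.restrict (Icc 0 T)) := fun T =>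
    (hm T).2.sub (memLp_const _)
  have hgr : ∀ᵐ s ∂(volume.restrict (Ici (0 : ℝ))),
      HasWeakGrad (u s - g 0) (ux s - g 1) (uy s - g 2) := hgrad.mono fun s hs => hs.sub hg.1
  have key := le_exp_of_integral_le (φ := fun s => ‖u s - g 0‖ ^ 2) (c := ν)
    (hd.continuousOn.norm.pow 2) ?_ (fun T hT => hd.energy hx hy hgr hT) ?_ ht
  · rw [← h.initial]
    refine (pow_le_pow_iff_left₀ (norm_nonneg _) (by positivity) two_ne_zero).1 ?_
    -- The squared norm decays at rate `ν`, the norm itself at half of it.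
    have e : Real.exp (-(ν / 2) * t) ^ 2 = Real.exp (-ν * t) := by
      rw [← Real.exp_nat_mul]; congr 1; push_cast; ring
    rw [mul_pow, e]
    exact key.trans_eq (mul_comm _ _)
  · exact fun T hT => (((MemLp.intervalIntegrable_norm_sq hT (hx T)).add
      (MemLp.intervalIntegrable_norm_sq hT (hy T))).const_mul _).add
      ((hd.intervalIntegrable_inner hT).const_mul _)
  · filter_upwards [hgrad, ae_restrict_mem measurableSet_Ici] with s hs1 hs2
    have hz : z s ∈ gradSpace := ⟨hs1, h.zero_mean s hs2⟩
    have := inner_perturbation_le hν hg hz hgn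
    convert! this using 4
    abel

theorem exists_nonlinear_stationary (hν : 0 < ν) {f : L2} (hf : ZeroXMean f)
    (hs : ‖f‖ ≤ ν ^ 2 / 40) : ∃ g : L2, IsNonlinearStationary ν f g ∧
      ∀ (ω₀ : L2) (u : ℝ → L2), IsNonlinearSolution ν f ω₀ u →
        ∀ t : ℝ, 0 ≤ t → ‖u t - g‖ ≤ Real.exp (-(ν / 2) * t) * ‖ω₀ - g‖ := by
  obtain ⟨g, hgn, h⟩ := exists_small_stationary hν hf hs
  exact ⟨(g : Triple) 0, h.isNonlinearStationary g.2,
    fun ω₀ u hu t ht => hu.norm_sub_le hν g.2 hgn h ht⟩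

end

end Couette

end

theorem theorem1p2 (ν : ℝ) (hν : 0 < ν) :
    -- linearized problem, resonant forcing `f(t,x,y) = f₀(x - t y, y)`
    (∃ C : ℝ, 0 < C ∧ ∀ ω₀ f₀ : L2, ZeroXMean ω₀ → ZeroXMean f₀ →
      ∀ ω : ℝ → L2, IsLinearSolution ν (fun t => shear t f₀) ω₀ ω →
      ∃ ω₁ ω₂ : ℝ → L2,
        (∀ t : ℝ, 0 ≤ t → ω t =ᵐ[volume] fun p => shear t (ω₁ t) p + shear t (ω₂ t) p) ∧
        (∀ t : ℝ, 0 ≤ t →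
          Real.exp (ν * t ^ 3 / 12) * ‖ω₁ t‖ + ‖ω₂ t‖ ≤ C * (‖ω₀‖ + ‖f₀‖)) ∧
        Tendsto (fun t => ‖ω₂ t‖) atTop (𝓝 0) ∧
        (∀ s : ℝ, 0 ≤ s → MemHs s f₀ → ∀ t : ℝ, 0 ≤ t →
          ‖ω₂ t‖ ≤ C * (1 + t) ^ (-(min s 2)) * (sobolevENorm s f₀).toReal) ∧
        (f₀ ≠ 0 → ∃ c : ℝ, 0 < c ∧ ∀ t : ℝ, 1 ≤ t → c / t ^ 2 ≤ ‖ω₂ t‖)) ∧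
    -- linearized problem, stationary forcing `f(t,x,y) = f₀(x, y)`
    (∀ f₀ : L2, ZeroXMean f₀ → ∃ g : L2, IsLinearStationary ν f₀ g ∧
      ∀ ω₀ : L2, ZeroXMean ω₀ → ∀ ω : ℝ → L2, IsLinearSolution ν (fun _ => f₀) ω₀ ω →
        ∀ t : ℝ, 0 ≤ t → ‖ω t - g‖ ≤ Real.exp (-ν * (t + t ^ 3 / 12)) * ‖ω₀ - g‖) ∧
    -- nonlinear problem, small stationary forcing
    (∀ f : L2, ZeroXMean f → ‖f‖ ≤ ν ^ 2 / 40 → ∃ g : L2, IsNonlinearStationary ν f g ∧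
      ∀ (ω₀ : L2) (ω : ℝ → L2), IsNonlinearSolution ν f ω₀ ω →
        ∀ t : ℝ, 0 ≤ t → ‖ω t - g‖ ≤ Real.exp (-(ν / 2) * t) * ‖ω₀ - g‖) := by
  refine ⟨⟨1 + 32 / ν, by positivity, fun ω₀ f₀ h0 hf ω h => ?_⟩, fun f₀ hf => ?_, fun f hf hs => ?_⟩
  · exact h.exists_decomposition hν rfl h0 hf
  · exact exists_linear_stationary hν hf
  · exact exists_nonlinear_stationary hν hf hs
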